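/- **Setting.** Let $I\subseteq\mathbb R$ be an interval (bounded or not) and let $\rho\ge 0$ be a probability density on $I$. Its *reducer* is $$\varphi(x)=\lim_{\varepsilon\to0^+}2\int_I\frac{(x-t)\,\rho(t)}{(x-t)^2+\varepsilon^2}\,dt .$$ Put $\varphi_0=\varphi/2$ and $\mu(x)=\dfrac{\rho(x)}{\varphi(x)^2/4+\pi^2\rho(x)^2}$. Assume that $\rho$ is *reducible*, i.e. $\rho/\mu\in L^2(I,\mu(x)\,dx)$. Let $T_\rho$ be the operator $$T_\rho f(x)=\int_I\frac{f(t)-f(x)}{t-x}\,\rho(t)\,dt,$$ where the integral is understood, as for the reducer, as $\lim_{\varepsilon\to0^+}\int_I\frac{(f(t)-f(x))(t-x)}{(t-x)^2+\varepsilon^2}\rho(t)\,dt$; this is the ordinary integral whenever the latter converges absolutely. $T_\rho^{j}$ denotes the $j$-th iterate, $T_\rho^0f=f$. **Coefficients.** The universal coefficients $u_n^k,v_n^k$ ($n\ge1$, $0\le k\le\lfloor\frac{n+1}2\rfloor$) are the rational numbers defined by $u_n^0=1$, $v_n^0=n$, $u_1^1=0$, $v_1^1=1$ and, for $n\ge1$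 and $1\le q\le\lfloor\frac{n+2}2\rfloor$, $$u_{n+1}^q=\sum_{k=1}^{q-1}\frac{v_n^k\,u_{n+1-2k}^{q-k}}{n+2-2k}+\Big[\frac{v_n^q}{n+2-2q}+u_n^q\Big],$$ $$v_{n+1}^q=\sum_{k=1}^{q-1}\frac{v_n^k\,v_{n+1-2k}^{q-k}}{n+2-2k}+\Big[\frac{n+1-2q}{n+2-2q}\,v_n^q\Big]+(n+1)\,\delta_{q,1},$$ where the bracketed terms are present only if $q\le\lfloor\frac{n+1}2\rfloor$. (They are the coefficients of the expansion $(n+1)ab^n=a^{n+1}+nb^{n+1}+\sum_{k=1}^{\lfloor (n+1)/2\rfloor}(u_n^ka^{n+1-2k}+v_n^kb^{n+1-2k})c^{2k}$, valid in an algebra when $2ab=a^2+b^2+c^2$ and $bc=cb$.) **Statement.** Let $n\ge1$ and suppose that $\int_I\rho^{n+1}\,dt<\infty$. Then the limit defining $\varphi(x)$ exists for almost every $x\in I$; for all $j,k\ge0$ with $j+2k<n$ the limit defining $T_\rho\big(T_\rho^{j}(\rho^{2k})\big)(x)$ exists for almost every $x\in I$; the functions $\varphi_0^n\rho$ and $T_\rho^{n-2k}(\rho^{2k})\,\rho$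 ($0\le 2k\le n$) are integrable on $I$; $u_n^{(n+1)/2}=0$ when $n$ is odd; and $$(n+1)\int_I\varphi_0^n\,\rho\,dt=\sum_{k=0}^{\lfloor (n+1)/2\rfloor}\pi^{2k}\,u_n^k\int_I T_\rho^{\,n-2k}(\rho^{2k})\,\rho\,dt ,$$ where, for $n$ odd, the term $k=\frac{n+1}2$ (formally containing $T_\rho^{-1}$) is $0$ because its coefficient vanishes. -/

import Mathlib

open MeasureTheory Filter Topology

/-- The universal coefficients `(u_n^k, v_n^k)` of the expansion
`(n+1) a bⁿ = aⁿ⁺¹ + n bⁿ⁺¹ + ∑_{k=1}^{⌊(n+1)/2⌋} (u_n^k a^{n+1-2k} + v_n^k b^{n+1-2k}) c^{2k}`,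
valid whenever `2ab = a² + b² + c²` and `bc = cb`. They are given by `u_n^0 = 1`, `v_n^0 = n`,
`u_1^1 = 0`, `v_1^1 = 1`, and, passing from `n` to `n + 1`, for `1 ≤ q ≤ ⌊(n+2)/2⌋`,
`u_{n+1}^q = ∑_{k=1}^{q-1} v_n^k u_{n+1-2k}^{q-k} / (n+2-2k) + v_n^q / (n+2-2q) + u_n^q`,
`v_{n+1}^q = ∑_{k=1}^{q-1} v_n^k v_{n+1-2k}^{q-k} / (n+2-2k) + (n+1-2q) / (n+2-2q) * v_n^q`,
with `n + 1` added to the second one when `q = 1`, and where the terms with upper index `q` on the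
right are present only for `q ≤ ⌊(n+1)/2⌋`. In the code the summation index is `j = k - 1`. -/
def universalCoeffs : ℕ → ℕ → ℚ × ℚ
  | 0, q => if q = 0 then (1, 0) else (0, 0)
  | 1, q => if q = 0 then (1, 1) else if q = 1 then (0, 1) else (0, 0)
  | n + 2, q =>
    -- the step from `m = n + 1` to `m + 1`
    let m : ℕ := n + 1
    if q = 0 then (1, (m : ℚ) + 1)
    else if (m + 2) / 2 < q then (0, 0)
    else
      (∑ j ∈ Finset.range (q - 1),
          (universalCoeffs (n + 1) (j + 1)).2 * (universalCoeffs (n - 2 * j) (q - (j + 1))).1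
            / ((m : ℚ) + 2 - 2 * ((j : ℚ) + 1))
        + (if q ≤ (m + 1) / 2 then
            (universalCoeffs (n + 1) q).2 / ((m : ℚ) + 2 - 2 * q) + (universalCoeffs (n + 1) q).1
          else 0),
       ∑ j ∈ Finset.range (q - 1),
          (universalCoeffs (n + 1) (j + 1)).2 * (universalCoeffs (n - 2 * j) (q - (j + 1))).2
            / ((m : ℚ) + 2 - 2 * ((j : ℚ) + 1))
        + (if q ≤ (m + 1) / 2 then
            ((m : ℚ) + 1 - 2 * q) / ((m : ℚ) + 2 - 2 * q) * (universalCoeffs (n + 1) q).2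
          else 0)
        + (if q = 1 then (m : ℚ) + 1 else 0))
  termination_by n => n
  decreasing_by all_goals omega

/-- The universal coefficient `u_n^k`. -/
def uCoeff (n k : ℕ) : ℚ := (universalCoeffs n k).1

/-- The integral `2 ∫_I (x - t) ρ(t) / ((x - t)² + ε²) dt`, whose limit as `ε → 0⁺` is the
reducer. -/
noncomputable def reducerApprox (I : Set ℝ) (ρ : ℝ → ℝ) (x ε : ℝ) : ℝ :=
  2 * ∫ t in I, (x - t) * ρ t / ((x - t) ^ 2 + ε ^ 2)

/-- The reducer `φ(x) = lim_{ε → 0⁺} 2 ∫_I (x - t) ρ(t) / ((x - t)² + ε²) dt`. -/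
noncomputable def reducer (I : Set ℝ) (ρ : ℝ → ℝ) (x : ℝ) : ℝ :=
  limUnder (𝓝[>] (0 : ℝ)) (reducerApprox I ρ x)

/-- The density `μ = ρ / (φ² / 4 + π² ρ²)` on `I`. -/
noncomputable def secondaryDensity (I : Set ℝ) (ρ : ℝ → ℝ) (x : ℝ) : ℝ :=
  ρ x / (reducer I ρ x ^ 2 / 4 + Real.pi ^ 2 * ρ x ^ 2)

/-- The measure `μ(x) dx` on `I`. -/
noncomputable def secondaryMeasure (I : Set ℝ) (ρ : ℝ → ℝ) : Measure ℝ :=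
  (volume.restrict I).withDensity fun x => ENNReal.ofReal (secondaryDensity I ρ x)

/-- The measure of density `ρ` on `I` is reducible: `ρ / μ` belongs to `L²(I, μ)`. -/
def IsReducibleDensity (I : Set ℝ) (ρ : ℝ → ℝ) : Prop :=
  MemLp (fun x => ρ x / secondaryDensity I ρ x) 2 (secondaryMeasure I ρ)

/-- The integral of `(f(t) - f(x)) / (t - x) ρ(t)` over `I`, with `1 / (t - x)` regularized to
`(t - x) / ((t - x)² + ε²)` exactly as in the definition of the reducer. -/
noncomputable def transformApprox (I : Set ℝ) (ρ f : ℝ → ℝ) (x ε : ℝ) : ℝ :=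
  ∫ t in I, (f t - f x) * (t - x) / ((t - x) ^ 2 + ε ^ 2) * ρ t

/-- The operator `T_ρ f(x) = ∫_I (f(t) - f(x)) / (t - x) ρ(t) dt`, the integral being taken as the
limit of its regularizations, so that it also makes sense where it is not absolutely convergent.
Where it is absolutely convergent it is the usual integral: see
`transform_eq_integral`. -/
noncomputable def transform (I : Set ℝ) (ρ f : ℝ → ℝ) (x : ℝ) : ℝ :=
  limUnder (𝓝[>] (0 : ℝ)) (transformApprox I ρ f x)

theorem transform_eq_integral (I : Set ℝ) (ρ f : ℝ → ℝ) (x : ℝ)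
    (h : IntegrableOn (fun t => (f t - f x) / (t - x) * ρ t) I) :
    transform I ρ f x = ∫ t in I, (f t - f x) / (t - x) * ρ t := by
  refine Tendsto.limUnder_eq ?_
  have key : ∀ t ε : ℝ, (f t - f x) * (t - x) / ((t - x) ^ 2 + ε ^ 2) * ρ t
      = (t - x) ^ 2 / ((t - x) ^ 2 + ε ^ 2) * ((f t - f x) / (t - x) * ρ t) := by
    intro t ε
    rcases eq_or_ne t x with rfl | ht
    · simp
    · have h1 : t - x ≠ 0 := sub_ne_zero.mpr ht
      have h2 : (t - x) ^ 2 + ε ^ 2 ≠ 0 := by positivity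
      field_simp
  unfold transformApprox
  simp only [key]
  refine tendsto_integral_filter_of_dominated_convergence
    (fun t => ‖(f t - f x) / (t - x) * ρ t‖) ?_ ?_ h.norm ?_
  · refine Eventually.of_forall fun ε => ?_
    refine AEStronglyMeasurable.mul ?_ h.aestronglyMeasurable
    exact Measurable.aestronglyMeasurable (by fun_prop)
  · refine Eventually.of_forall fun ε => Eventually.of_forall fun t => ?_
    rw [norm_mul]
    refine mul_le_of_le_one_left (norm_nonneg _) ?_
    rw [Real.norm_of_nonneg (by positivity)]
    exact div_le_one_of_le₀ (by nlinarith [sq_nonneg ε]) (by positivity)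
  · refine Eventually.of_forall fun t => ?_
    rcases eq_or_ne t x with rfl | ht
    · simp
    · have h1 : (t - x) ^ 2 ≠ 0 := pow_ne_zero _ (sub_ne_zero.mpr ht)
      have h3 : ContinuousAt (fun ε : ℝ => (t - x) ^ 2 / ((t - x) ^ 2 + ε ^ 2)
          * ((f t - f x) / (t - x) * ρ t)) 0 := by
        refine ContinuousAt.mul (ContinuousAt.div ?_ ?_ ?_) continuousAt_const
        · fun_prop
        · fun_prop
        · simpa using h1
      have h4 := h3.tendsto.mono_left (nhdsWithin_le_nhds (s := Set.Ioi (0 : ℝ)))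
      simpa [div_self h1] using h4

/-! Extend the density by zero to `r` on the whole line, and let `H` be the unnormalized Hilbert
transform, the limit of the conjugate Poisson integrals. Almost everywhere `φ₀ = H r` and `T f = f ·
H r - H (f r)`. Let `a = T`, let `b` be multiplication by `φ₀`, let `c` be multiplication by `π² ρ²`
(it plays the role of `c²` in the universal expansion), and let `L f = ∫ f ρ`. Two classical facts
about `H` carry everything. Tricomi's identity `H (u Hg + g Hu) = Hu Hg - π² u g`, with `u = r` and
`g = f r`, becomes `2ab = a² + b² + c`. The antisymmetry of `H` becomes `L (a f) = 2 L (b f)`. The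
rest is algebra: the relation and `bc = cb` expand `a bᵐ` with the universal coefficients
(`FilteredTriple.expansion`), and applying `L` and inducting removes the remaining powers of `b`
(`FilteredTriple.functional`). The theorem is the case `f = 1`.

The operators make sense only under integrability conditions, which a filtration records: degree `d`
consists of the `f` with `f r` in `L¹ ∩ L^((n+1)/(d+1))`. Since `r` and `H r` lie in `L^(n+1)`,
Hölder's inequality shows that `a` and `b` raise the degree by 1 and `c` by 2. For `d < n` the
exponent exceeds 1 and `H` is bounded by M. Riesz's theorem; in degree `n` only integrability is
left, which is what `L` needs.

The facts about `H` come from the Cauchy transform `F = P f + i Q f` in the upper half plane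
(Poisson and conjugate Poisson integrals). Riesz's bound for `1 < p ≤ 2` integrates a pointwise
inequality between `|F|^p`, `(Re F)^p` and `Re F^p`, the last having integral zero; `p > 2` follows
by duality. The semigroup rule `Q_ε P_δ = π Q_(ε+δ)` then makes `Q_ε f` Cauchy in `L^p`, and `P_ε (H
f) = π Q_ε f` gives the limit almost everywhere, because Poisson integrals converge at Lebesgue
points. Tricomi's identity is the vanishing of the integral of `F_f F_g` against a Cauchy kernel. -/

/-! ### Universal coefficients: uniform recursions and vanishing. -/

/-- The universal coefficient `v_n^k`. -/
def vCoeff (n k : ℕ) : ℚ := (universalCoeffs n k).2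

theorem uCoeff_zero_left (k : ℕ) : uCoeff 0 k = if k = 0 then 1 else 0 := by
  unfold uCoeff; rw [universalCoeffs]; split_ifs <;> rfl

theorem vCoeff_zero_left (k : ℕ) : vCoeff 0 k = 0 := by
  unfold vCoeff; rw [universalCoeffs]; split_ifs <;> rfl

theorem uCoeff_one_left (k : ℕ) : uCoeff 1 k = if k = 0 then 1 else 0 := by
  unfold uCoeff; rw [universalCoeffs]; split_ifs <;> rfl

theorem vCoeff_one_left (k : ℕ) : vCoeff 1 k = if k = 0 then 1 else if k = 1 then 1 else 0 := by
  unfold vCoeff; rw [universalCoeffs]; split_ifs <;> rfl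

theorem uCoeff_zero_right (n : ℕ) : uCoeff n 0 = 1 := by
  match n with
  | 0 => simp [uCoeff_zero_left]
  | 1 => simp [uCoeff_one_left]
  | n + 2 => unfold uCoeff; rw [universalCoeffs]; simp

theorem vCoeff_zero_right (n : ℕ) : vCoeff n 0 = n := by
  match n with
  | 0 => simp [vCoeff_zero_left]
  | 1 => simp [vCoeff_one_left]
  | n + 2 => unfold vCoeff; rw [universalCoeffs]; simp; ring

theorem universalCoeffs_eq_zero {n q : ℕ} (h : (n + 1) / 2 < q) : universalCoeffs n q = (0, 0) := by
  match n with
  | 0 => rw [universalCoeffs, if_neg (by omega)]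
  | 1 => rw [universalCoeffs, if_neg (by omega), if_neg (by omega)]
  | n + 2 =>
    rw [universalCoeffs, if_neg (by omega), if_pos (by omega)]

theorem uCoeff_eq_zero {n q : ℕ} (h : (n + 1) / 2 < q) : uCoeff n q = 0 := by
  unfold uCoeff; rw [universalCoeffs_eq_zero h]

theorem vCoeff_eq_zero {n q : ℕ} (h : (n + 1) / 2 < q) : vCoeff n q = 0 := by
  unfold vCoeff; rw [universalCoeffs_eq_zero h]

/-- The bracketed term of the definition is the summand `j = p`, because `u_N^0 = 1`. Coefficients
out of range vanish, so one formula holds for all `m` and `p`. -/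
theorem uCoeff_succ (m p : ℕ) :
    uCoeff (m + 1) (p + 1) = uCoeff m (p + 1) + ∑ j ∈ Finset.range (p + 1),
      vCoeff m (j + 1) / ((m : ℚ) - 2 * j) * uCoeff (m - 1 - 2 * j) (p - j) := by
  rcases m with _ | n
  · simp [uCoeff_one_left, uCoeff_zero_left, vCoeff_zero_left]
  by_cases hp : (n + 3) / 2 < p + 1
  · rw [uCoeff_eq_zero (by omega), uCoeff_eq_zero (by omega), Finset.sum_eq_zero, add_zero]
    intro j hj
    by_cases hj' : (n + 2) / 2 < j + 1
    · rw [vCoeff_eq_zero (by omega)]; simp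
    · rw [uCoeff_eq_zero (n := n + 1 - 1 - 2 * j) (by omega)]; simp
  · have h : uCoeff (n + 1 + 1) (p + 1) =
      ∑ j ∈ Finset.range p, vCoeff (n + 1) (j + 1) * uCoeff (n - 2 * j) (p + 1 - (j + 1))
            / (((n + 1 : ℕ) : ℚ) + 2 - 2 * ((j : ℚ) + 1))
        + (if p + 1 ≤ (n + 1 + 1) / 2 then
            vCoeff (n + 1) (p + 1) / (((n + 1 : ℕ) : ℚ) + 2 - 2 * (p + 1 : ℕ)) + uCoeff (n + 1) (p + 1)
          else 0) := by
      conv_lhs => unfold uCoeff; rw [universalCoeffs]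
      rw [if_neg (by omega), if_neg (by omega)]
      simp [uCoeff, vCoeff]
    rw [h, Finset.sum_range_succ, add_left_comm]
    congr 1
    · refine Finset.sum_congr rfl fun j hj => ?_
      simp only [Nat.add_sub_add_right, Nat.add_sub_cancel]
      rw [div_mul_eq_mul_div]
      congr 1
      ring
    · simp only [Nat.sub_self, uCoeff_zero_right, mul_one]
      split_ifs with h1
      · rw [add_comm]
        congr 2
        push_cast
        ring
      · rw [uCoeff_eq_zero (by omega), vCoeff_eq_zero (by omega)]
        simp

/-- Here the bracketed term is the summand `j = p` because `v_N^0 = N` with `N = m - 1 - 2p`. -/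
theorem vCoeff_succ (m p : ℕ) :
    vCoeff (m + 1) (p + 1) = (if p = 0 then (m : ℚ) + 1 else 0) + ∑ j ∈ Finset.range (p + 1),
      vCoeff m (j + 1) / ((m : ℚ) - 2 * j) * vCoeff (m - 1 - 2 * j) (p - j) := by
  rcases m with _ | n
  · rcases p with _ | p <;> simp [vCoeff_one_left, vCoeff_zero_left]
  by_cases hp : (n + 3) / 2 < p + 1
  · rw [vCoeff_eq_zero (by omega), if_neg (by omega), Finset.sum_eq_zero, add_zero]
    intro j hj
    by_cases hj' : (n + 2) / 2 < j + 1
    · rw [vCoeff_eq_zero (by omega)]; simp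
    · rw [vCoeff_eq_zero (n := n + 1 - 1 - 2 * j) (by omega)]; simp
  · have h : vCoeff (n + 1 + 1) (p + 1) =
      ∑ j ∈ Finset.range p, vCoeff (n + 1) (j + 1) * vCoeff (n - 2 * j) (p + 1 - (j + 1))
            / (((n + 1 : ℕ) : ℚ) + 2 - 2 * ((j : ℚ) + 1))
        + (if p + 1 ≤ (n + 1 + 1) / 2 then
            (((n + 1 : ℕ) : ℚ) + 1 - 2 * (p + 1 : ℕ)) / (((n + 1 : ℕ) : ℚ) + 2 - 2 * (p + 1 : ℕ))
              * vCoeff (n + 1) (p + 1)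
          else 0) + (if p + 1 = 1 then ((n + 1 : ℕ) : ℚ) + 1 else 0) := by
      conv_lhs => unfold vCoeff; rw [universalCoeffs]
      rw [if_neg (by omega), if_neg (by omega)]
      simp [vCoeff]
    rw [h, Finset.sum_range_succ, add_comm]
    congr 1
    · simp
    congr 1
    · refine Finset.sum_congr rfl fun j hj => ?_
      simp only [Nat.add_sub_add_right, Nat.add_sub_cancel]
      rw [div_mul_eq_mul_div]
      congr 1
      ring
    · simp only [Nat.sub_self, vCoeff_zero_right]
      split_ifs with h1
      · have h2 : ((n + 1 - 1 - 2 * p : ℕ) : ℚ) = n - 2 * p := by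
          rw [Nat.cast_sub (by omega)]; simp
        rw [h2, div_mul_eq_mul_div, mul_comm, div_mul_eq_mul_div]
        push_cast
        ring_nf
      · rw [vCoeff_eq_zero (by omega)]
        simp

/-- In the recursion for `u_{2p+1}^{p+1}` the isolated term and the summand `j = p` are out of
range, and every other summand contains `u_{2p-1-2j}^{p-j}`, again a top coefficient of odd index.
-/
theorem uCoeff_top_eq_zero {n : ℕ} (h : Odd n) : uCoeff n ((n + 1) / 2) = 0 := by
  induction n using Nat.strong_induction_on with
  | _ n ih =>
    obtain ⟨p, rfl⟩ := h
    rw [show (2 * p + 1 + 1) / 2 = p + 1 by omega, uCoeff_succ, uCoeff_eq_zero (by omega), zero_add]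
    refine Finset.sum_eq_zero fun j hj => ?_
    rw [Finset.mem_range] at hj
    rcases eq_or_ne j p with rfl | hjp
    · rw [vCoeff_eq_zero (by omega)]; simp
    · have := ih (2 * p - 1 - 2 * j) (by omega) ⟨p - 1 - j, by omega⟩
      rw [show (2 * p - 1 - 2 * j + 1) / 2 = p - j by omega] at this
      rw [this, mul_zero]

/-! ### Algebra of the relation `2ab = a² + b² + c` on a filtered space. -/

section Words

variable {V : Type*} [AddCommGroup V] [Module ℝ V]

/-- The recursion summed against arbitrary vectors: the convolution of coefficients becomes an
iterated sum along the diagonals `q = i + j + 1`, the shape produced by an induction hypothesis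
applied to `c ^ (j + 1) f`. -/
theorem sum_uCoeff_succ (m K : ℕ) (G : ℕ → V) :
    ∑ q ∈ Finset.range (K + 1), (uCoeff (m + 1) q : ℝ) • G q =
      ∑ q ∈ Finset.range (K + 1), (uCoeff m q : ℝ) • G q +
      ∑ j ∈ Finset.range K, ((vCoeff m (j + 1) / ((m : ℚ) - 2 * j) : ℚ) : ℝ) •
        ∑ i ∈ Finset.range (K - j), (uCoeff (m - 1 - 2 * j) i : ℝ) • G (i + j + 1) := by
  rw [Finset.sum_range_succ', Finset.sum_range_succ' _ K]
  simp only [uCoeff_zero_right, Finset.smul_sum, smul_smul]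
  rw [← Finset.sum_range_diag_flip K fun j i =>
    (((vCoeff m (j + 1) / ((m : ℚ) - 2 * j) : ℚ) : ℝ) * (uCoeff (m - 1 - 2 * j) i : ℝ))
      • G (i + j + 1)]
  rw [add_right_comm, ← Finset.sum_add_distrib]
  congr 1
  refine Finset.sum_congr rfl fun q _ => ?_
  rw [uCoeff_succ, Rat.cast_add, add_smul, Rat.cast_sum, Finset.sum_smul]
  congr 1
  refine Finset.sum_congr rfl fun j hj => ?_
  rw [Finset.mem_range] at hj
  rw [Rat.cast_mul, show q - j + j + 1 = q + 1 by omega]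

theorem sum_vCoeff_succ (m K : ℕ) (G : ℕ → V) :
    ∑ q ∈ Finset.range (K + 2), (vCoeff (m + 1) q : ℝ) • G q =
      ((m : ℝ) + 1) • G 0 + ((m : ℝ) + 1) • G 1 +
      ∑ j ∈ Finset.range (K + 1), ((vCoeff m (j + 1) / ((m : ℚ) - 2 * j) : ℚ) : ℝ) •
        ∑ i ∈ Finset.range (K + 1 - j), (vCoeff (m - 1 - 2 * j) i : ℝ) • G (i + j + 1) := by
  rw [Finset.sum_range_succ']
  simp only [vCoeff_zero_right, Finset.smul_sum, smul_smul]
  rw [← Finset.sum_range_diag_flip (K + 1) fun j i =>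
    (((vCoeff m (j + 1) / ((m : ℚ) - 2 * j) : ℚ) : ℝ) * (vCoeff (m - 1 - 2 * j) i : ℝ))
      • G (i + j + 1)]
  have h0 : ((m : ℝ) + 1) • G 1 =
      ∑ q ∈ Finset.range (K + 1), (((if q = 0 then (m : ℚ) + 1 else 0) : ℚ) : ℝ) • G (q + 1) := by
    rw [Finset.sum_eq_single 0]
    · simp
    · intro b _ hb; simp [hb]
    · simp
  rw [add_assoc, h0, ← Finset.sum_add_distrib, add_comm]
  push_cast
  congr 1
  refine Finset.sum_congr rfl fun q _ => ?_
  rw [vCoeff_succ, Rat.cast_add, add_smul, Rat.cast_sum, Finset.sum_smul]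
  congr 1
  refine Finset.sum_congr rfl fun j hj => ?_
  rw [Finset.mem_range] at hj
  rw [Rat.cast_mul, show q - j + j + 1 = q + 1 by omega]
  push_cast
  rfl

/-- Linear maps `a`, `b`, `c` (the last one playing the role of a square) which raise the degree of
an increasing filtration by `1`, `1`, `2` and satisfy `2ab = a² + b² + c`, `bc = cb` in degrees
`≤ n`. -/
structure FilteredTriple (a b c : V →ₗ[ℝ] V) (X : ℕ → Submodule ℝ V) (n : ℕ) : Prop where
  map_b : ∀ d < n, ∀ f ∈ X d, b f ∈ X (d + 1)
  map_c : ∀ d, d + 2 ≤ n → ∀ f ∈ X d, c f ∈ X (d + 2)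
  comm : ∀ f, b (c f) = c (b f)
  rel : ∀ d, d + 2 ≤ n → ∀ f ∈ X d, (2 : ℝ) • a (b f) = a (a f) + b (b f) + c f

variable {a b c : V →ₗ[ℝ] V} {X : ℕ → Submodule ℝ V} {n : ℕ}

namespace FilteredTriple

theorem pow_b_mem (h : FilteredTriple a b c X n) {d m : ℕ} (hd : d + m ≤ n) {f : V} (hf : f ∈ X d) :
    (b ^ m) f ∈ X (d + m) := by
  induction m with
  | zero => simpa using hf
  | succ m ih =>
    rw [pow_succ', Module.End.mul_apply]
    exact h.map_b (d + m) (by omega) _ (ih (by omega))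

theorem pow_c_mem (h : FilteredTriple a b c X n) {d m : ℕ} (hd : d + 2 * m ≤ n) {f : V}
    (hf : f ∈ X d) : (c ^ m) f ∈ X (d + 2 * m) := by
  induction m with
  | zero => simpa using hf
  | succ m ih =>
    rw [pow_succ', Module.End.mul_apply]
    exact h.map_c (d + 2 * m) (by omega) _ (ih (by omega))

theorem pow_b_c (h : FilteredTriple a b c X n) (m : ℕ) (f : V) : (b ^ m) (c f) = c ((b ^ m) f) := by
  have : Commute b c := LinearMap.ext h.comm
  exact LinearMap.congr_fun (this.pow_left m) f

/-- Induction on `m`. Apply `a` to the expansion of `a bᵐ`. On the left `a² bᵐ = 2 a bᵐ⁺¹ - bᵐ⁺² - c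
bᵐ`; on the right each `a b^(m+1-2k) cᵏ` with `k ≥ 1` is expanded by induction, while `k = 0` gives
`m a bᵐ⁺¹`. Collecting leaves `(m + 2) a bᵐ⁺¹`, and the coefficients obey the defining recursion;
the term `(m + 1) c bᵐ` accounts for the Kronecker delta in it. -/
theorem expansion (h : FilteredTriple a b c X n) (m : ℕ) : ∀ {d K : ℕ} {f : V}, f ∈ X d →
    d + m + 1 ≤ n → (m + 1) / 2 < K →
    ((m : ℝ) + 1) • a ((b ^ m) f) =
      ∑ k ∈ Finset.range K, (uCoeff m k : ℝ) • (a ^ (m + 1 - 2 * k)) ((c ^ k) f) +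
      ∑ k ∈ Finset.range K, (vCoeff m k : ℝ) • (b ^ (m + 1 - 2 * k)) ((c ^ k) f) := by
  induction m using Nat.strong_induction_on with
  | _ m ih =>
  intro d K f hf hd hK
  rcases m with _ | m
  · obtain ⟨K, rfl⟩ : ∃ K', K = K' + 1 := ⟨K - 1, by omega⟩
    simp [uCoeff_zero_left, vCoeff_zero_left, Finset.sum_range_succ']
  · obtain ⟨K, rfl⟩ : ∃ K', K = K' + 2 := ⟨K - 2, by omega⟩
    rw [sum_uCoeff_succ, sum_vCoeff_succ]
    have e := congrArg a (ih m (by omega) (K := K + 2) hf (by omega) (by omega))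
    simp only [map_smul, map_add, map_sum] at e
    have r := h.rel (d + m) (by omega) _ (h.pow_b_mem (by omega) hf)
    rw [Finset.sum_range_succ' (fun k => (vCoeff m k : ℝ) • _)] at e
    simp only [vCoeff_zero_right] at e
    have e1 : ∑ k ∈ Finset.range (K + 2), (uCoeff m k : ℝ) • a ((a ^ (m + 1 - 2 * k)) ((c ^ k) f))
        = ∑ k ∈ Finset.range (K + 2), (uCoeff m k : ℝ) • (a ^ (m + 1 + 1 - 2 * k)) ((c ^ k) f) := by
      refine Finset.sum_congr rfl fun k _ => ?_
      by_cases hk : (m + 1) / 2 < k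
      -- Beyond `2k ≤ m + 1` the natural subtractions truncate and the powers of `a` disagree, but
      -- there the coefficient is zero.
      · simp [uCoeff_eq_zero hk]
      · rw [show m + 1 + 1 - 2 * k = m + 1 - 2 * k + 1 by omega, pow_succ' a, Module.End.mul_apply]
    have e2 : ∑ k ∈ Finset.range (K + 1),
          (vCoeff m (k + 1) : ℝ) • a ((b ^ (m + 1 - 2 * (k + 1))) ((c ^ (k + 1)) f))
        = ∑ j ∈ Finset.range (K + 1), ((vCoeff m (j + 1) / ((m : ℚ) - 2 * j) : ℚ) : ℝ) •
          (∑ i ∈ Finset.range (K + 1 - j), (uCoeff (m - 1 - 2 * j) i : ℝ) •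
              (a ^ (m + 1 + 1 - 2 * (i + j + 1))) ((c ^ (i + j + 1)) f) +
            ∑ i ∈ Finset.range (K + 1 - j), (vCoeff (m - 1 - 2 * j) i : ℝ) •
              (b ^ (m + 1 + 1 - 2 * (i + j + 1))) ((c ^ (i + j + 1)) f)) := by
      refine Finset.sum_congr rfl fun j _ => ?_
      by_cases hj : (m + 1) / 2 < j + 1
      · simp [vCoeff_eq_zero hj]
      · have := ih (m - 1 - 2 * j) (by omega) (K := K + 1 - j)
          (h.pow_c_mem (m := j + 1) (by omega) hf) (by omega) (by omega)
        have hm : (((m - 1 - 2 * j : ℕ) : ℝ) + 1) = (m : ℝ) - 2 * j := by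
          rw [Nat.cast_sub (by omega), Nat.cast_sub (by omega)]; push_cast; ring
        have hm0 : (m : ℝ) - 2 * j ≠ 0 := by
          rw [← hm]; positivity
        have e3 : ∀ (x : V →ₗ[ℝ] V) (i : ℕ),
            (x ^ (m - 1 - 2 * j + 1 - 2 * i)) ((c ^ i) ((c ^ (j + 1)) f)) =
            (x ^ (m + 1 + 1 - 2 * (i + j + 1))) ((c ^ (i + j + 1)) f) := by
          intro x i
          rw [show m - 1 - 2 * j + 1 - 2 * i = m + 1 + 1 - 2 * (i + j + 1) by omega,
            ← Module.End.mul_apply (c ^ i), ← pow_add, add_assoc i j 1]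
        simp only [e3] at this
        rw [← this, show m + 1 - 2 * (j + 1) = m - 1 - 2 * j by omega, hm, smul_smul]
        push_cast
        rw [div_mul_cancel₀ _ hm0]
    rw [e1, e2] at e
    simp only [smul_add, Finset.sum_add_distrib] at e
    simp only [pow_zero, Module.End.one_apply, Nat.mul_zero, Nat.sub_zero, mul_one,
      pow_one] at e ⊢
    rw [show m + 1 + 1 - 2 = m by omega]
    rw [h.pow_b_c, pow_succ' b (m + 1), pow_succ' b m]
    simp only [Module.End.mul_apply]
    rw [pow_succ' b m] at e
    simp only [Module.End.mul_apply] at e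
    have r' : a (a ((b ^ m) f)) = (2 : ℝ) • a (b ((b ^ m) f)) - b (b ((b ^ m) f)) - c ((b ^ m) f) := by
      rw [r]; abel
    rw [r'] at e
    rw [← sub_eq_zero] at e ⊢
    rw [← e]
    push_cast
    module

/-- Applying `L` to the expansion of `a bᵐ f`, the left side is `2(m + 1) L (bᵐ⁺¹ f)` and the right
side contains `m L (bᵐ⁺¹ f)`, so `(m + 2) L (bᵐ⁺¹ f)` remains. The other `b`-terms `L (b^(m+1-2k)
(cᵏ f))` are replaced by induction, and this is exactly the recursion of `u` alone. -/
theorem functional (h : FilteredTriple a b c X n) {L : V →ₗ[ℝ] ℝ}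
    (hL : ∀ d < n, ∀ f ∈ X d, L (a f) = 2 * L (b f)) (m : ℕ) : ∀ {d K : ℕ} {f : V}, f ∈ X d →
    d + m ≤ n → (m + 1) / 2 < K →
    ((m : ℝ) + 1) * L ((b ^ m) f) =
      ∑ k ∈ Finset.range K, (uCoeff m k : ℝ) * L ((a ^ (m - 2 * k)) ((c ^ k) f)) := by
  induction m using Nat.strong_induction_on with
  | _ m ih =>
  intro d K f hf hd hK
  rcases m with _ | m
  · obtain ⟨K, rfl⟩ : ∃ K', K = K' + 1 := ⟨K - 1, by omega⟩
    simp [uCoeff_zero_left, Finset.sum_range_succ']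
  · obtain ⟨K, rfl⟩ : ∃ K', K = K' + 2 := ⟨K - 2, by omega⟩
    have s := sum_uCoeff_succ m (K + 1) fun q => L ((a ^ (m + 1 - 2 * q)) ((c ^ q) f))
    simp only [smul_eq_mul] at s
    rw [s]
    have e := congrArg L (h.expansion m (K := K + 2) hf (by omega) (by omega))
    simp only [map_smul, map_add, map_sum, smul_eq_mul] at e
    rw [hL (d + m) (by omega) _ (h.pow_b_mem (by omega) hf)] at e
    rw [Finset.sum_range_succ' (fun k => (vCoeff m k : ℝ) * _)] at e
    simp only [vCoeff_zero_right] at e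
    have e2 : ∑ k ∈ Finset.range (K + 1),
          (vCoeff m (k + 1) : ℝ) * L ((b ^ (m + 1 - 2 * (k + 1))) ((c ^ (k + 1)) f))
        = ∑ j ∈ Finset.range (K + 1), ((vCoeff m (j + 1) / ((m : ℚ) - 2 * j) : ℚ) : ℝ) *
          (∑ i ∈ Finset.range (K + 1 - j), (uCoeff (m - 1 - 2 * j) i : ℝ) *
              L ((a ^ (m + 1 - 2 * (i + j + 1))) ((c ^ (i + j + 1)) f))) := by
      refine Finset.sum_congr rfl fun j _ => ?_
      by_cases hj : (m + 1) / 2 < j + 1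
      · simp [vCoeff_eq_zero hj]
      · have := ih (m - 1 - 2 * j) (by omega) (K := K + 1 - j)
          (h.pow_c_mem (m := j + 1) (by omega) hf) (by omega) (by omega)
        have hm : (((m - 1 - 2 * j : ℕ) : ℝ) + 1) = (m : ℝ) - 2 * j := by
          rw [Nat.cast_sub (by omega), Nat.cast_sub (by omega)]; push_cast; ring
        have hm0 : (m : ℝ) - 2 * j ≠ 0 := by
          rw [← hm]; positivity
        have e3 : ∀ i : ℕ,
            (a ^ (m - 1 - 2 * j - 2 * i)) ((c ^ i) ((c ^ (j + 1)) f)) =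
            (a ^ (m + 1 - 2 * (i + j + 1))) ((c ^ (i + j + 1)) f) := by
          intro i
          rw [show m - 1 - 2 * j - 2 * i = m + 1 - 2 * (i + j + 1) by omega,
            ← Module.End.mul_apply (c ^ i), ← pow_add, add_assoc i j 1]
        simp only [e3] at this
        rw [← this, show m + 1 - 2 * (j + 1) = m - 1 - 2 * j by omega, hm, ← mul_assoc]
        push_cast
        rw [div_mul_cancel₀ _ hm0]
    rw [e2] at e
    simp only [pow_zero, Module.End.one_apply, Nat.mul_zero, Nat.sub_zero] at e
    rw [pow_succ' b m] at e ⊢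
    simp only [Module.End.mul_apply] at e ⊢
    push_cast at e ⊢
    linarith

end FilteredTriple

end Words

/-! ### Contour integrals and the Poisson formula in the upper half plane. -/

section UpperHalfPlane

open Complex Set

/-- Cauchy's theorem on the rectangle with corners `-R` and `R + iR`: the three sides off the real
axis have total length `4R`, and `g` is at most `C / R²` on them. -/
theorem integral_eq_zero_of_norm_le_div_sq {g : ℂ → ℂ} (hc : ContinuousOn g {z | 0 ≤ z.im})
    (hd : DifferentiableOn ℂ g {z | 0 < z.im}) {C R₀ : ℝ}
    (hb : ∀ z : ℂ, 0 ≤ z.im → R₀ ≤ ‖z‖ → ‖g z‖ ≤ C / ‖z‖ ^ 2)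
    (hi : Integrable fun x : ℝ => g x) : ∫ x : ℝ, g x = 0 := by
  have key : ∀ R : ℝ, max R₀ 1 ≤ R → ‖∫ x in (-R)..R, g x‖ ≤ 4 * C / R := by
    intro R hR
    have hR0 : R₀ ≤ R := (le_max_left _ _).trans hR
    have hR1 : 1 ≤ R := (le_max_right _ _).trans hR
    have hRpos : 0 < R := by linarith
    have hC : 0 ≤ C := by
      have h1 := hb (R : ℂ) (by simp) (by simpa [abs_of_pos hRpos] using hR0)
      have h2 : 0 ≤ C / ‖(R : ℂ)‖ ^ 2 := (norm_nonneg _).trans h1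
      by_contra hC
      have : C / ‖(R : ℂ)‖ ^ 2 < 0 :=
        div_neg_of_neg_of_pos (not_le.1 hC) (by rw [norm_real, Real.norm_eq_abs, sq_abs]; positivity)
      linarith
    have hbound : ∀ z : ℂ, 0 ≤ z.im → R ≤ ‖z‖ → ‖g z‖ ≤ C / R ^ 2 := by
      intro z hz hzR
      refine (hb z hz (hR0.trans hzR)).trans ?_
      gcongr
    have h := integral_boundary_rect_eq_zero_of_continuousOn_of_differentiableOn g
      (-R : ℂ) (R + R * I) ?_ ?_
    · have e1 : ‖∫ x in (-R)..R, g (x + R * I)‖ ≤ C / R ^ 2 * |R - -R| := by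
        refine intervalIntegral.norm_integral_le_of_norm_le_const fun x _ => ?_
        refine hbound _ (by simp [hRpos.le]) ?_
        calc R = |(x + R * I : ℂ).im| := by simp [abs_of_pos hRpos]
          _ ≤ _ := abs_im_le_norm _
      have e2 : ∀ s : ℝ, |s| = R → ‖∫ y in (0 : ℝ)..R, g (s + y * I)‖ ≤ C / R ^ 2 * |R - 0| := by
        intro s hs
        refine intervalIntegral.norm_integral_le_of_norm_le_const fun y hy => ?_
        rw [uIoc_of_le hRpos.le] at hy
        refine hbound _ (by simpa using hy.1.le) ?_
        calc R = |(s + y * I : ℂ).re| := by simp [hs]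
          _ ≤ _ := abs_re_le_norm _
      have e3 := e2 R (abs_of_pos hRpos)
      have e4 := e2 (-R) (by rw [abs_neg, abs_of_pos hRpos])
      simp only [neg_re, ofReal_re, neg_im, ofReal_im, neg_zero, ofReal_zero, zero_mul, add_zero,
        add_re, mul_re, I_re, mul_zero, I_im, mul_one, sub_self, add_im, mul_im, zero_add,
        smul_eq_mul, ofReal_neg] at h e1 e3 e4
      have e5 : ∫ x in (-R)..R, g x = (∫ x in (-R)..R, g (x + R * I)) -
          I * (∫ y in (0 : ℝ)..R, g (R + y * I)) + I * ∫ y in (0 : ℝ)..R, g (-R + y * I) := by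
        linear_combination h
      rw [e5]
      have e6 : ‖I * ∫ y in (0 : ℝ)..R, g (R + y * I)‖ ≤ C / R ^ 2 * |R - 0| := by
        rwa [norm_mul, norm_I, one_mul]
      have e7 : ‖I * ∫ y in (0 : ℝ)..R, g (-R + y * I)‖ ≤ C / R ^ 2 * |R - 0| := by
        rwa [norm_mul, norm_I, one_mul]
      refine (norm_add_le _ _).trans ((add_le_add (norm_sub_le _ _) le_rfl).trans ?_)
      rw [sub_zero, abs_of_pos hRpos] at e6 e7
      rw [abs_of_pos (by linarith)] at e1
      calc _ ≤ C / R ^ 2 * (R - -R) + C / R ^ 2 * R + C / R ^ 2 * R := by gcongr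
        _ = 4 * C / R := by field_simp; ring
    · refine hc.mono fun z hz => ?_
      have := hz.2
      simp only [neg_im, ofReal_im, neg_zero, add_im, mul_im, ofReal_re, I_im, mul_one, I_re,
        mul_zero, add_zero, zero_add, mem_preimage, uIcc_of_le hRpos.le] at this
      exact this.1
    · refine hd.mono fun z hz => ?_
      have := hz.2
      simp only [neg_im, ofReal_im, neg_zero, add_im, mul_im, ofReal_re, I_im, mul_one, I_re,
        mul_zero, add_zero, zero_add, mem_preimage, min_eq_left hRpos.le] at this
      exact this.1
  have h1 := intervalIntegral_tendsto_integral hi tendsto_neg_atTop_atBot tendsto_id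
  have h2 : Tendsto (fun R : ℝ => ∫ x in (-R)..R, g x) atTop (𝓝 0) := by
    refine squeeze_zero_norm' ((eventually_ge_atTop (max R₀ 1)).mono key) ?_
    exact tendsto_const_nhds.div_atTop tendsto_id
  exact tendsto_nhds_unique h1 h2

theorem integrable_poissonKernel {ε : ℝ} (hε : 0 < ε) (x : ℝ) :
    Integrable fun t : ℝ => ε / ((x - t) ^ 2 + ε ^ 2) := by
  have h := ((integrable_inv_one_add_sq.comp_div hε.ne').comp_sub_left x).const_mul ε⁻¹
  refine h.congr (Eventually.of_forall fun t => ?_)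
  simp only
  field_simp
  ring

theorem integral_poissonKernel {ε : ℝ} (hε : 0 < ε) (x : ℝ) :
    ∫ t : ℝ, ε / ((x - t) ^ 2 + ε ^ 2) = Real.pi := by
  have h1 : (fun t : ℝ => ε / ((x - t) ^ 2 + ε ^ 2)) =
      fun t => ε⁻¹ * (1 + ((x - t) / ε) ^ 2)⁻¹ := by
    funext t
    field_simp
    ring
  rw [h1, integral_const_mul, integral_sub_left_eq_self (fun t : ℝ => (1 + (t / ε) ^ 2)⁻¹) volume x,
    Measure.integral_comp_div (fun t : ℝ => (1 + t ^ 2)⁻¹), integral_univ_inv_one_add_sq]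
  rw [abs_of_pos hε, smul_eq_mul, inv_mul_cancel_left₀ hε.ne']

/-- With `z₀ = x + iε` and `w₀` its conjugate, `(G z - G z₀) / ((z - z₀)(z - w₀))` has a removable
singularity at `z₀` and decays quadratically, so its integral over the real line vanishes. There the
denominator is `(x - t)² + ε²`. -/
theorem integral_poissonKernel_smul_of_bounded {G : ℂ → ℂ} (hc : ContinuousOn G {z | 0 ≤ z.im})
    (hd : DifferentiableOn ℂ G {z | 0 < z.im}) {M : ℝ} (hb : ∀ z : ℂ, 0 ≤ z.im → ‖G z‖ ≤ M)
    {ε : ℝ} (hε : 0 < ε) (x : ℝ) :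
    ∫ t : ℝ, (ε / ((x - t) ^ 2 + ε ^ 2)) • G t = Real.pi • G (x + ε * I) := by
  set z₀ : ℂ := x + ε * I with hz₀
  have hz₀im : z₀.im = ε := by simp [hz₀]
  set w₀ : ℂ := x - ε * I with hw₀
  have hw₀im : w₀.im = -ε := by simp [hw₀]
  have hopen : IsOpen {z : ℂ | 0 < z.im} := isOpen_lt continuous_const continuous_im
  have hden : ∀ z : ℂ, 0 ≤ z.im → z - w₀ ≠ 0 := by
    intro z hz h
    have := congrArg Complex.im h
    simp only [sub_im, hw₀im, zero_im] at this
    linarith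
  have hmem : {z : ℂ | 0 < z.im} ∈ 𝓝 z₀ := hopen.mem_nhds (by simp [hz₀im, hε])
  have hreal : ∀ t : ℝ, (t : ℂ) - z₀ ≠ 0 := by
    intro t h
    have := congrArg Complex.im h
    simp only [sub_im, hz₀im, zero_im, ofReal_im] at this
    linarith
  have hprod : ∀ t : ℝ, ((t : ℂ) - z₀) * (t - w₀) = (((x - t) ^ 2 + ε ^ 2 : ℝ) : ℂ) := by
    intro t
    rw [hz₀, hw₀]
    push_cast
    linear_combination (ε ^ 2 : ℂ) * (-I_sq)
  have hg : ∀ t : ℝ, dslope G z₀ t / (t - w₀) =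
      (1 / ((x - t) ^ 2 + ε ^ 2)) • (G t - G z₀) := by
    intro t
    rw [dslope_of_ne _ (sub_ne_zero.1 (hreal t)), slope_def_field, div_div, hprod, real_smul]
    push_cast
    rw [one_div, inv_mul_eq_div]
  have hM : 0 ≤ M := (norm_nonneg _).trans (hb 0 (by simp))
  have hGt : Continuous fun t : ℝ => G t :=
    hc.comp_continuous continuous_ofReal (by simp)
  have hi0 : Integrable fun t : ℝ => (ε / ((x - t) ^ 2 + ε ^ 2)) • G t := by
    refine ((integrable_poissonKernel hε x).norm.mul_const M).mono' ?_ ?_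
    · exact ((integrable_poissonKernel hε x).aestronglyMeasurable).smul hGt.aestronglyMeasurable
    · refine Eventually.of_forall fun t => ?_
      rw [norm_smul]
      gcongr
      exact hb _ (by simp)
  have hi1 : Integrable fun t : ℝ => (ε / ((x - t) ^ 2 + ε ^ 2)) • G z₀ :=
    (integrable_poissonKernel hε x).smul_const _
  have hi : Integrable fun t : ℝ => dslope G z₀ t / (t - w₀) := by
    refine ((hi0.sub hi1).smul (ε⁻¹)).congr (Eventually.of_forall fun t => ?_)
    simp only [hg, Pi.sub_apply, Pi.smul_apply]
    rw [← smul_sub, smul_smul]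
    congr 1
    field_simp
  have h := integral_eq_zero_of_norm_le_div_sq (g := fun z => dslope G z₀ z / (z - w₀))
    -- For `‖z‖ ≥ 2‖z₀‖` both factors of the denominator are at least `‖z‖ / 2`, and the numerator
    -- is at most `2M`; the `+ 1` keeps `z` away from `0`.
    (C := 2 * M * 4) (R₀ := 2 * ‖z₀‖ + 1) ?_ ?_ ?_ hi
  · simp only [hg] at h
    have h2 : ∫ t : ℝ, ((ε / ((x - t) ^ 2 + ε ^ 2)) • G t - (ε / ((x - t) ^ 2 + ε ^ 2)) • G z₀)
        = 0 := by
      rw [← smul_zero ε, ← h, ← integral_smul]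
      refine integral_congr_ae (Eventually.of_forall fun t => ?_)
      simp only
      rw [← smul_sub, smul_smul]
      congr 1
      field_simp
    rw [integral_sub hi0 hi1, integral_smul_const, integral_poissonKernel hε, sub_eq_zero] at h2
    exact h2
  · have h1 : ContinuousOn (dslope G z₀) {z | 0 ≤ z.im} :=
      (continuousOn_dslope (mem_of_superset hmem fun z (hz : 0 < z.im) => hz.le)).2
        ⟨hc, (hd z₀ (by simp [hz₀im, hε])).differentiableAt hmem⟩
    exact h1.div (by fun_prop) hden
  · have h1 : DifferentiableOn ℂ (dslope G z₀) {z | 0 < z.im} :=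
      (differentiableOn_dslope hmem).2 hd
    exact h1.div (by fun_prop) fun z hz => hden z (le_of_lt hz)
  · intro z hz hzR
    have hn0 : 0 ≤ ‖z₀‖ := norm_nonneg _
    have hw : ‖w₀‖ = ‖z₀‖ := by
      have : w₀ = (starRingEnd ℂ) z₀ := by simp [hw₀, hz₀, sub_eq_add_neg]
      rw [this, RCLike.norm_conj]
    have h1 : ‖z‖ / 2 ≤ ‖z - z₀‖ := by
      have := norm_sub_norm_le z z₀
      linarith
    have h2 : ‖z‖ / 2 ≤ ‖z - w₀‖ := by
      have := norm_sub_norm_le z w₀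
      linarith
    have hzpos : 0 < ‖z‖ := by linarith
    have hne : z ≠ z₀ := by
      rintro rfl
      rw [sub_self, norm_zero] at h1
      linarith
    have h3 : ‖G z - G z₀‖ ≤ 2 * M := by
      refine (norm_sub_le _ _).trans ?_
      have := hb z hz
      have := hb z₀ (by rw [hz₀im]; exact hε.le)
      linarith
    rw [dslope_of_ne _ hne, slope_def_field, div_div, norm_div, norm_mul]
    calc ‖G z - G z₀‖ / (‖z - z₀‖ * ‖z - w₀‖) ≤ 2 * M / (‖z‖ / 2 * (‖z‖ / 2)) := by gcongr
      _ = 2 * M * 4 / ‖z‖ ^ 2 := by field_simp; ring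

/-- The factor `(iR / (z + iR))²` supplies the quadratic decay. It has modulus at most 1 in the half
plane and tends to 1 as `R → ∞`, so dominated convergence removes it. -/
theorem integral_eq_zero_of_bounded_of_integrable {G : ℂ → ℂ} (hc : ContinuousOn G {z | 0 ≤ z.im})
    (hd : DifferentiableOn ℂ G {z | 0 < z.im}) {M : ℝ} (hb : ∀ z : ℂ, 0 ≤ z.im → ‖G z‖ ≤ M)
    (hi : Integrable fun x : ℝ => G x) : ∫ x : ℝ, G x = 0 := by
  have hM : 0 ≤ M := (norm_nonneg _).trans (hb 0 (by simp))
  have hne : ∀ R : ℝ, 0 < R → ∀ z : ℂ, 0 ≤ z.im → z + R * I ≠ 0 := by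
    intro R hR z hz h
    have := congrArg Complex.im h
    simp at this
    linarith
  have hle : ∀ R : ℝ, 0 < R → ∀ z : ℂ, 0 ≤ z.im → R ≤ ‖z + R * I‖ ∧ ‖z‖ ≤ ‖z + R * I‖ := by
    intro R hR z hz
    constructor
    · calc R ≤ (z + R * I).im := by simpa using hz
        _ ≤ _ := (le_abs_self _).trans (abs_im_le_norm _)
    · rw [Complex.norm_def, Complex.norm_def]
      refine Real.sqrt_le_sqrt ?_
      simp only [normSq_apply, add_re, mul_re, ofReal_re, I_re, mul_zero, ofReal_im, I_im, mul_one,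
        sub_self, add_zero, add_im, mul_im]
      nlinarith
  have key : ∀ R : ℝ, 0 < R → ∫ x : ℝ, ((R * I) / (x + R * I)) ^ 2 * G x = 0 := by
    intro R hR
    refine integral_eq_zero_of_norm_le_div_sq (g := fun z => ((R * I) / (z + R * I)) ^ 2 * G z)
      (C := R ^ 2 * M) (R₀ := 1) ?_ ?_ ?_ ?_
    · refine ContinuousOn.mul (ContinuousOn.pow (ContinuousOn.div ?_ ?_ (hne R hR)) 2) hc <;>
        fun_prop
    · refine DifferentiableOn.mul (DifferentiableOn.pow (DifferentiableOn.div ?_ ?_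
        fun z hz => hne R hR z (le_of_lt hz)) 2) hd <;> fun_prop
    · intro z hz hz1
      have h1 := (hle R hR z hz).2
      rw [norm_mul, norm_pow, norm_div, norm_mul, norm_I, mul_one, norm_real, Real.norm_eq_abs,
        abs_of_pos hR, div_pow, div_mul_eq_mul_div]
      have := hb z hz
      have : 0 < ‖z‖ := by linarith
      gcongr
    · refine hi.norm.mono' ?_ (Eventually.of_forall fun x => ?_)
      · refine AEStronglyMeasurable.mul ?_ hi.aestronglyMeasurable
        exact (by fun_prop : Measurable fun x : ℝ => ((R * I) / (x + R * I)) ^ 2).aestronglyMeasurable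
      · rw [norm_mul]
        refine mul_le_of_le_one_left (norm_nonneg _) ?_
        rw [norm_pow, norm_div, norm_mul, norm_I, mul_one, norm_real, Real.norm_eq_abs,
          abs_of_pos hR]
        have h1 := (hle R hR x (by simp)).1
        exact pow_le_one₀ (by positivity) (div_le_one_of_le₀ h1 (norm_nonneg _))
  have h1 : Tendsto (fun R : ℝ => ∫ x : ℝ, ((R * I) / (x + R * I)) ^ 2 * G x) atTop
      (𝓝 (∫ x : ℝ, G x)) := by
    refine tendsto_integral_filter_of_dominated_convergence (fun x : ℝ => ‖G x‖) ?_ ?_ hi.norm ?_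
    · refine Eventually.of_forall fun R => AEStronglyMeasurable.mul ?_ hi.aestronglyMeasurable
      exact (by fun_prop : Measurable fun x : ℝ => ((R * I) / (x + R * I)) ^ 2).aestronglyMeasurable
    · filter_upwards [eventually_gt_atTop 0] with R hR
      refine Eventually.of_forall fun x => ?_
      rw [norm_mul]
      refine mul_le_of_le_one_left (norm_nonneg _) ?_
      rw [norm_pow, norm_div, norm_mul, norm_I, mul_one, norm_real, Real.norm_eq_abs,
        abs_of_pos hR]
      have h1 := (hle R hR x (by simp)).1
      exact pow_le_one₀ (by positivity) (div_le_one_of_le₀ h1 (norm_nonneg _))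
    · refine Eventually.of_forall fun x => ?_
      have h2 : Tendsto (fun R : ℝ => (I / ((x : ℂ) * ((R⁻¹ : ℝ) : ℂ) + I)) ^ 2 * G x) atTop
          (𝓝 ((I / ((x : ℂ) * ((0 : ℝ) : ℂ) + I)) ^ 2 * G x)) := by
        refine Tendsto.mul_const _ (Tendsto.pow (Tendsto.div tendsto_const_nhds
          (Tendsto.add_const _ (Tendsto.const_mul _ ?_)) (by simp)) 2)
        exact (continuous_ofReal.tendsto 0).comp tendsto_inv_atTop_zero
      simp only [ofReal_zero, mul_zero, zero_add, div_self I_ne_zero, one_pow, one_mul] at h2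
      refine h2.congr' ?_
      filter_upwards [eventually_gt_atTop 0] with R hR
      congr 2
      have : (R : ℂ) ≠ 0 := by exact_mod_cast hR.ne'
      have h3 := hne R hR x (by simp)
      have h4 : (x : ℂ) * ((R⁻¹ : ℝ) : ℂ) + I = (x + R * I) / R := by
        push_cast
        field_simp
      rw [h4]
      field_simp
  refine tendsto_nhds_unique h1 (tendsto_const_nhds.congr' ?_)
  filter_upwards [eventually_gt_atTop 0] with R hR
  exact (key R hR).symm

end UpperHalfPlane

/-! ### Convolution inequalities and continuity of translations in `L^p`. -/

section LpInequalities

open ENNReal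

/-- Jensen's inequality for the unnormalized weight `a`, obtained from Hölder applied to `a b =
a^(1-1/p) (a b^p)^(1/p)`. -/
theorem lintegral_mul_rpow_le {α : Type*} [MeasurableSpace α] {μ : Measure α} {a b : α → ℝ≥0∞}
    (ha : AEMeasurable a μ) (hb : AEMeasurable b μ) {p : ℝ} (hp : 1 ≤ p) :
    (∫⁻ s, a s * b s ∂μ) ^ p ≤ (∫⁻ s, a s ∂μ) ^ (p - 1) * ∫⁻ s, a s * b s ^ p ∂μ := by
  have hp0 : 0 < p := by linarith
  have h := ENNReal.lintegral_mul_norm_pow_le ha (ha.mul (hb.pow_const p)) (p := 1 - 1 / p)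
    (q := 1 / p) (by rw [sub_nonneg, div_le_one hp0]; exact hp) (by positivity) (by ring)
  have h1 : ∀ s, a s ^ (1 - 1 / p) * (a s * b s ^ p) ^ (1 / p) = a s * b s := by
    intro s
    rw [ENNReal.mul_rpow_of_nonneg _ _ (by positivity), ← mul_assoc,
      ← ENNReal.rpow_add_of_nonneg _ _ (by rw [sub_nonneg, div_le_one hp0]; exact hp)
        (by positivity), ← ENNReal.rpow_mul, mul_one_div_cancel hp0.ne']
    simp
  simp only [Pi.mul_apply, h1] at h
  refine (ENNReal.rpow_le_rpow h hp0.le).trans (le_of_eq ?_)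
  rw [ENNReal.mul_rpow_of_nonneg _ _ hp0.le, ← ENNReal.rpow_mul, ← ENNReal.rpow_mul,
    one_div_mul_cancel hp0.ne', ENNReal.rpow_one, sub_mul, one_div_mul_cancel hp0.ne', one_mul]

theorem lintegral_lintegral_mul_rpow_le {a : ℝ → ℝ≥0∞} {b : ℝ → ℝ → ℝ≥0∞} (ha : AEMeasurable a)
    (hb : AEMeasurable (Function.uncurry b) (volume.prod volume)) {p : ℝ} (hp : 1 ≤ p) :
    ∫⁻ x, (∫⁻ s, a s * b x s) ^ p ≤
      (∫⁻ s, a s) ^ (p - 1) * ∫⁻ s, a s * ∫⁻ x, b x s ^ p := by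
  have h1 : ∀ᵐ x : ℝ, AEMeasurable (b x) := hb.aestronglyMeasurable.prodMk_left.mono fun x hx => hx.aemeasurable
  calc ∫⁻ x, (∫⁻ s, a s * b x s) ^ p
      ≤ ∫⁻ x, (∫⁻ s, a s) ^ (p - 1) * ∫⁻ s, a s * b x s ^ p := by
        refine lintegral_mono_ae ?_
        filter_upwards [h1] with x hx
        exact lintegral_mul_rpow_le ha hx hp
    _ = (∫⁻ s, a s) ^ (p - 1) * ∫⁻ x, ∫⁻ s, a s * b x s ^ p := by
        refine lintegral_const_mul'' _ ?_
        exact AEMeasurable.lintegral_prod_right' (f := fun z : ℝ × ℝ => a z.2 * b z.1 z.2 ^ p)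
          ((ha.comp_snd).mul (hb.pow_const p))
    _ = (∫⁻ s, a s) ^ (p - 1) * ∫⁻ s, ∫⁻ x, a s * b x s ^ p := by
        rw [lintegral_lintegral_swap]
        exact (ha.comp_snd).mul (hb.pow_const p)
    _ = _ := by
        congr 1
        refine lintegral_congr_ae ?_
        have h2 : ∀ᵐ s : ℝ, AEMeasurable fun x => b x s :=
          (hb.comp_quasiMeasurePreserving
            (Measure.measurePreserving_swap (μ := volume) (ν := volume)).quasiMeasurePreserving).aestronglyMeasurable.prodMk_left.mono
            fun x hx => hx.aemeasurable
        filter_upwards [h2] with s hs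
        exact lintegral_const_mul'' _ (hs.pow_const p)

theorem aestronglyMeasurable_conv {k f : ℝ → ℝ} (hk : AEStronglyMeasurable k)
    (hf : AEStronglyMeasurable f) : AEStronglyMeasurable fun x => ∫ t, k (x - t) * f t :=
  AEStronglyMeasurable.integral_prod_right' (f := fun z : ℝ × ℝ => k (z.1 - z.2) * f z.2)
    ((hk.comp_quasiMeasurePreserving
      (quasiMeasurePreserving_sub_of_right_invariant volume volume)).mul hf.comp_snd)

theorem conv_comm (k f : ℝ → ℝ) (x : ℝ) : ∫ t, k (x - t) * f t = ∫ t, f (x - t) * k t := by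
  rw [← integral_sub_left_eq_self _ volume x]
  simp [mul_comm]

theorem eLpNorm_conv_le {k f : ℝ → ℝ} (hk : AEStronglyMeasurable k)
    (hf : AEStronglyMeasurable f) {p : ℝ≥0∞} (hp : 1 ≤ p) (hp' : p ≠ ∞) :
    eLpNorm (fun x => ∫ t, k (x - t) * f t) p ≤ eLpNorm f 1 * eLpNorm k p := by
  have hp1 : 1 ≤ p.toReal := by
    rw [← ENNReal.toReal_one]; exact ENNReal.toReal_mono hp' hp
  have hp0 : 0 < p.toReal := by linarith
  have hpne : p ≠ 0 := fun h => by simp [h] at hp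
  rw [eLpNorm_eq_lintegral_rpow_enorm_toReal hpne hp', eLpNorm_eq_lintegral_rpow_enorm_toReal hpne hp',
    eLpNorm_one_eq_lintegral_enorm]
  have h1 : ∫⁻ x, ‖∫ t, k (x - t) * f t‖ₑ ^ p.toReal ≤
      (∫⁻ t, ‖f t‖ₑ) ^ p.toReal * ∫⁻ x, ‖k x‖ₑ ^ p.toReal := by
    calc ∫⁻ x, ‖∫ t, k (x - t) * f t‖ₑ ^ p.toReal
        ≤ ∫⁻ x, (∫⁻ t, ‖f t‖ₑ * ‖k (x - t)‖ₑ) ^ p.toReal := by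
          gcongr with x
          refine (enorm_integral_le_lintegral_enorm _).trans (le_of_eq ?_)
          simp [mul_comm]
      _ ≤ (∫⁻ t, ‖f t‖ₑ) ^ (p.toReal - 1) * ∫⁻ t, ‖f t‖ₑ * ∫⁻ x, ‖k (x - t)‖ₑ ^ p.toReal := by
          refine lintegral_lintegral_mul_rpow_le (b := fun x t => ‖k (x - t)‖ₑ) hf.enorm ?_ hp1
          exact (hk.comp_quasiMeasurePreserving
            (quasiMeasurePreserving_sub_of_right_invariant volume volume)).enorm
      _ = (∫⁻ t, ‖f t‖ₑ) ^ (p.toReal - 1) * ∫⁻ t, ‖f t‖ₑ * ∫⁻ x, ‖k x‖ₑ ^ p.toReal := by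
          simp only [lintegral_sub_right_eq_self (fun x => ‖k x‖ₑ ^ p.toReal)]
      _ = _ := by
          rw [lintegral_mul_const'' _ hf.enorm, ← mul_assoc]
          congr 1
          nth_rewrite 2 [← ENNReal.rpow_one (∫⁻ t, ‖f t‖ₑ)]
          rw [← ENNReal.rpow_add_of_nonneg _ _ (by linarith) zero_le_one, sub_add_cancel]
  refine (ENNReal.rpow_le_rpow h1 (by positivity)).trans (le_of_eq ?_)
  rw [ENNReal.mul_rpow_of_nonneg _ _ (by positivity), ← ENNReal.rpow_mul,
    mul_one_div_cancel hp0.ne', ENNReal.rpow_one]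

theorem eLpNorm_conv_le' {k f : ℝ → ℝ} (hk : AEStronglyMeasurable k)
    (hf : AEStronglyMeasurable f) {p : ℝ≥0∞} (hp : 1 ≤ p) (hp' : p ≠ ∞) :
    eLpNorm (fun x => ∫ t, k (x - t) * f t) p ≤ eLpNorm k 1 * eLpNorm f p := by
  simp only [conv_comm k f]
  exact eLpNorm_conv_le hf hk hp hp'

/-- Translation is continuous in `L^p`. -/
theorem tendsto_lintegral_translate_sub {f : ℝ → ℝ} {p : ℝ≥0∞} (hp : 1 ≤ p) (hp' : p ≠ ∞)
    (hf : MemLp f p) :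
    Tendsto (fun s : ℝ => ∫⁻ x, ‖f (x - s) - f x‖ₑ ^ p.toReal) (𝓝 0) (𝓝 0) := by
  have : Fact (1 ≤ p) := ⟨hp⟩
  have hpne : p ≠ 0 := fun h => by simp [h] at hp
  have hp0 : 0 < p.toReal := ENNReal.toReal_pos hpne hp'
  have hmp : ∀ s : ℝ, MeasurePreserving (fun x : ℝ => x - s) volume volume :=
    fun s => measurePreserving_sub_right volume s
  have hm : ∀ s : ℝ, MemLp (fun x => f (x - s)) p := fun s => hf.comp_measurePreserving (hmp s)
  -- Translations form a continuous family of measure preserving maps, and composition with such a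
  -- family is continuous in `L^p`.
  let g : C(ℝ, C(ℝ, ℝ)) := ContinuousMap.curry ⟨fun z : ℝ × ℝ => z.2 - z.1, by fun_prop⟩
  have h1 := (Continuous.compMeasurePreservingLp (μ := volume) (ν := volume)
    (f := fun _ : ℝ => hf.toLp f) continuous_const g.continuous hmp hp').tendsto 0
  have h2 : ∀ s : ℝ, Lp.compMeasurePreserving (g s) (hmp s) (hf.toLp f) = (hm s).toLp _ :=
    fun s => Lp.toLp_compMeasurePreserving hf (hmp s)
  simp only [h2] at h1
  rw [Lp.tendsto_Lp_iff_tendsto_eLpNorm''] at h1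
  have h3 := (ENNReal.continuous_rpow_const (y := p.toReal)).tendsto 0 |>.comp h1
  rw [ENNReal.zero_rpow_of_pos hp0] at h3
  refine h3.congr fun s => ?_
  simp only [Function.comp_apply]
  rw [eLpNorm_eq_lintegral_rpow_enorm_toReal hpne hp', ← ENNReal.rpow_mul,
    one_div_mul_cancel hp0.ne', ENNReal.rpow_one]
  simp

end LpInequalities

/-! ### Poisson and conjugate Poisson kernels. -/

section Kernels

open ENNReal

/-- The (unnormalized) Poisson integral `∫ ε f(t) / ((x - t)² + ε²) dt`. -/
noncomputable def poissonInt (ε : ℝ) (f : ℝ → ℝ) (x : ℝ) : ℝ :=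
  ∫ t, ε / ((x - t) ^ 2 + ε ^ 2) * f t

/-- The (unnormalized) conjugate Poisson integral `∫ (x - t) f(t) / ((x - t)² + ε²) dt`. -/
noncomputable def conjInt (ε : ℝ) (f : ℝ → ℝ) (x : ℝ) : ℝ :=
  ∫ t, (x - t) / ((x - t) ^ 2 + ε ^ 2) * f t

/-- A common majorant: up to the factor `1 + ε⁻¹` it dominates both kernels. -/
theorem memLp_one_add_abs_inv {p : ℝ≥0∞} (hp : 1 < p) :
    MemLp (fun s : ℝ => (1 + |s|)⁻¹) p := by
  have hm : AEStronglyMeasurable (fun s : ℝ => (1 + |s|)⁻¹) :=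
    (by fun_prop : Measurable fun s : ℝ => (1 + |s|)⁻¹).aestronglyMeasurable
  rcases eq_or_ne p ∞ with rfl | hp'
  · refine memLp_top_of_bound hm 1 (Eventually.of_forall fun s => ?_)
    rw [Real.norm_of_nonneg (by positivity)]
    exact inv_le_one_of_one_le₀ (by linarith [abs_nonneg s])
  · rw [← integrable_norm_rpow_iff hm (by positivity) hp']
    have h1 : 1 < p.toReal := by
      rw [← ENNReal.toReal_one]
      exact (ENNReal.toReal_lt_toReal one_ne_top hp').2 hp
    have h := integrable_one_add_norm (E := ℝ) (μ := volume) (r := p.toReal) (by simpa using h1)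
    refine h.congr (Eventually.of_forall fun s => ?_)
    change (1 + |s|) ^ (-p.toReal) = ‖(1 + |s|)⁻¹‖ ^ p.toReal
    rw [Real.norm_of_nonneg (by positivity), Real.rpow_neg (by positivity),
      Real.inv_rpow (by positivity)]

theorem abs_conjKernel_le {ε : ℝ} (hε : 0 < ε) (s : ℝ) :
    |s / (s ^ 2 + ε ^ 2)| ≤ (1 + ε⁻¹) * (1 + |s|)⁻¹ := by
  rw [abs_div, abs_of_pos (by positivity : 0 < s ^ 2 + ε ^ 2), ← div_eq_mul_inv,
    div_le_div_iff₀ (by positivity) (by positivity)]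
  have h2 : |s| ≤ ε⁻¹ * (s ^ 2 + ε ^ 2) := by
    rw [inv_mul_eq_div, le_div_iff₀ hε, ← sq_abs s]
    nlinarith [sq_nonneg (|s| - ε), sq_nonneg (|s|), sq_nonneg ε]
  nlinarith [sq_abs s, sq_nonneg ε]

theorem abs_poissonKernel_le {ε : ℝ} (hε : 0 < ε) (s : ℝ) :
    |ε / (s ^ 2 + ε ^ 2)| ≤ (1 + ε⁻¹) * (1 + |s|)⁻¹ := by
  rw [abs_of_pos (by positivity), ← div_eq_mul_inv,
    div_le_div_iff₀ (by positivity) (by positivity)]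
  have h2 : ε ≤ ε⁻¹ * (s ^ 2 + ε ^ 2) := by
    rw [inv_mul_eq_div, le_div_iff₀ hε]
    nlinarith [sq_nonneg s]
  nlinarith [sq_abs s, sq_nonneg (|s| - ε), abs_nonneg s]

theorem measurable_conjKernel (ε : ℝ) : Measurable fun s : ℝ => s / (s ^ 2 + ε ^ 2) := by fun_prop

theorem measurable_poissonKernel (ε : ℝ) : Measurable fun s : ℝ => ε / (s ^ 2 + ε ^ 2) := by
  fun_prop

theorem memLp_conjKernel {ε : ℝ} (hε : 0 < ε) {p : ℝ≥0∞} (hp : 1 < p) :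
    MemLp (fun s : ℝ => s / (s ^ 2 + ε ^ 2)) p :=
  ((memLp_one_add_abs_inv hp).const_mul (1 + ε⁻¹)).of_le
    (measurable_conjKernel ε).aestronglyMeasurable (Eventually.of_forall fun s => by
      rw [Real.norm_eq_abs, Real.norm_of_nonneg (by positivity)]
      exact abs_conjKernel_le hε s)

theorem memLp_poissonKernel {ε : ℝ} (hε : 0 < ε) {p : ℝ≥0∞} (hp : 1 ≤ p) :
    MemLp (fun s : ℝ => ε / (s ^ 2 + ε ^ 2)) p := by
  rcases hp.eq_or_lt with rfl | hp
  · rw [memLp_one_iff_integrable]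
    simpa using integrable_poissonKernel hε 0
  · exact ((memLp_one_add_abs_inv hp).const_mul (1 + ε⁻¹)).of_le
      (measurable_poissonKernel ε).aestronglyMeasurable (Eventually.of_forall fun s => by
        rw [Real.norm_eq_abs, Real.norm_of_nonneg (by positivity)]
        exact abs_poissonKernel_le hε s)

theorem memLp_poissonKernel_sub {ε : ℝ} (hε : 0 < ε) {p : ℝ≥0∞} (hp : 1 ≤ p) (x : ℝ) :
    MemLp (fun t : ℝ => ε / ((x - t) ^ 2 + ε ^ 2)) p :=
  (memLp_poissonKernel hε hp).comp_measurePreserving (Measure.measurePreserving_sub_left volume x)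

theorem eLpNorm_poissonKernel_one {ε : ℝ} (hε : 0 < ε) :
    eLpNorm (fun s : ℝ => ε / (s ^ 2 + ε ^ 2)) 1 = ENNReal.ofReal Real.pi := by
  rw [eLpNorm_one_eq_lintegral_enorm, ← integral_poissonKernel hε 0]
  simp only [zero_sub, neg_sq]
  rw [ofReal_integral_eq_lintegral_ofReal (by simpa using integrable_poissonKernel hε 0)
    (Eventually.of_forall fun s => by positivity)]
  refine lintegral_congr fun s => ?_
  rw [Real.enorm_of_nonneg (by positivity)]

theorem aestronglyMeasurable_poissonInt (ε : ℝ) {f : ℝ → ℝ} (hf : AEStronglyMeasurable f) :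
    AEStronglyMeasurable (poissonInt ε f) :=
  aestronglyMeasurable_conv (measurable_poissonKernel ε).aestronglyMeasurable hf

theorem aestronglyMeasurable_conjInt (ε : ℝ) {f : ℝ → ℝ} (hf : AEStronglyMeasurable f) :
    AEStronglyMeasurable (conjInt ε f) :=
  aestronglyMeasurable_conv (measurable_conjKernel ε).aestronglyMeasurable hf

theorem eLpNorm_poissonInt_le {ε : ℝ} (hε : 0 < ε) {f : ℝ → ℝ} (hf : AEStronglyMeasurable f)
    {p : ℝ≥0∞} (hp : 1 ≤ p) (hp' : p ≠ ∞) :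
    eLpNorm (poissonInt ε f) p ≤ ENNReal.ofReal Real.pi * eLpNorm f p := by
  rw [← eLpNorm_poissonKernel_one hε]
  exact eLpNorm_conv_le' (measurable_poissonKernel ε).aestronglyMeasurable hf hp hp'

theorem memLp_poissonInt {ε : ℝ} (hε : 0 < ε) {f : ℝ → ℝ} {p : ℝ≥0∞} (hp : 1 ≤ p) (hp' : p ≠ ∞)
    (hf : MemLp f p) : MemLp (poissonInt ε f) p :=
  ⟨aestronglyMeasurable_poissonInt ε hf.1, (eLpNorm_poissonInt_le hε hf.1 hp hp').trans_lt
    (ENNReal.mul_lt_top ENNReal.ofReal_lt_top hf.2)⟩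

theorem memLp_conjInt {ε : ℝ} (hε : 0 < ε) {f : ℝ → ℝ} {p : ℝ≥0∞} (hp : 1 < p) (hp' : p ≠ ∞)
    (hf : Integrable f) : MemLp (conjInt ε f) p :=
  ⟨aestronglyMeasurable_conjInt ε hf.1, (eLpNorm_conv_le
    (measurable_conjKernel ε).aestronglyMeasurable hf.1 hp.le hp').trans_lt
    (ENNReal.mul_lt_top (memLp_one_iff_integrable.2 hf).2 (memLp_conjKernel hε hp).2)⟩

end Kernels

/-! ### Convergence of Poisson integrals in `L^p` and almost everywhere. -/

section PoissonConvergence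

open ENNReal

theorem lintegral_poissonKernel {ε : ℝ} (hε : 0 < ε) (x : ℝ) :
    ∫⁻ t : ℝ, ENNReal.ofReal (ε / ((x - t) ^ 2 + ε ^ 2)) = ENNReal.ofReal Real.pi := by
  rw [← integral_poissonKernel hε x, ofReal_integral_eq_lintegral_ofReal
    (integrable_poissonKernel hε x) (Eventually.of_forall fun s => by positivity)]

/-- Away from the origin the kernel is `O(ε)` times the kernel of scale 1, so tails are negligible
as `ε → 0`. -/
theorem poissonKernel_le_of_le_abs {ε δ s : ℝ} (hε : 0 < ε) (hδ : 0 < δ) (hs : δ ≤ |s|) :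
    ε / (s ^ 2 + ε ^ 2) ≤ ε * (1 + (δ ^ 2)⁻¹) * (1 / (s ^ 2 + 1 ^ 2)) := by
  have h1 : δ ^ 2 ≤ s ^ 2 := by
    rw [← sq_abs s]; gcongr
  have h2 : 0 < s ^ 2 := lt_of_lt_of_le (by positivity) h1
  have h3 : (s ^ 2 + 1 ^ 2) ≤ (1 + (δ ^ 2)⁻¹) * s ^ 2 := by
    have : 1 ≤ (δ ^ 2)⁻¹ * s ^ 2 := by
      rw [inv_mul_eq_div, one_le_div (by positivity)]; exact h1
    linarith
  rw [mul_one_div, div_le_div_iff₀ (by positivity) (by positivity)]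
  have : s ^ 2 + 1 ^ 2 ≤ (1 + (δ ^ 2)⁻¹) * (s ^ 2 + ε ^ 2) := by
    refine h3.trans ?_
    gcongr
    nlinarith [sq_nonneg ε]
  calc ε * (s ^ 2 + 1 ^ 2) ≤ ε * ((1 + (δ ^ 2)⁻¹) * (s ^ 2 + ε ^ 2)) := by gcongr
    _ = _ := by ring

/-- Approximate identity: where `w ≤ η` the kernel contributes at most `ηπ`, and the remaining tail
is `O(ε)`. -/
theorem tendsto_lintegral_poissonKernel_mul {w : ℝ → ℝ≥0∞} {W : ℝ≥0∞} (hW : W ≠ ∞)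
    (hw : ∀ s, w s ≤ W) (h0 : Tendsto w (𝓝 0) (𝓝 0)) :
    Tendsto (fun ε : ℝ => ∫⁻ s, ENNReal.ofReal (ε / (s ^ 2 + ε ^ 2)) * w s) (𝓝[>] 0) (𝓝 0) := by
  have hpi : ∀ ε : ℝ, 0 < ε →
      ∫⁻ s : ℝ, ENNReal.ofReal (ε / (s ^ 2 + ε ^ 2)) = ENNReal.ofReal Real.pi := by
    intro ε hε
    simpa using lintegral_poissonKernel hε 0
  have key : ∀ η : ℝ≥0∞, 0 < η → ∃ C : ℝ≥0∞, C ≠ ∞ ∧ ∀ ε : ℝ, 0 < ε →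
      ∫⁻ s, ENNReal.ofReal (ε / (s ^ 2 + ε ^ 2)) * w s ≤
        η * ENNReal.ofReal Real.pi + ENNReal.ofReal ε * C := by
    intro η hη
    obtain ⟨δ, hδ, hδ'⟩ := Metric.eventually_nhds_iff.1 (h0.eventually (eventually_le_nhds hη))
    refine ⟨ENNReal.ofReal (1 + (δ ^ 2)⁻¹) * W * ENNReal.ofReal Real.pi,
      by finiteness, fun ε hε => ?_⟩
    calc ∫⁻ s, ENNReal.ofReal (ε / (s ^ 2 + ε ^ 2)) * w s
        ≤ ∫⁻ s, (η * ENNReal.ofReal (ε / (s ^ 2 + ε ^ 2)) +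
            ENNReal.ofReal ε * (ENNReal.ofReal (1 + (δ ^ 2)⁻¹) * W) *
              ENNReal.ofReal (1 / (s ^ 2 + 1 ^ 2))) := by
          refine lintegral_mono fun s => ?_
          by_cases hs : |s| < δ
          · have := hδ' (y := s) (by simpa using hs)
            refine le_add_right ?_
            rw [mul_comm]
            gcongr
          · refine le_add_left ?_
            calc ENNReal.ofReal (ε / (s ^ 2 + ε ^ 2)) * w s
                ≤ ENNReal.ofReal (ε * (1 + (δ ^ 2)⁻¹) * (1 / (s ^ 2 + 1 ^ 2))) * W := by
                  gcongr
                  · exact poissonKernel_le_of_le_abs hε hδ (not_lt.1 hs)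
                  · exact hw s
              _ = _ := by
                  rw [ENNReal.ofReal_mul (by positivity), ENNReal.ofReal_mul hε.le]
                  ring
      _ = _ := by
          rw [lintegral_add_left (by fun_prop), lintegral_const_mul _ (by fun_prop),
            lintegral_const_mul _ (by fun_prop), hpi ε hε, hpi 1 one_pos]
          ring
  rw [ENNReal.tendsto_nhds_zero]
  intro η hη
  rcases eq_or_ne η ∞ with rfl | hη'
  · exact Eventually.of_forall fun _ => le_top
  have hpi0 : ENNReal.ofReal Real.pi ≠ 0 := by simp [Real.pi_pos]
  obtain ⟨C, hC, hb⟩ := key (η / 2 / ENNReal.ofReal Real.pi)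
    (ENNReal.div_pos (ENNReal.div_pos hη.ne' (by simp)).ne' ENNReal.ofReal_ne_top)
  have h1 : Tendsto (fun ε : ℝ => ENNReal.ofReal ε * C) (𝓝[>] 0) (𝓝 0) := by
    have h2 : Tendsto (fun ε : ℝ => ENNReal.ofReal ε) (𝓝[>] 0) (𝓝 0) := by
      have := (ENNReal.continuous_ofReal.tendsto 0).mono_left (nhdsWithin_le_nhds (s := Set.Ioi 0))
      simpa using this
    simpa using ENNReal.Tendsto.mul_const h2 (Or.inr hC)
  filter_upwards [self_mem_nhdsWithin, h1.eventually (eventually_le_nhds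
    (ENNReal.div_pos hη.ne' (by simp : (2 : ℝ≥0∞) ≠ ∞)))] with ε hε h3
  refine (hb ε hε).trans ?_
  rw [ENNReal.div_mul_cancel hpi0 ENNReal.ofReal_ne_top]
  calc _ ≤ η / 2 + η / 2 := by gcongr
    _ = η := ENNReal.add_halves η

theorem integrable_poissonKernel_mul {p : ℝ≥0∞} (hp : 1 ≤ p) {f : ℝ → ℝ} (hf : MemLp f p)
    {ε : ℝ} (hε : 0 < ε) (x : ℝ) : Integrable fun t => ε / ((x - t) ^ 2 + ε ^ 2) * f t := by
  have : p.HolderConjugate (p.conjExponent) := ENNReal.HolderConjugate.conjExponent hp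
  have hq : 1 ≤ p.conjExponent := by
    have := ENNReal.HolderConjugate.one_le p.conjExponent p
    exact this
  have h := (memLp_poissonKernel_sub hε hq x).integrable_mul hf
  exact h

theorem poissonInt_sub_pi_mul {p : ℝ≥0∞} (hp : 1 ≤ p) {f : ℝ → ℝ} (hf : MemLp f p)
    {ε : ℝ} (hε : 0 < ε) (x c : ℝ) :
    poissonInt ε f x - Real.pi * c = ∫ t, ε / ((x - t) ^ 2 + ε ^ 2) * (f t - c) := by
  rw [← integral_poissonKernel hε x, ← integral_mul_const, poissonInt, ← integral_sub
    (integrable_poissonKernel_mul hp hf hε x) ((integrable_poissonKernel hε x).mul_const c)]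
  simp only [mul_sub]

theorem lintegral_translate_sub_le {p : ℝ≥0∞} (hp : 1 ≤ p) (hp' : p ≠ ∞) {f : ℝ → ℝ}
    (hf : MemLp f p) (s : ℝ) :
    ∫⁻ x, ‖f (x - s) - f x‖ₑ ^ p.toReal ≤ (2 * eLpNorm f p) ^ p.toReal := by
  have hpne : p ≠ 0 := fun h => by simp [h] at hp
  have hp0 : 0 < p.toReal := ENNReal.toReal_pos hpne hp'
  have hmp := measurePreserving_sub_right (volume : Measure ℝ) s
  have h1 : eLpNorm (fun x => f (x - s) - f x) p ≤ 2 * eLpNorm f p := by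
    refine (eLpNorm_sub_le (hf.1.comp_measurePreserving hmp) hf.1 hp).trans ?_
    rw [eLpNorm_comp_measurePreserving hf.1 hmp, two_mul]
  refine le_trans (le_of_eq ?_) (ENNReal.rpow_le_rpow h1 hp0.le)
  rw [eLpNorm_eq_lintegral_rpow_enorm_toReal hpne hp', ← ENNReal.rpow_mul,
    one_div_mul_cancel hp0.ne', ENNReal.rpow_one]

/-- The kernel has mass `π`, so the difference is an average of `f (x - s) - f x`; Jensen and
Tonelli reduce its `p`-th power to the modulus of continuity of translations. -/
theorem eLpNorm_poissonInt_sub_le {p : ℝ≥0∞} (hp : 1 ≤ p) (hp' : p ≠ ∞) {f : ℝ → ℝ}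
    (hf : MemLp f p) {ε : ℝ} (hε : 0 < ε) :
    eLpNorm (fun x => poissonInt ε f x - Real.pi * f x) p ≤
      (ENNReal.ofReal Real.pi ^ (p.toReal - 1) * ∫⁻ s, ENNReal.ofReal (ε / (s ^ 2 + ε ^ 2)) *
        ∫⁻ x, ‖f (x - s) - f x‖ₑ ^ p.toReal) ^ (1 / p.toReal) := by
  have hp1 : 1 ≤ p.toReal := by
    rw [← ENNReal.toReal_one]; exact ENNReal.toReal_mono hp' hp
  have hp0 : 0 < p.toReal := by linarith
  have hpne : p ≠ 0 := fun h => by simp [h] at hp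
  rw [eLpNorm_eq_lintegral_rpow_enorm_toReal hpne hp']
  refine ENNReal.rpow_le_rpow ?_ (by positivity)
  calc ∫⁻ x, ‖poissonInt ε f x - Real.pi * f x‖ₑ ^ p.toReal
      ≤ ∫⁻ x, (∫⁻ s, ENNReal.ofReal (ε / (s ^ 2 + ε ^ 2)) * ‖f (x - s) - f x‖ₑ) ^ p.toReal := by
        gcongr with x
        rw [poissonInt_sub_pi_mul hp hf hε, ← integral_sub_left_eq_self
          (fun t => ε / ((x - t) ^ 2 + ε ^ 2) * (f t - f x)) volume x]
        simp only [_root_.sub_sub_cancel]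
        refine (enorm_integral_le_lintegral_enorm _).trans (le_of_eq (lintegral_congr fun s => ?_))
        rw [enorm_mul, Real.enorm_of_nonneg (by positivity)]
    _ ≤ (∫⁻ s, ENNReal.ofReal (ε / (s ^ 2 + ε ^ 2))) ^ (p.toReal - 1) *
        ∫⁻ s, ENNReal.ofReal (ε / (s ^ 2 + ε ^ 2)) * ∫⁻ x, ‖f (x - s) - f x‖ₑ ^ p.toReal := by
        refine lintegral_lintegral_mul_rpow_le (b := fun x s => ‖f (x - s) - f x‖ₑ)
          (by fun_prop) ?_ hp1
        exact ((hf.1.comp_quasiMeasurePreserving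
          (quasiMeasurePreserving_sub_of_right_invariant volume volume)).sub hf.1.comp_fst).enorm
    _ = _ := by
        congr 2
        simpa using lintegral_poissonKernel hε 0

/-- Poisson integrals converge in `L^p`. -/
theorem tendsto_eLpNorm_poissonInt_sub {p : ℝ≥0∞} (hp : 1 ≤ p) (hp' : p ≠ ∞) {f : ℝ → ℝ}
    (hf : MemLp f p) :
    Tendsto (fun ε => eLpNorm (fun x => poissonInt ε f x - Real.pi * f x) p) (𝓝[>] 0) (𝓝 0) := by
  have hp1 : 1 ≤ p.toReal := by
    rw [← ENNReal.toReal_one]; exact ENNReal.toReal_mono hp' hp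
  have hp0 : 0 < p.toReal := by linarith
  obtain ⟨w, hw⟩ : ∃ w : ℝ → ℝ≥0∞, w = fun s => ∫⁻ x, ‖f (x - s) - f x‖ₑ ^ p.toReal := ⟨_, rfl⟩
  have hW : (2 * eLpNorm f p) ^ p.toReal ≠ ∞ :=
    ENNReal.rpow_ne_top_of_nonneg hp0.le (ENNReal.mul_ne_top (by simp) hf.2.ne)
  have hwW : ∀ s, w s ≤ (2 * eLpNorm f p) ^ p.toReal := fun s => by
    rw [hw]; exact lintegral_translate_sub_le hp hp' hf s
  have hw0 : Tendsto w (𝓝 0) (𝓝 0) := by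
    rw [hw]; exact tendsto_lintegral_translate_sub hp hp' hf
  have h1 : Tendsto (fun ε : ℝ => ∫⁻ s, ENNReal.ofReal (ε / (s ^ 2 + ε ^ 2)) * w s)
      (𝓝[>] 0) (𝓝 0) :=
    tendsto_lintegral_poissonKernel_mul hW hwW hw0
  have h2 : Tendsto (fun ε : ℝ => (ENNReal.ofReal Real.pi ^ (p.toReal - 1) *
      ∫⁻ s, ENNReal.ofReal (ε / (s ^ 2 + ε ^ 2)) * w s) ^ (1 / p.toReal)) (𝓝[>] 0) (𝓝 0) := by
    have hc : ENNReal.ofReal Real.pi ^ (p.toReal - 1) ≠ ∞ :=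
      ENNReal.rpow_ne_top_of_nonneg (by linarith) ENNReal.ofReal_ne_top
    generalize ENNReal.ofReal Real.pi ^ (p.toReal - 1) = c at hc ⊢
    have h3 := ENNReal.Tendsto.const_mul (a := c) h1 (Or.inr hc)
    have h4 := h3.ennrpow_const (1 / p.toReal)
    rwa [mul_zero, ENNReal.zero_rpow_of_pos (by positivity)] at h4
  have h5 : ∀ᶠ ε : ℝ in 𝓝[>] 0, eLpNorm (fun x => poissonInt ε f x - Real.pi * f x) p ≤
      (ENNReal.ofReal Real.pi ^ (p.toReal - 1) *
        ∫⁻ s, ENNReal.ofReal (ε / (s ^ 2 + ε ^ 2)) * w s) ^ (1 / p.toReal) := by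
    filter_upwards [self_mem_nhdsWithin] with ε hε
    rw [hw]
    exact eLpNorm_poissonInt_sub_le hp hp' hf hε
  exact tendsto_of_tendsto_of_tendsto_of_le_of_le' tendsto_const_nhds h2
    (Eventually.of_forall fun _ => zero_le) h5

/-- If a density has averages at most `η` over all small balls centred at `x`, then so has its
integral against the Poisson kernel centred at `x` and cut off at the scale `r`. -/
theorem setLIntegral_poissonKernel_mul_le {g : ℝ → ℝ≥0∞} (hg : AEMeasurable g) {x r : ℝ}
    {η : ℝ≥0∞} (h : ∀ s, s ≤ r →
      ∫⁻ t in Metric.closedBall x s, g t ≤ η * volume (Metric.closedBall x s))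
    {ε : ℝ} (hε : 0 < ε) :
    ∫⁻ t in Metric.closedBall x r, ENNReal.ofReal (ε / ((x - t) ^ 2 + ε ^ 2)) * g t ≤
      η * ENNReal.ofReal Real.pi := by
  have hm : Measurable fun t : ℝ => ε / ((x - t) ^ 2 + ε ^ 2) := by fun_prop
  set ν : Measure ℝ := (volume.restrict (Metric.closedBall x r)).withDensity g with hν
  have h1 : ∫⁻ t in Metric.closedBall x r, ENNReal.ofReal (ε / ((x - t) ^ 2 + ε ^ 2)) * g t
      = ∫⁻ t, ENNReal.ofReal (ε / ((x - t) ^ 2 + ε ^ 2)) ∂ν := by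
    rw [hν, lintegral_withDensity_eq_lintegral_mul₀ hg.restrict (by fun_prop)]
    simp only [Pi.mul_apply, mul_comm]
  -- Layer cake: the superlevel sets of the kernel are balls centred at `x`, so the hypothesis
  -- compares `ν` with `η • volume` on each of them. Balls larger than `r` are controlled by the
  -- ball of radius `r`.
  have h2 : ∀ c : ℝ, 0 < c → ν {t | c < ε / ((x - t) ^ 2 + ε ^ 2)} ≤
      (η • volume) {t | c < ε / ((x - t) ^ 2 + ε ^ 2)} := by
    intro c hc
    have hS : {t | c < ε / ((x - t) ^ 2 + ε ^ 2)} = {t | (t - x) ^ 2 < ε / c - ε ^ 2} := by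
      ext t
      simp only [Set.mem_ofPred_eq]
      rw [lt_div_iff₀ (by positivity), lt_sub_iff_add_lt, lt_div_iff₀ hc,
        show (t - x) ^ 2 = (x - t) ^ 2 by ring, mul_comm]
    have hSm : MeasurableSet {t | c < ε / ((x - t) ^ 2 + ε ^ 2)} := measurableSet_lt (by fun_prop) hm
    rw [hν, withDensity_apply _ hSm, Measure.restrict_restrict hSm, Measure.smul_apply, smul_eq_mul,
      hS]
    rcases le_or_gt (ε / c - ε ^ 2) 0 with h3 | h3
    · have : {t : ℝ | (t - x) ^ 2 < ε / c - ε ^ 2} = ∅ := by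
        ext t
        simp only [Set.mem_ofPred_eq, Set.mem_empty_iff_false, iff_false, not_lt]
        exact h3.trans (sq_nonneg _)
      simp [this]
    · have h4 : {t : ℝ | (t - x) ^ 2 < ε / c - ε ^ 2} = Metric.ball x √(ε / c - ε ^ 2) := by
        ext t
        rw [Set.mem_ofPred_eq, Metric.mem_ball, Real.dist_eq, Real.lt_sqrt (abs_nonneg _), sq_abs]
      rw [h4]
      rcases le_total √(ε / c - ε ^ 2) r with h5 | h5
      · calc ∫⁻ t in Metric.ball x √(ε / c - ε ^ 2) ∩ Metric.closedBall x r, g t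
            ≤ ∫⁻ t in Metric.closedBall x √(ε / c - ε ^ 2), g t :=
              lintegral_mono_set (Set.inter_subset_left.trans Metric.ball_subset_closedBall)
          _ ≤ _ := h _ h5
          _ = _ := by rw [Real.volume_closedBall, Real.volume_ball]
      · calc ∫⁻ t in Metric.ball x √(ε / c - ε ^ 2) ∩ Metric.closedBall x r, g t
            ≤ ∫⁻ t in Metric.closedBall x r, g t := lintegral_mono_set Set.inter_subset_right
          _ ≤ _ := h _ le_rfl
          _ ≤ _ := by
            rw [Real.volume_closedBall, Real.volume_ball]
            gcongr
  have h0 : ∀ t : ℝ, 0 ≤ ε / ((x - t) ^ 2 + ε ^ 2) := fun t => by positivity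
  rw [h1, lintegral_eq_lintegral_meas_lt ν (Eventually.of_forall h0) hm.aemeasurable]
  calc _ ≤ ∫⁻ c in Set.Ioi 0, (η • volume) {t | c < ε / ((x - t) ^ 2 + ε ^ 2)} :=
        setLIntegral_mono' measurableSet_Ioi fun c hc => h2 c hc
    _ = ∫⁻ t, ENNReal.ofReal (ε / ((x - t) ^ 2 + ε ^ 2)) ∂(η • volume) :=
        (lintegral_eq_lintegral_meas_lt _ (Eventually.of_forall h0) hm.aemeasurable).symm
    _ = _ := by rw [lintegral_smul_measure, lintegral_poissonKernel hε, smul_eq_mul]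

/-- Poisson integrals converge almost everywhere. -/
theorem ae_tendsto_poissonInt {p : ℝ≥0∞} (hp : 1 ≤ p) {f : ℝ → ℝ} (hf : MemLp f p) :
    ∀ᵐ x, Tendsto (fun ε => poissonInt ε f x) (𝓝[>] 0) (𝓝 (Real.pi * f x)) := by
  have hl : LocallyIntegrable f := hf.locallyIntegrable hp
  -- Convergence is proved at each Lebesgue point `x`: the averages of `|f - f x|` are below `η` on
  -- balls of radius at most some `r`, which bounds the part inside radius `r` by `ηπ`; the part
  -- outside is `O(ε)`.
  filter_upwards [IsUnifLocDoublingMeasure.ae_tendsto_average_norm_sub volume hl 1] with x hx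
  have hx' := hx (l := 𝓝[>] (0 : ℝ)) (fun _ => x) id tendsto_id
    (by filter_upwards [self_mem_nhdsWithin] with r hr
        exact Metric.mem_closedBall_self (by simpa using (le_of_lt hr)))
  simp only [id] at hx'
  have hloc : LocallyIntegrable fun t => f t - f x := hl.sub (locallyIntegrable_const _)
  have hmeas : AEStronglyMeasurable fun t => f t - f x := hloc.aestronglyMeasurable
  have hint : Integrable fun t => 1 / ((x - t) ^ 2 + 1 ^ 2) * (f t - f x) := by
    simp only [mul_sub]
    exact (integrable_poissonKernel_mul hp hf one_pos x).sub
      ((integrable_poissonKernel one_pos x).mul_const _)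
  have key : ∀ η : ℝ, 0 < η → ∃ C : ℝ≥0∞, C ≠ ∞ ∧ ∀ ε : ℝ, 0 < ε →
      ‖poissonInt ε f x - Real.pi * f x‖ₑ ≤
        ENNReal.ofReal η * ENNReal.ofReal Real.pi + ENNReal.ofReal ε * C := by
    intro η hη
    obtain ⟨r, hr, hr'⟩ := (mem_nhdsGT_iff_exists_Ioc_subset).1 (hx'.eventually (gt_mem_nhds hη))
    replace hr : 0 < r := hr
    refine ⟨ENNReal.ofReal (1 + (r ^ 2)⁻¹) * ∫⁻ t, ‖1 / ((x - t) ^ 2 + 1 ^ 2) * (f t - f x)‖ₑ,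
      ENNReal.mul_ne_top ENNReal.ofReal_ne_top hint.2.ne, fun ε hε => ?_⟩
    rw [poissonInt_sub_pi_mul hp hf hε]
    refine (enorm_integral_le_lintegral_enorm _).trans ?_
    rw [← lintegral_add_compl _ (Metric.isClosed_closedBall (x := x) (ε := r)).measurableSet]
    refine add_le_add ?_ ?_
    · refine le_trans (le_of_eq (lintegral_congr fun t => ?_))
        (setLIntegral_poissonKernel_mul_le (g := fun t => ‖f t - f x‖ₑ) hmeas.enorm ?_ hε)
      · rw [enorm_mul, Real.enorm_of_nonneg (by positivity)]
      · intro s hs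
        rcases lt_or_ge s 0 with hs0 | hs0
        · simp [Metric.closedBall_eq_empty.2 hs0]
        rcases hs0.eq_or_lt with rfl | hs0
        · simp
        have h1 : ⨍ y in Metric.closedBall x s, ‖f y - f x‖ < η := hr' ⟨hs0, hs⟩
        have h2 : IntegrableOn (fun t => f t - f x) (Metric.closedBall x s) :=
          hloc.integrableOn_isCompact (isCompact_closedBall x s)
        have h4 : 0 < volume.real (Metric.closedBall x s) := by
          rw [Real.volume_real_closedBall hs0.le]; positivity
        rw [setAverage_eq, smul_eq_mul, inv_mul_lt_iff₀ h4] at h1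
        rw [← ofReal_integral_norm_eq_lintegral_enorm h2, ← ofReal_measureReal (by rw [Real.volume_closedBall]; exact ENNReal.ofReal_ne_top),
          ← ENNReal.ofReal_mul hη.le]
        exact ENNReal.ofReal_le_ofReal (by linarith)
    · refine le_trans (setLIntegral_mono' (g := fun t => ENNReal.ofReal ε *
        (ENNReal.ofReal (1 + (r ^ 2)⁻¹) * ‖1 / ((x - t) ^ 2 + 1 ^ 2) * (f t - f x)‖ₑ))
        (Metric.isClosed_closedBall.measurableSet.compl) fun t ht => ?_) ?_
      · have h3 : r ≤ |x - t| := by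
          have := ht
          simp only [Set.mem_compl_iff, Metric.mem_closedBall, Real.dist_eq, not_le] at this
          rw [abs_sub_comm]; exact this.le
        rw [enorm_mul, enorm_mul, Real.enorm_of_nonneg (by positivity),
          Real.enorm_of_nonneg (r := 1 / _) (by positivity), ← mul_assoc, ← mul_assoc,
          ← ENNReal.ofReal_mul hε.le, ← ENNReal.ofReal_mul (by positivity)]
        gcongr
        exact poissonKernel_le_of_le_abs hε hr h3
      · rw [lintegral_const_mul' _ _ ENNReal.ofReal_ne_top,
          lintegral_const_mul' _ _ ENNReal.ofReal_ne_top]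
        gcongr
        exact Measure.restrict_le_self
  rw [tendsto_iff_edist_tendsto_0, ENNReal.tendsto_nhds_zero]
  intro η hη
  rcases eq_or_ne η ∞ with rfl | hη'
  · exact Eventually.of_forall fun _ => le_top
  have hη2 : 0 < η.toReal := ENNReal.toReal_pos hη.ne' hη'
  obtain ⟨C, hC, hb⟩ := key (η.toReal / 2 / Real.pi) (by positivity)
  have h1 : Tendsto (fun ε : ℝ => ENNReal.ofReal ε * C) (𝓝[>] 0) (𝓝 0) := by
    have h2 : Tendsto (fun ε : ℝ => ENNReal.ofReal ε) (𝓝[>] 0) (𝓝 0) := by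
      have := (ENNReal.continuous_ofReal.tendsto 0).mono_left (nhdsWithin_le_nhds (s := Set.Ioi 0))
      simpa using this
    simpa using ENNReal.Tendsto.mul_const h2 (Or.inr hC)
  filter_upwards [self_mem_nhdsWithin, h1.eventually (eventually_le_nhds
    (ENNReal.div_pos hη.ne' (by simp : (2 : ℝ≥0∞) ≠ ∞)))] with ε hε h3
  rw [edist_eq_enorm_sub]
  refine (hb ε hε).trans ?_
  rw [← ENNReal.ofReal_mul (by positivity), div_mul_cancel₀ _ Real.pi_ne_zero,
    ENNReal.ofReal_div_of_pos two_pos, ENNReal.ofReal_toReal hη', ENNReal.ofReal_ofNat]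
  calc _ ≤ η / 2 + η / 2 := by gcongr
    _ = η := ENNReal.add_halves η

end PoissonConvergence

/-! ### The Cauchy transform of an integrable function. -/

section CauchyTransform

open Complex

/-- The Cauchy transform `∫ i f(t) / (z - t) dt`; its real and imaginary parts in the upper half
plane are the Poisson integral and the conjugate Poisson integral. -/
noncomputable def cauchyInt (f : ℝ → ℝ) (z : ℂ) : ℂ := ∫ t : ℝ, I / (z - t) * f t

theorem im_le_norm_sub_ofReal (z : ℂ) (t : ℝ) : z.im ≤ ‖z - t‖ := by
  have h := abs_im_le_norm (z - t)
  simp only [sub_im, ofReal_im, sub_zero] at h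
  exact (le_abs_self _).trans h

theorem sub_ofReal_ne_zero {z : ℂ} (hz : 0 < z.im) (t : ℝ) : z - t ≠ 0 :=
  norm_pos_iff.1 (hz.trans_le (im_le_norm_sub_ofReal z t))

theorem norm_I_div_sub_le {z : ℂ} {δ : ℝ} (hδ : 0 < δ) (hz : δ ≤ z.im) (t : ℝ) :
    ‖I / (z - t)‖ ≤ δ⁻¹ := by
  rw [norm_div, norm_I, one_div]
  exact inv_anti₀ hδ (hz.trans (im_le_norm_sub_ofReal z t))

theorem I_div_sub_eq {ε : ℝ} (hε : 0 < ε) (x t : ℝ) :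
    I / ((x + ε * I : ℂ) - t) =
      ((ε / ((x - t) ^ 2 + ε ^ 2) : ℝ) : ℂ) + (((x - t) / ((x - t) ^ 2 + ε ^ 2) : ℝ) : ℂ) * I := by
  have h1 : (x + ε * I : ℂ) - t ≠ 0 := sub_ofReal_ne_zero (by simpa using hε) t
  have h2 : (x - t : ℂ) ^ 2 + ε ^ 2 ≠ 0 := by
    have : (x - t) ^ 2 + ε ^ 2 ≠ 0 := by positivity
    exact_mod_cast this
  push_cast
  rw [div_eq_iff h1]
  field_simp
  linear_combination (-(ε : ℂ) * (x - t)) * I_sq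

theorem abs_conjKernel_le_inv {ε : ℝ} (hε : 0 < ε) (s : ℝ) : |s / (s ^ 2 + ε ^ 2)| ≤ ε⁻¹ := by
  rw [abs_div, abs_of_pos (by positivity : 0 < s ^ 2 + ε ^ 2), ← one_div,
    div_le_div_iff₀ (by positivity) hε, ← sq_abs s]
  nlinarith [sq_nonneg (|s| - ε), sq_nonneg |s|, sq_nonneg ε]

theorem integrable_conjKernel_mul {f : ℝ → ℝ} (hf : Integrable f) {ε : ℝ} (hε : 0 < ε) (x : ℝ) :
    Integrable fun t => (x - t) / ((x - t) ^ 2 + ε ^ 2) * f t :=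
  hf.bdd_mul (c := ε⁻¹) (by fun_prop : Measurable _).aestronglyMeasurable
    (Eventually.of_forall fun t => abs_conjKernel_le_inv hε (x - t))

theorem integrable_cauchyKernel_mul {f : ℝ → ℝ} (hf : Integrable f) {z : ℂ} (hz : 0 < z.im) :
    Integrable fun t : ℝ => I / (z - t) * (f t : ℂ) :=
  hf.ofReal.bdd_mul (c := z.im⁻¹) (by fun_prop : Measurable _).aestronglyMeasurable
    (Eventually.of_forall fun t => norm_I_div_sub_le hz le_rfl t)

theorem cauchyInt_eq {f : ℝ → ℝ} (hf : Integrable f) {ε : ℝ} (hε : 0 < ε) (x : ℝ) :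
    cauchyInt f (x + ε * I) = (poissonInt ε f x : ℂ) + (conjInt ε f x : ℂ) * I := by
  have h1 := integrable_poissonKernel_mul le_rfl (memLp_one_iff_integrable.2 hf) hε x
  have h2 := integrable_conjKernel_mul hf hε x
  have h1' : Integrable fun t => ((ε / ((x - t) ^ 2 + ε ^ 2) * f t : ℝ) : ℂ) := h1.ofReal
  have h2' : Integrable fun t => (((x - t) / ((x - t) ^ 2 + ε ^ 2) * f t : ℝ) : ℂ) * I :=
    h2.ofReal.mul_const I
  rw [cauchyInt, poissonInt, conjInt, ← integral_complex_ofReal,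
    ← integral_complex_ofReal,
    ← integral_mul_const, ← integral_add h1' h2']
  refine integral_congr_ae (Eventually.of_forall fun t => ?_)
  simp only
  rw [I_div_sub_eq hε]
  push_cast
  ring

theorem norm_cauchyInt_le {f : ℝ → ℝ} (hf : Integrable f) {z : ℂ} {δ : ℝ} (hδ : 0 < δ)
    (hz : δ ≤ z.im) : ‖cauchyInt f z‖ ≤ δ⁻¹ * ∫ t, ‖f t‖ := by
  rw [← integral_const_mul]
  refine norm_integral_le_of_norm_le (hf.norm.const_mul _) (Eventually.of_forall fun t => ?_)
  rw [norm_mul, norm_real]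
  gcongr
  exact norm_I_div_sub_le hδ hz t

theorem differentiableOn_cauchyInt {f : ℝ → ℝ} (hf : Integrable f) :
    DifferentiableOn ℂ (cauchyInt f) {z | 0 < z.im} := by
  intro z₀ hz₀
  replace hz₀ : 0 < z₀.im := hz₀
  refine DifferentiableAt.differentiableWithinAt ?_
  have hmem : {z : ℂ | z₀.im / 2 < z.im} ∈ 𝓝 z₀ :=
    (isOpen_lt continuous_const continuous_im).mem_nhds (by
      change z₀.im / 2 < z₀.im
      linarith)
  have h := hasDerivAt_integral_of_dominated_loc_of_deriv_le (μ := volume) (𝕜 := ℂ)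
    (F := fun z (t : ℝ) => I / (z - t) * (f t : ℂ)) (x₀ := z₀)
    (F' := fun z (t : ℝ) => -I / (z - t) ^ 2 * (f t : ℂ))
    (bound := fun t => ((z₀.im / 2)⁻¹) ^ 2 * ‖f t‖) hmem ?_ ?_ ?_ ?_ ?_ ?_
  · exact h.2.differentiableAt
  · refine Eventually.of_forall fun z => AEStronglyMeasurable.mul ?_ hf.ofReal.aestronglyMeasurable
    exact (by fun_prop : Measurable fun t : ℝ => I / (z - t)).aestronglyMeasurable
  · exact integrable_cauchyKernel_mul hf hz₀
  · refine AEStronglyMeasurable.mul ?_ hf.ofReal.aestronglyMeasurable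
    exact (by fun_prop : Measurable fun t : ℝ => -I / (z₀ - t) ^ 2).aestronglyMeasurable
  · refine Eventually.of_forall fun t z hz => ?_
    rw [norm_mul, norm_real, norm_div, norm_neg, norm_I, norm_pow, one_div, ← inv_pow]
    gcongr
    exact (le_of_lt hz).trans (im_le_norm_sub_ofReal z t)
  · exact hf.norm.const_mul _
  · refine Eventually.of_forall fun t z hz => HasDerivAt.mul_const ?_ _
    have hz' : z - t ≠ 0 := sub_ofReal_ne_zero (lt_trans (by positivity) hz) t
    have := (hasDerivAt_const z I).div ((hasDerivAt_id z).sub_const (t : ℂ)) hz'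
    exact HasDerivAt.congr_deriv (f := fun x => I / (x - t)) this (by simp)

/-- The translate `z ↦ cauchyInt f (z + i δ)` is holomorphic near the closed upper half plane. -/
theorem differentiableOn_cauchyInt_add {f : ℝ → ℝ} (hf : Integrable f) {δ : ℝ} :
    DifferentiableOn ℂ (fun z => cauchyInt f (z + δ * I)) {z | -δ < z.im} := by
  refine (differentiableOn_cauchyInt hf).comp (by fun_prop) fun z hz => ?_
  have : -δ < z.im := hz
  simp
  linarith

/-- The Poisson formula for `z ↦ cauchyInt f (z + iδ)`, which is bounded and holomorphic on the half
plane. Its imaginary part gives `P_ε Q_δ = π Q_(ε+δ)`. -/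
theorem cauchyInt_semigroup {f : ℝ → ℝ} (hf : Integrable f) {ε δ : ℝ} (hε : 0 < ε) (hδ : 0 < δ)
    (x : ℝ) :
    ∫ t : ℝ, (ε / ((x - t) ^ 2 + ε ^ 2)) • cauchyInt f (t + δ * I) =
      Real.pi • cauchyInt f (x + (ε + δ : ℝ) * I) := by
  have hd := differentiableOn_cauchyInt_add hf (δ := δ)
  have h := integral_poissonKernel_smul_of_bounded (G := fun z => cauchyInt f (z + δ * I))
    (M := δ⁻¹ * ∫ t, ‖f t‖)
    (hd.continuousOn.mono fun z (hz : 0 ≤ z.im) => (neg_lt_zero.2 hδ).trans_le hz)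
    (hd.mono fun z (hz : 0 < z.im) => (neg_lt_zero.2 hδ).trans hz)
    (fun z hz => norm_cauchyInt_le hf hδ (by simpa using hz)) hε x
  rw [h]
  congr 2
  push_cast
  ring

theorem continuous_cauchyInt_add {f : ℝ → ℝ} (hf : Integrable f) {δ : ℝ} (hδ : 0 < δ) :
    Continuous fun t : ℝ => cauchyInt f (t + δ * I) :=
  (differentiableOn_cauchyInt_add hf (δ := δ)).continuousOn.comp_continuous continuous_ofReal
    (by simp [hδ])

theorem integrable_poissonKernel_smul_cauchyInt {f : ℝ → ℝ} (hf : Integrable f) {ε δ : ℝ}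
    (hε : 0 < ε) (hδ : 0 < δ) (x : ℝ) :
    Integrable fun t : ℝ => (ε / ((x - t) ^ 2 + ε ^ 2)) • cauchyInt f (t + δ * I) := by
  refine ((integrable_poissonKernel hε x).norm.mul_const (δ⁻¹ * ∫ t, ‖f t‖)).mono'
    ((integrable_poissonKernel hε x).aestronglyMeasurable.smul
      (continuous_cauchyInt_add hf hδ).aestronglyMeasurable) (Eventually.of_forall fun t => ?_)
  rw [norm_smul]
  gcongr
  exact norm_cauchyInt_le hf hδ (by simp)

theorem poissonInt_conjInt {f : ℝ → ℝ} (hf : Integrable f) {ε δ : ℝ} (hε : 0 < ε) (hδ : 0 < δ)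
    (x : ℝ) : poissonInt ε (conjInt δ f) x = Real.pi * conjInt (ε + δ) f x := by
  have h := congrArg imCLM (cauchyInt_semigroup hf hε hδ x)
  rw [← imCLM.integral_comp_comm (integrable_poissonKernel_smul_cauchyInt hf hε hδ x)] at h
  rw [poissonInt]
  simpa [cauchyInt_eq hf hδ, cauchyInt_eq hf (add_pos hε hδ), -ofReal_add] using h

/-- Fubini, the kernel being odd; its boundedness makes the double integral absolutely convergent.
-/
theorem integral_conjInt_mul {f g : ℝ → ℝ} (hf : Integrable f) (hg : Integrable g) {ε : ℝ}
    (hε : 0 < ε) : ∫ x, conjInt ε f x * g x = -∫ x, f x * conjInt ε g x := by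
  have hi : Integrable (Function.uncurry fun x t : ℝ =>
      (x - t) / ((x - t) ^ 2 + ε ^ 2) * f t * g x) (volume.prod volume) := by
    have h := (hg.mul_prod hf).bdd_mul (c := ε⁻¹)
      (f := fun z : ℝ × ℝ => (z.1 - z.2) / ((z.1 - z.2) ^ 2 + ε ^ 2))
      (by fun_prop : Measurable _).aestronglyMeasurable
      (Eventually.of_forall fun z => abs_conjKernel_le_inv hε (z.1 - z.2))
    refine h.congr (Eventually.of_forall fun z => ?_)
    simp only [Function.uncurry]
    ring
  calc ∫ x, conjInt ε f x * g x = ∫ x, ∫ t, (x - t) / ((x - t) ^ 2 + ε ^ 2) * f t * g x := by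
        simp only [conjInt, ← integral_mul_const]
    _ = ∫ t, ∫ x, (x - t) / ((x - t) ^ 2 + ε ^ 2) * f t * g x := integral_integral_swap hi
    _ = _ := by
        rw [← integral_neg]
        congr 1
        funext t
        rw [conjInt, ← integral_const_mul, ← integral_neg]
        congr 1
        funext x
        rw [← neg_sub t x, neg_sq]
        ring

end CauchyTransform

/-! ### M. Riesz's theorem, uniformly in `ε`. -/

section Riesz

open Complex ENNReal

/-- Near `|θ| = π/2` the angle `p|θ|` lies in `(π/2, π]`, because `1 < p ≤ 2`, so `-cos (pθ)` is
bounded below by a positive constant; elsewhere `cos θ` is. -/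
theorem exists_one_le_cos_rpow_sub_cos {p : ℝ} (hp : 1 < p) (hp2 : p ≤ 2) :
    ∃ A B : ℝ, 0 ≤ A ∧ ∀ θ : ℝ, |θ| < Real.pi / 2 →
      1 ≤ A * Real.cos θ ^ p - B * Real.cos (θ * p) := by
  have hpi := Real.pi_pos
  have hp0 : 0 < p := by linarith
  -- The two regimes are separated at the midpoint of `π/(2p)` and `π/2`. `B` makes `-B cos (pθ₀) =
  -- 1`, and `A` makes the first term at least `1 + B` below `θ₀`.
  set θ₀ : ℝ := (Real.pi / (2 * p) + Real.pi / 2) / 2 with hθ₀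
  have h1 : Real.pi / (2 * p) < Real.pi / 2 := by
    gcongr
    linarith
  have h2 : θ₀ < Real.pi / 2 := by linarith
  have h3 : Real.pi / (2 * p) < θ₀ := by linarith
  have h3' : 0 < θ₀ := lt_trans (by positivity) h3
  have h4 : Real.pi / 2 < θ₀ * p := by
    have := mul_lt_mul_of_pos_right h3 hp0
    calc Real.pi / 2 = Real.pi / (2 * p) * p := by field_simp
      _ < _ := this
  have h5 : θ₀ * p ≤ Real.pi := by nlinarith
  have h6 : Real.cos (θ₀ * p) < 0 := Real.cos_neg_of_pi_div_two_lt_of_lt h4 (by linarith)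
  have h7 : 0 < Real.cos θ₀ := Real.cos_pos_of_mem_Ioo ⟨by linarith, h2⟩
  set B : ℝ := 1 / -Real.cos (θ₀ * p) with hB
  have hBpos : 0 < B := one_div_pos.2 (by linarith)
  refine ⟨(1 + B) / Real.cos θ₀ ^ p, B, by positivity, fun θ hθ => ?_⟩
  have hcos : Real.cos θ = Real.cos |θ| := (Real.cos_abs θ).symm
  have hcosp : Real.cos (θ * p) = Real.cos (|θ| * p) := by
    rw [← Real.cos_abs (θ * p), abs_mul, abs_of_pos hp0]
  rw [hcos, hcosp]
  have h8 : 0 ≤ |θ| := abs_nonneg θ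
  have h9 : 0 < Real.cos |θ| := Real.cos_pos_of_mem_Ioo ⟨by linarith, hθ⟩
  rcases le_total θ₀ |θ| with h | h
  · have h10 : Real.cos (|θ| * p) ≤ Real.cos (θ₀ * p) := by
      refine Real.cos_le_cos_of_nonneg_of_le_pi (by positivity) (by nlinarith) (by gcongr)
    have h11 : 1 ≤ -(B * Real.cos (|θ| * p)) := by
      have : B * -Real.cos (θ₀ * p) = 1 := by
        rw [hB, one_div_mul_cancel]
        linarith
      nlinarith
    have h12 : 0 ≤ (1 + B) / Real.cos θ₀ ^ p * Real.cos |θ| ^ p := by positivity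
    linarith
  · have h10 : Real.cos θ₀ ≤ Real.cos |θ| :=
      Real.cos_le_cos_of_nonneg_of_le_pi h8 (by linarith) h
    have h11 : Real.cos θ₀ ^ p ≤ Real.cos |θ| ^ p := Real.rpow_le_rpow h7.le h10 hp0.le
    have h12 : 1 + B ≤ (1 + B) / Real.cos θ₀ ^ p * Real.cos |θ| ^ p := by
      rw [div_mul_eq_mul_div, le_div_iff₀ (by positivity)]
      gcongr
    have h13 := Real.cos_le_one (|θ| * p)
    nlinarith

theorem exists_norm_rpow_le {p : ℝ} (hp : 1 < p) (hp2 : p ≤ 2) :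
    ∃ A B : ℝ, 0 ≤ A ∧ ∀ z : ℂ, 0 < z.re → ‖z‖ ^ p ≤ A * z.re ^ p - B * (z ^ (p : ℂ)).re := by
  obtain ⟨A, B, hA, h⟩ := exists_one_le_cos_rpow_sub_cos hp hp2
  refine ⟨A, B, hA, fun z hz => ?_⟩
  have h1 := h z.arg (abs_arg_lt_pi_div_two_iff.2 (Or.inl hz))
  have h2 : 0 ≤ Real.cos z.arg := by
    have h3 := norm_mul_cos_arg z
    by_contra h4
    have := mul_nonpos_of_nonneg_of_nonpos (norm_nonneg z) (not_le.1 h4).le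
    linarith
  rw [cpow_ofReal_re, ← norm_mul_cos_arg z, Real.mul_rpow (norm_nonneg _) h2]
  have h3 : 0 ≤ ‖z‖ ^ p := by positivity
  nlinarith

theorem memLp_cauchyInt {f : ℝ → ℝ} (hf : Integrable f) {p : ℝ≥0∞} (hp : 1 < p) (hp' : p ≠ ∞)
    (hfp : MemLp f p) {ε : ℝ} (hε : 0 < ε) : MemLp (fun x : ℝ => cauchyInt f (x + ε * I)) p := by
  simp only [cauchyInt_eq hf hε]
  have h1 : MemLp (fun x => (poissonInt ε f x : ℂ)) p := (memLp_poissonInt hε hp.le hp' hfp).ofReal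
  have h2 : MemLp (fun x => (conjInt ε f x : ℂ)) p := (memLp_conjInt hε hp hp' hf).ofReal
  exact h1.add (h2.mul_const I)

theorem poissonInt_pos {f : ℝ → ℝ} (hf : Integrable f) (h0 : 0 ≤ f) (hpos : 0 < ∫ t, f t) {ε : ℝ}
    (hε : 0 < ε) (x : ℝ) : 0 < poissonInt ε f x := by
  rw [integral_pos_iff_support_of_nonneg h0 hf] at hpos
  rw [poissonInt, integral_pos_iff_support_of_nonneg (fun t => mul_nonneg (by positivity) (h0 t))
    (integrable_poissonKernel_mul le_rfl (memLp_one_iff_integrable.2 hf) hε x)]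
  convert hpos using 2
  ext t
  have : ε / ((x - t) ^ 2 + ε ^ 2) ≠ 0 := by positivity
  simp only [Function.mem_support, ne_eq, mul_eq_zero, this, false_or]

/-- For `f ≥ 0` of positive mass the Cauchy transform takes values in the right half plane, so its
principal `p`-th power is holomorphic. It is bounded on `Im z ≥ ε` and integrable on that line, so
its integral vanishes. -/
theorem integral_cauchyInt_cpow {f : ℝ → ℝ} (hf : Integrable f) (h0 : 0 ≤ f)
    (hpos : 0 < ∫ t, f t) {p : ℝ} (hp : 1 < p) (hfp : MemLp f (ENNReal.ofReal p)) {ε : ℝ}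
    (hε : 0 < ε) : Integrable (fun x : ℝ => cauchyInt f (x + ε * I) ^ (p : ℂ)) ∧
      ∫ x : ℝ, cauchyInt f (x + ε * I) ^ (p : ℂ) = 0 := by
  have hp0 : 0 < p := by linarith
  have hp1 : 1 < ENNReal.ofReal p := by rwa [← ENNReal.ofReal_one, ENNReal.ofReal_lt_ofReal_iff hp0]
  have hre : ∀ z : ℂ, 0 < z.im → 0 < (cauchyInt f z).re := by
    intro z hz
    have h1 : z = (z.re : ℂ) + (z.im : ℂ) * I := (re_add_im z).symm
    rw [h1, cauchyInt_eq hf hz]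
    simpa using poissonInt_pos hf h0 hpos hz z.re
  have hd : DifferentiableOn ℂ (fun z => cauchyInt f (z + ε * I) ^ (p : ℂ)) {z | -ε < z.im} := by
    refine (differentiableOn_cauchyInt_add hf (δ := ε)).cpow_const fun z hz => ?_
    refine mem_slitPlane_iff.2 (Or.inl (hre _ ?_))
    have : -ε < z.im := hz
    simp
    linarith
  have hi : Integrable fun x : ℝ => cauchyInt f (x + ε * I) ^ (p : ℂ) := by
    have h1 := (memLp_cauchyInt hf hp1 ENNReal.ofReal_ne_top hfp hε).integrable_norm_rpow
      (by simpa using hp0) ENNReal.ofReal_ne_top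
    rw [ENNReal.toReal_ofReal hp0.le] at h1
    refine h1.mono' (hd.continuousOn.comp_continuous continuous_ofReal
      (by simp [hε])).aestronglyMeasurable (Eventually.of_forall fun x => ?_)
    rw [norm_cpow_real]
  refine ⟨hi, integral_eq_zero_of_bounded_of_integrable
    (G := fun z => cauchyInt f (z + ε * I) ^ (p : ℂ)) (M := (ε⁻¹ * ∫ t, ‖f t‖) ^ p)
    (hd.continuousOn.mono fun z (hz : 0 ≤ z.im) => (neg_lt_zero.2 hε).trans_le hz)
    (hd.mono fun z (hz : 0 < z.im) => (neg_lt_zero.2 hε).trans hz) (fun z hz => ?_) hi⟩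
  rw [norm_cpow_real]
  exact Real.rpow_le_rpow (norm_nonneg _) (norm_cauchyInt_le hf hε (by simpa using hz)) hp0.le

/-- Integrating `|F|^p ≤ A (Re F)^p - B Re F^p` along `Im z = ε` kills the last term and leaves the
Poisson integral, whose `L^p` norm is at most `π` times that of `f`. -/
theorem eLpNorm_conjInt_le_of_nonneg {p : ℝ} (hp : 1 < p) (hp2 : p ≤ 2) :
    ∃ C : ℝ≥0∞, C ≠ ∞ ∧ ∀ (f : ℝ → ℝ) (ε : ℝ), 0 < ε → 0 ≤ f → Integrable f →
      MemLp f (ENNReal.ofReal p) →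
      eLpNorm (conjInt ε f) (ENNReal.ofReal p) ≤ C * eLpNorm f (ENNReal.ofReal p) := by
  obtain ⟨A, B, hA, hAB⟩ := exists_norm_rpow_le hp hp2
  have hp0 : 0 < p := by linarith
  have hp1 : 1 < ENNReal.ofReal p := by rwa [← ENNReal.ofReal_one, ENNReal.ofReal_lt_ofReal_iff hp0]
  have hpne : ENNReal.ofReal p ≠ 0 := by simpa using hp0
  refine ⟨ENNReal.ofReal (A ^ p⁻¹) * ENNReal.ofReal Real.pi,
    ENNReal.mul_ne_top ENNReal.ofReal_ne_top ENNReal.ofReal_ne_top, fun f ε hε h0 hf hfp => ?_⟩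
  -- A density of zero mass is treated apart: its Cauchy transform is zero and does not lie in the
  -- open right half plane.
  rcases (integral_nonneg h0).eq_or_lt with hz | hpos
  · have h1 : f =ᵐ[volume] 0 := (integral_eq_zero_iff_of_nonneg h0 hf).1 hz.symm
    have h2 : conjInt ε f = 0 := by
      funext x
      refine integral_eq_zero_of_ae ?_
      filter_upwards [h1] with t ht
      simp [ht]
    simp [h2]
  have hF := memLp_cauchyInt hf hp1 ENNReal.ofReal_ne_top hfp hε
  have hu := memLp_poissonInt hε hp1.le ENNReal.ofReal_ne_top hfp
  have hupos := poissonInt_pos hf h0 hpos hε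
  obtain ⟨hi, hint⟩ := integral_cauchyInt_cpow hf h0 hpos hp hfp hε
  have hFi := hF.integrable_norm_rpow hpne ENNReal.ofReal_ne_top
  have hui := hu.integrable_norm_rpow hpne ENNReal.ofReal_ne_top
  rw [ENNReal.toReal_ofReal hp0.le] at hFi hui
  have hre0 : ∫ x : ℝ, (cauchyInt f (x + ε * I) ^ (p : ℂ)).re = 0 := by
    have := reCLM.integral_comp_comm hi
    simpa [hint] using this
  have hrei : Integrable fun x : ℝ => (cauchyInt f (x + ε * I) ^ (p : ℂ)).re := hi.re
  have key : ∫ x : ℝ, ‖cauchyInt f (x + ε * I)‖ ^ p ≤ A * ∫ x, ‖poissonInt ε f x‖ ^ p := by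
    calc ∫ x : ℝ, ‖cauchyInt f (x + ε * I)‖ ^ p
        ≤ ∫ x : ℝ, (A * ‖poissonInt ε f x‖ ^ p -
            B * (cauchyInt f (x + ε * I) ^ (p : ℂ)).re) := by
          refine integral_mono hFi ((hui.const_mul A).sub (hrei.const_mul B)) fun x => ?_
          have hre : (cauchyInt f (x + ε * I)).re = poissonInt ε f x := by
            rw [cauchyInt_eq hf hε]; simp
          have := hAB (cauchyInt f (x + ε * I)) (by rw [hre]; exact hupos x)
          rw [hre] at this
          simpa [Real.norm_of_nonneg (hupos x).le] using this
      _ = _ := by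
          rw [integral_sub (hui.const_mul A) (hrei.const_mul B), integral_const_mul,
            integral_const_mul, hre0, mul_zero, sub_zero]
  have s1 : eLpNorm (conjInt ε f) (ENNReal.ofReal p) ≤
      eLpNorm (fun x : ℝ => cauchyInt f (x + ε * I)) (ENNReal.ofReal p) := by
        refine eLpNorm_mono fun x => ?_
        have him : (cauchyInt f (x + ε * I)).im = conjInt ε f x := by
          rw [cauchyInt_eq hf hε]; simp
        rw [← him]
        exact abs_im_le_norm _
  have s2 : eLpNorm (fun x : ℝ => cauchyInt f (x + ε * I)) (ENNReal.ofReal p) ≤ ENNReal.ofReal (A ^ p⁻¹) * eLpNorm (poissonInt ε f) (ENNReal.ofReal p) := by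
        have hI : 0 ≤ ∫ x : ℝ, ‖cauchyInt f (x + ε * I)‖ ^ p :=
          integral_nonneg fun x => Real.rpow_nonneg (norm_nonneg _) _
        have hJ : 0 ≤ ∫ x : ℝ, ‖poissonInt ε f x‖ ^ p :=
          integral_nonneg fun x => Real.rpow_nonneg (norm_nonneg _) _
        rw [hF.eLpNorm_eq_integral_rpow_norm hpne ENNReal.ofReal_ne_top,
          hu.eLpNorm_eq_integral_rpow_norm hpne ENNReal.ofReal_ne_top,
          ENNReal.toReal_ofReal hp0.le, ← ENNReal.ofReal_mul (Real.rpow_nonneg hA _),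
          ← Real.mul_rpow hA hJ]
        exact ENNReal.ofReal_le_ofReal (Real.rpow_le_rpow hI key (inv_nonneg.2 hp0.le))
  have s3 : ENNReal.ofReal (A ^ p⁻¹) * eLpNorm (poissonInt ε f) (ENNReal.ofReal p)  ≤ ENNReal.ofReal (A ^ p⁻¹) * (ENNReal.ofReal Real.pi * eLpNorm f (ENNReal.ofReal p)) :=
        mul_le_mul' le_rfl (eLpNorm_poissonInt_le hε hf.1 hp1.le ENNReal.ofReal_ne_top)
  have s4 := s1.trans (s2.trans s3)
  rw [← mul_assoc] at s4
  exact s4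

theorem conjInt_sub {f g : ℝ → ℝ} (hf : Integrable f) (hg : Integrable g) {ε : ℝ} (hε : 0 < ε) :
    conjInt ε (fun t => f t - g t) = fun x => conjInt ε f x - conjInt ε g x := by
  funext x
  simp only [conjInt, mul_sub]
  exact integral_sub (integrable_conjKernel_mul hf hε x) (integrable_conjKernel_mul hg hε x)

theorem conjInt_add {f g : ℝ → ℝ} (hf : Integrable f) (hg : Integrable g) {ε : ℝ} (hε : 0 < ε) :
    conjInt ε (fun t => f t + g t) = fun x => conjInt ε f x + conjInt ε g x := by
  funext x
  simp only [conjInt, mul_add]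
  exact integral_add (integrable_conjKernel_mul hf hε x) (integrable_conjKernel_mul hg hε x)

theorem eLpNorm_conjInt_le_of_le_two {p : ℝ} (hp : 1 < p) (hp2 : p ≤ 2) :
    ∃ C : ℝ≥0∞, C ≠ ∞ ∧ ∀ (f : ℝ → ℝ) (ε : ℝ), 0 < ε → Integrable f →
      MemLp f (ENNReal.ofReal p) →
      eLpNorm (conjInt ε f) (ENNReal.ofReal p) ≤ C * eLpNorm f (ENNReal.ofReal p) := by
  obtain ⟨C, hC, h⟩ := eLpNorm_conjInt_le_of_nonneg hp hp2
  have hp0 : 0 < p := by linarith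
  have hp1 : 1 < ENNReal.ofReal p := by rwa [← ENNReal.ofReal_one, ENNReal.ofReal_lt_ofReal_iff hp0]
  refine ⟨C * 2, ENNReal.mul_ne_top hC (by simp), fun f ε hε hf hfp => ?_⟩
  have hf' : f = fun t => max (f t) 0 - max (-f t) 0 := by
    funext t
    rcases le_total 0 (f t) with h | h
    · rw [max_eq_left h, max_eq_right (by linarith), sub_zero]
    · rw [max_eq_right h, max_eq_left (by linarith)]; ring
  have h1 : eLpNorm (fun t => max (f t) 0) (ENNReal.ofReal p) ≤ eLpNorm f (ENNReal.ofReal p) := by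
    refine eLpNorm_mono fun t => ?_
    rw [Real.norm_eq_abs, Real.norm_eq_abs, abs_of_nonneg (le_max_right _ _)]
    exact max_le (le_abs_self _) (abs_nonneg _)
  have h2 : eLpNorm (fun t => max (-f t) 0) (ENNReal.ofReal p) ≤ eLpNorm f (ENNReal.ofReal p) := by
    refine eLpNorm_mono fun t => ?_
    rw [Real.norm_eq_abs, Real.norm_eq_abs, abs_of_nonneg (le_max_right _ _)]
    exact max_le (neg_le_abs _) (abs_nonneg _)
  conv_lhs => rw [hf', conjInt_sub hf.pos_part hf.neg_part hε]
  refine (eLpNorm_sub_le (aestronglyMeasurable_conjInt ε hf.pos_part.1)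
    (aestronglyMeasurable_conjInt ε hf.neg_part.1) hp1.le).trans ?_
  rw [mul_two, add_mul]
  exact add_le_add
    ((h _ ε hε (fun t => le_max_right _ _) hf.pos_part hfp.pos_part).trans (by gcongr; exact h1))
    ((h _ ε hε (fun t => le_max_right _ _) hf.neg_part hfp.neg_part).trans (by gcongr; exact h2))

/-- Cancellation closing the duality argument; it requires `N` to be finite beforehand. -/
theorem le_of_rpow_le_mul_rpow_sub_one {N F C : ℝ≥0∞} (hN : N ≠ ∞) {p : ℝ} (hp : 1 < p)
    (h : N ^ p ≤ F * (C * N ^ (p - 1))) : N ≤ C * F := by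
  rcases eq_or_ne N 0 with rfl | h0
  · exact zero_le
  have h1 : N ^ (p - 1) ≠ 0 := by simp [ENNReal.rpow_eq_zero_iff, h0, hN]
  have h2 : N ^ (p - 1) ≠ ∞ := ENNReal.rpow_ne_top_of_nonneg (by linarith) hN
  have h3 : N ^ p = N * N ^ (p - 1) := by
    nth_rewrite 2 [← ENNReal.rpow_one N]
    rw [← ENNReal.rpow_add _ _ h0 hN]
    congr 1
    ring
  rw [h3, show F * (C * N ^ (p - 1)) = C * F * N ^ (p - 1) by ring] at h
  exact (ENNReal.mul_le_mul_iff_left h1 h2).1 h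

/-- Duality with the conjugate exponent `q ≤ 2`: test `g = Q_ε f` against `k = g |g|^(p-2)`, for
which `∫ g k = ‖g‖_p^p` and `‖k‖_q = ‖g‖_p^(p-1)`, and move `Q_ε` onto `k` by antisymmetry. -/
theorem eLpNorm_conjInt_le_of_two_lt {p : ℝ} (hp : 2 < p) :
    ∃ C : ℝ≥0∞, C ≠ ∞ ∧ ∀ (f : ℝ → ℝ) (ε : ℝ), 0 < ε → Integrable f →
      MemLp f (ENNReal.ofReal p) →
      eLpNorm (conjInt ε f) (ENNReal.ofReal p) ≤ C * eLpNorm f (ENNReal.ofReal p) := by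
  have hp0 : 0 < p := by linarith
  have hpq : p.HolderConjugate (Real.conjExponent p) := Real.HolderConjugate.conjExponent (by linarith)
  set q := Real.conjExponent p with hq
  have hq2 : q ≤ 2 := by
    rw [hq, Real.conjExponent, div_le_iff₀ (by linarith)]
    linarith
  have hqp : q * (p - 1) = p := by
    have := hpq.sub_one_mul_conj
    linarith
  obtain ⟨C, hC, h⟩ := eLpNorm_conjInt_le_of_le_two hpq.symm.lt hq2
  refine ⟨C, hC, fun f ε hε hf hfp => ?_⟩
  have hp1 : 1 < ENNReal.ofReal p := by
    rw [← ENNReal.ofReal_one, ENNReal.ofReal_lt_ofReal_iff hp0]; linarith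
  set g := conjInt ε f with hg
  have hgp : MemLp g (ENNReal.ofReal p) := memLp_conjInt hε hp1 ENNReal.ofReal_ne_top hf
  -- Here `p > 2` is essential: `p - 1 > 1` puts `g` in `L^(p-1)`, which makes `k` integrable.
  have hgp1 : MemLp g (ENNReal.ofReal (p - 1)) := memLp_conjInt hε (by
    rw [← ENNReal.ofReal_one, ENNReal.ofReal_lt_ofReal_iff (by linarith)]; linarith)
    ENNReal.ofReal_ne_top hf
  set k : ℝ → ℝ := fun x => g x * |g x| ^ (p - 2) with hk
  have hkn : ∀ x, ‖k x‖ = ‖g x‖ ^ (p - 1) := by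
    intro x
    simp only [hk, norm_mul, Real.norm_eq_abs, abs_of_nonneg (Real.rpow_nonneg (abs_nonneg _) _)]
    rcases eq_or_ne (g x) 0 with h0 | h0
    · simp [h0, Real.zero_rpow (by linarith : p - 1 ≠ 0)]
    · rw [show p - 1 = 1 + (p - 2) by ring, Real.rpow_add (abs_pos.2 h0), Real.rpow_one]
  have hkm : AEStronglyMeasurable k := by
    have := hgp.1.aemeasurable
    exact (this.mul ((this.abs).pow_const (p - 2))).aestronglyMeasurable
  have hnorm : ∀ r : ℝ≥0∞, eLpNorm k r = eLpNorm g (r * ENNReal.ofReal (p - 1)) ^ (p - 1) := by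
    intro r
    rw [← eLpNorm_norm_rpow g (by linarith : 0 < p - 1)]
    exact eLpNorm_congr_norm_ae (Eventually.of_forall fun x => by
      rw [hkn x, Real.norm_of_nonneg (Real.rpow_nonneg (norm_nonneg _) _)])
  have hk1 : Integrable k := by
    rw [← memLp_one_iff_integrable]
    refine ⟨hkm, ?_⟩
    rw [hnorm, one_mul]
    exact ENNReal.rpow_lt_top_of_nonneg (by linarith) hgp1.2.ne
  have hkq : eLpNorm k (ENNReal.ofReal q) = eLpNorm g (ENNReal.ofReal p) ^ (p - 1) := by
    rw [hnorm, ← ENNReal.ofReal_mul hpq.symm.nonneg, hqp]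
  have hkq' : MemLp k (ENNReal.ofReal q) :=
    ⟨hkm, by rw [hkq]; exact ENNReal.rpow_lt_top_of_nonneg (by linarith) hgp.2.ne⟩
  have hgk : ∀ x, g x * k x = ‖g x‖ ^ p := by
    intro x
    rcases eq_or_ne (g x) 0 with h0 | h0
    · simp [h0, hp0.ne']
    · simp only [hk]
      rw [← mul_assoc, ← sq, ← sq_abs, Real.norm_eq_abs, show p = (2 : ℕ) + (p - 2) by push_cast; ring,
        Real.rpow_add (abs_pos.2 h0), Real.rpow_natCast]
      congr 2
      push_cast
      ring
  have hi : Integrable fun x => ‖g x‖ ^ p := by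
    have := hgp.integrable_norm_rpow (by simpa using hp0) ENNReal.ofReal_ne_top
    rwa [ENNReal.toReal_ofReal hp0.le] at this
  have hmain : eLpNorm g (ENNReal.ofReal p) ^ p ≤
      eLpNorm f (ENNReal.ofReal p) * (C * eLpNorm g (ENNReal.ofReal p) ^ (p - 1)) := by
    have : ENNReal.HolderConjugate (ENNReal.ofReal p) (ENNReal.ofReal q) := hpq.ennrealOfReal
    have s1 : eLpNorm g (ENNReal.ofReal p) ^ p = ENNReal.ofReal (∫ x, g x * k x) := by
      rw [eLpNorm_eq_lintegral_rpow_enorm_toReal (by simpa using hp0) ENNReal.ofReal_ne_top,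
        ENNReal.toReal_ofReal hp0.le, ← ENNReal.rpow_mul, one_div_mul_cancel hp0.ne',
        ENNReal.rpow_one]
      simp only [hgk]
      rw [ofReal_integral_eq_lintegral_ofReal hi (Eventually.of_forall fun x => by positivity)]
      refine lintegral_congr fun x => ?_
      rw [← ENNReal.ofReal_rpow_of_nonneg (norm_nonneg _) hp0.le, ofReal_norm]
    have s2 : ENNReal.ofReal (∫ x, g x * k x) ≤ ‖∫ x, g x * k x‖ₑ := by
      rw [← ofReal_norm]
      exact ENNReal.ofReal_le_ofReal (Real.le_norm_self _)
    have s3 : ‖∫ x, g x * k x‖ₑ = ‖∫ x, f x * conjInt ε k x‖ₑ := by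
      rw [hg, integral_conjInt_mul hf hk1 hε, enorm_neg]
    have s4 : ‖∫ x, f x * conjInt ε k x‖ₑ ≤ eLpNorm (f • conjInt ε k) 1 := by
      rw [eLpNorm_one_eq_lintegral_enorm]
      exact enorm_integral_le_lintegral_enorm _
    have s5 : eLpNorm (f • conjInt ε k) 1 ≤
        eLpNorm f (ENNReal.ofReal p) * eLpNorm (conjInt ε k) (ENNReal.ofReal q) :=
      eLpNorm_smul_le_mul_eLpNorm (aestronglyMeasurable_conjInt ε hkm) hf.1
    have s6 := h k ε hε hk1 hkq'
    rw [hkq] at s6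
    rw [s1]
    refine s2.trans ?_
    rw [s3]
    exact s4.trans (s5.trans (mul_le_mul' le_rfl s6))
  exact le_of_rpow_le_mul_rpow_sub_one hgp.2.ne (by linarith) hmain

/-- M. Riesz's theorem for the conjugate Poisson integrals. -/
theorem exists_eLpNorm_conjInt_le {p : ℝ≥0∞} (hp : 1 < p) (hp' : p ≠ ∞) :
    ∃ C : ℝ≥0∞, C ≠ ∞ ∧ ∀ (f : ℝ → ℝ) (ε : ℝ), 0 < ε → Integrable f → MemLp f p →
      eLpNorm (conjInt ε f) p ≤ C * eLpNorm f p := by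
  have h1 : 1 < p.toReal := by
    rw [← ENNReal.toReal_one]
    exact (ENNReal.toReal_lt_toReal one_ne_top hp').2 hp
  rw [← ENNReal.ofReal_toReal hp']
  rcases le_or_gt p.toReal 2 with h2 | h2
  · exact eLpNorm_conjInt_le_of_le_two h1 h2
  · exact eLpNorm_conjInt_le_of_two_lt h2

end Riesz

/-! ### The Hilbert transform as a limit in `L^p` and almost everywhere. -/

section Hilbert

open Complex ENNReal

/-- Imaginary part of the Poisson formula for `z ↦ i / (z + iε - x)`. -/
theorem poissonInt_conjKernel {ε δ : ℝ} (hε : 0 < ε) (hδ : 0 < δ) (x s : ℝ) :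
    poissonInt δ (fun t => (x - t) / ((x - t) ^ 2 + ε ^ 2)) s =
      Real.pi * ((x - s) / ((x - s) ^ 2 + (ε + δ) ^ 2)) := by
  have hne : ∀ z : ℂ, -ε < z.im → z + ε * I - x ≠ 0 := fun z hz =>
    sub_ofReal_ne_zero (by simpa using by linarith) x
  have hd : DifferentiableOn ℂ (fun z : ℂ => I / (z + ε * I - x)) {z | -ε < z.im} :=
    DifferentiableOn.div (by fun_prop) (by fun_prop) hne
  have hb : ∀ z : ℂ, 0 ≤ z.im → ‖I / (z + ε * I - x)‖ ≤ ε⁻¹ := fun z hz =>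
    norm_I_div_sub_le hε (by simpa using hz) x
  have hi : Integrable fun t : ℝ => (δ / ((s - t) ^ 2 + δ ^ 2)) • (I / ((t : ℂ) + ε * I - x)) := by
    refine ((integrable_poissonKernel hδ s).norm.mul_const ε⁻¹).mono'
      ((integrable_poissonKernel hδ s).aestronglyMeasurable.smul
        (by fun_prop : Measurable fun t : ℝ => I / ((t : ℂ) + ε * I - x)).aestronglyMeasurable)
      (Eventually.of_forall fun t => ?_)
    rw [norm_smul]
    gcongr
    exact hb t (by simp)
  have h := congrArg imCLM (integral_poissonKernel_smul_of_bounded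
    (hd.continuousOn.mono fun z (hz : 0 ≤ z.im) => (neg_lt_zero.2 hε).trans_le hz)
    (hd.mono fun z (hz : 0 < z.im) => (neg_lt_zero.2 hε).trans hz) hb hδ s)
  rw [← imCLM.integral_comp_comm hi] at h
  have h1 : ∀ t : ℝ, imCLM ((δ / ((s - t) ^ 2 + δ ^ 2)) • (I / ((t : ℂ) + ε * I - x))) =
      -(δ / ((s - t) ^ 2 + δ ^ 2) * ((x - t) / ((x - t) ^ 2 + ε ^ 2))) := by
    intro t
    rw [I_div_sub_eq hε, map_smul, ← neg_sub x t, neg_sq]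
    simp [-ofReal_div]
    ring
  have h2 : imCLM (Real.pi • (I / ((s : ℂ) + δ * I + ε * I - x))) =
      -(Real.pi * ((x - s) / ((x - s) ^ 2 + (ε + δ) ^ 2))) := by
    have : (s : ℂ) + δ * I + ε * I - x = s + ((ε + δ : ℝ) : ℂ) * I - x := by push_cast; ring
    rw [this, I_div_sub_eq (add_pos hε hδ), map_smul, ← neg_sub x s, neg_sq]
    simp [-ofReal_div]
    ring
  simp only [h1] at h
  rw [h2, integral_neg, neg_inj] at h
  exact h

theorem integral_mul_poissonInt {f g : ℝ → ℝ} {c : ℝ} (hf : Integrable f)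
    (hg : AEStronglyMeasurable g) (hgc : ∀ t, |g t| ≤ c) {δ : ℝ} (hδ : 0 < δ) :
    ∫ t, g t * poissonInt δ f t = ∫ s, poissonInt δ g s * f s := by
  have hi : Integrable (Function.uncurry fun t s : ℝ =>
      g t * (δ / ((t - s) ^ 2 + δ ^ 2) * f s)) (volume.prod volume) := by
    have h0 : Integrable fun s : ℝ => δ / (s ^ 2 + δ ^ 2) := by
      simpa using integrable_poissonKernel hδ 0
    have h := hf.convolution_integrand (ContinuousLinearMap.mul ℝ ℝ) h0
    refine (h.bdd_mul (f := fun z : ℝ × ℝ => g z.1) hg.comp_fst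
      (Eventually.of_forall fun z => hgc z.1)).congr (Eventually.of_forall fun z => ?_)
    simp only [Function.uncurry, ContinuousLinearMap.mul_apply']
    ring
  have e1 : ∫ t, g t * poissonInt δ f t = ∫ t, ∫ s, g t * (δ / ((t - s) ^ 2 + δ ^ 2) * f s) := by
    simp only [poissonInt, ← integral_const_mul]
  have e2 : ∫ s, poissonInt δ g s * f s = ∫ s, ∫ t, g t * (δ / ((t - s) ^ 2 + δ ^ 2) * f s) := by
    congr 1
    funext s
    rw [poissonInt, ← integral_mul_const]
    congr 1
    funext t
    rw [← neg_sub t s, neg_sq]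
    ring
  rw [e1, e2, integral_integral_swap hi]

theorem conjInt_poissonInt {f : ℝ → ℝ} (hf : Integrable f) {ε δ : ℝ} (hε : 0 < ε) (hδ : 0 < δ)
    (x : ℝ) : conjInt ε (poissonInt δ f) x = Real.pi * conjInt (ε + δ) f x := by
  rw [conjInt, integral_mul_poissonInt (g := fun t => (x - t) / ((x - t) ^ 2 + ε ^ 2)) hf
    (by fun_prop : Measurable _).aestronglyMeasurable
    (fun t => abs_conjKernel_le_inv hε (x - t)) hδ, conjInt, ← integral_const_mul]
  simp only [poissonInt_conjKernel hε hδ, mul_assoc]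

theorem conjInt_const_mul (c : ℝ) (f : ℝ → ℝ) (ε x : ℝ) :
    conjInt ε (fun t => c * f t) x = c * conjInt ε f x := by
  rw [conjInt, conjInt, ← integral_const_mul]
  congr 1
  funext t
  ring

/-- Writes an increment in `ε` as `Q_ε` of the Poisson error of `f` at scale `δ`; with Riesz's bound
it is small uniformly in `ε`. -/
theorem conjInt_sub_conjInt_add {f : ℝ → ℝ} (hf : Integrable f) {ε δ : ℝ} (hε : 0 < ε)
    (hδ : 0 < δ) (x : ℝ) : conjInt ε f x - conjInt (ε + δ) f x =
      conjInt ε (fun t => f t - Real.pi⁻¹ * poissonInt δ f t) x := by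
  have h1 : Integrable (poissonInt δ f) := by
    rw [← memLp_one_iff_integrable] at hf ⊢
    exact memLp_poissonInt hδ le_rfl one_ne_top hf
  rw [congrFun (conjInt_sub hf (h1.const_mul Real.pi⁻¹) hε) x, conjInt_const_mul,
    conjInt_poissonInt hf hε hδ, inv_mul_cancel_left₀ Real.pi_ne_zero]

/-- The conjugate Poisson integrals converge in `L^p`. -/
theorem exists_tendsto_eLpNorm_conjInt {p : ℝ≥0∞} (hp : 1 < p) (hp' : p ≠ ∞) {f : ℝ → ℝ}
    (hf : Integrable f) (hfp : MemLp f p) : ∃ h : ℝ → ℝ, MemLp h p ∧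
      Tendsto (fun ε => eLpNorm (fun x => conjInt ε f x - h x) p) (𝓝[>] 0) (𝓝 0) := by
  have : Fact (1 ≤ p) := ⟨hp.le⟩
  obtain ⟨C, hC, hCb⟩ := exists_eLpNorm_conjInt_le hp hp'
  have hQ : ∀ {ε : ℝ}, 0 < ε → MemLp (conjInt ε f) p := fun hε => memLp_conjInt hε hp hp' hf
  have hd : Tendsto (fun δ => C * (ENNReal.ofReal Real.pi⁻¹ *
      eLpNorm (fun x => poissonInt δ f x - Real.pi * f x) p)) (𝓝[>] 0) (𝓝 0) := by
    have h1 := tendsto_eLpNorm_poissonInt_sub hp.le hp' hfp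
    have h2 := ENNReal.Tendsto.const_mul (a := ENNReal.ofReal Real.pi⁻¹) h1
      (Or.inr ENNReal.ofReal_ne_top)
    have h3 := ENNReal.Tendsto.const_mul (a := C) h2 (Or.inr hC)
    simpa using h3
  have hdist : ∀ ε δ : ℝ, 0 < ε → 0 < δ →
      eLpNorm (fun x => conjInt ε f x - conjInt (ε + δ) f x) p ≤
        C * (ENNReal.ofReal Real.pi⁻¹ * eLpNorm (fun x => poissonInt δ f x - Real.pi * f x) p) := by
    intro ε δ hε hδ
    have hPi : Integrable (poissonInt δ f) := by
      rw [← memLp_one_iff_integrable] at hf ⊢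
      exact memLp_poissonInt hδ le_rfl one_ne_top hf
    have hPp := memLp_poissonInt hδ hp.le hp' hfp
    simp only [conjInt_sub_conjInt_add hf hε hδ]
    refine (hCb _ ε hε (hf.sub (hPi.const_mul Real.pi⁻¹))
      (hfp.sub (hPp.const_mul Real.pi⁻¹))).trans (mul_le_mul' le_rfl (le_of_eq ?_))
    have h1 : (f - fun t => Real.pi⁻¹ * poissonInt δ f t) =
        (-Real.pi⁻¹) • fun x => poissonInt δ f x - Real.pi * f x := by
      funext t
      simp only [Pi.smul_apply, Pi.sub_apply, smul_eq_mul]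
      have := Real.pi_ne_zero
      field_simp
      ring
    rw [h1, eLpNorm_const_smul, enorm_neg, Real.enorm_of_nonneg (by positivity)]
  let F : ℝ → Lp ℝ p (volume : Measure ℝ) := fun ε => if h : 0 < ε then (hQ h).toLp _ else 0
  have hF : ∀ ε (h : 0 < ε), F ε = (hQ h).toLp _ := fun ε h => dif_pos h
  have hcauchy : Cauchy (Filter.map F (𝓝[>] 0)) := by
    rw [EMetric.cauchy_iff]
    refine ⟨(inferInstance : NeBot (Filter.map F (𝓝[>] 0))).ne, fun η hη => ?_⟩
    obtain ⟨r, hr, hr'⟩ := mem_nhdsGT_iff_exists_Ioo_subset.1 (hd.eventually (gt_mem_nhds hη))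
    replace hr : 0 < r := hr
    refine ⟨F '' Set.Ioo 0 r, image_mem_map (Ioo_mem_nhdsGT hr), ?_⟩
    have hlt : ∀ a ∈ Set.Ioo 0 r, ∀ b ∈ Set.Ioo 0 r, a ≤ b → edist (F a) (F b) < η := by
      intro a ha b hb hab
      rcases hab.eq_or_lt with rfl | hab
      · simpa using hη
      rw [hF a ha.1, hF b hb.1, Lp.edist_toLp_toLp]
      have h1 := hdist a (b - a) ha.1 (sub_pos.2 hab)
      rw [add_sub_cancel] at h1
      exact lt_of_le_of_lt h1 (hr' ⟨sub_pos.2 hab, by linarith [ha.1, hb.2]⟩)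
    rintro _ ⟨a, ha, rfl⟩ _ ⟨b, hb, rfl⟩
    rcases le_total a b with hab | hab
    · exact hlt a ha b hb hab
    · rw [edist_comm]; exact hlt b hb a ha hab
  obtain ⟨h, hh⟩ := CompleteSpace.complete hcauchy
  refine ⟨h, Lp.memLp h, ?_⟩
  have h1 : Tendsto F (𝓝[>] 0) (𝓝 h) := hh
  rw [Lp.tendsto_Lp_iff_tendsto_eLpNorm'] at h1
  refine h1.congr' ?_
  filter_upwards [self_mem_nhdsWithin] with ε hε
  rw [hF ε hε]
  refine eLpNorm_congr_ae ?_
  filter_upwards [(hQ hε).coeFn_toLp] with x hx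
  simp [hx]

/-- Convergence of integrals of products of functions converging in dual Lebesgue spaces. -/
theorem tendsto_integral_mul_mul {ι : Type*} {l : Filter ι} {p q : ℝ≥0∞} [p.HolderConjugate q]
    {u v : ι → ℝ → ℝ} {u₀ v₀ w : ℝ → ℝ} {c : ℝ} (hu : ∀ᶠ i in l, MemLp (u i) p)
    (hu₀ : MemLp u₀ p) (hv : ∀ᶠ i in l, MemLp (v i) q) (hv₀ : MemLp v₀ q)
    (hw : AEStronglyMeasurable w) (hwc : ∀ x, |w x| ≤ c)
    (hul : Tendsto (fun i => eLpNorm (fun x => u i x - u₀ x) p) l (𝓝 0))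
    (hvl : Tendsto (fun i => eLpNorm (fun x => v i x - v₀ x) q) l (𝓝 0)) :
    Tendsto (fun i => ∫ x, w x * (u i x * v i x)) l (𝓝 (∫ x, w x * (u₀ x * v₀ x))) := by
  have hint : ∀ {a b : ℝ → ℝ}, MemLp a p → MemLp b q → Integrable fun x => w x * (a x * b x) :=
    fun ha hb => (ha.integrable_mul hb).bdd_mul hw (Eventually.of_forall hwc)
  obtain ⟨K, hK, hnorm⟩ : ∃ K : ℝ≥0∞, K ≠ ∞ ∧ ∀ {a b : ℝ → ℝ}, MemLp a p → MemLp b q →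
      eLpNorm (fun x => w x * (a x * b x)) 1 ≤ K * (eLpNorm a p * eLpNorm b q) := by
    refine ⟨ENNReal.ofReal c, ENNReal.ofReal_ne_top, fun {a b} ha hb => ?_⟩
    have h1 : eLpNorm (fun x => w x * (a x * b x)) 1 ≤ ENNReal.ofReal c * eLpNorm (a • b) 1 := by
      refine eLpNorm_le_mul_eLpNorm_of_ae_le_mul (Eventually.of_forall fun x => ?_) 1
      rw [norm_mul]
      exact mul_le_mul_of_nonneg_right (hwc x) (norm_nonneg _)
    exact h1.trans (mul_le_mul' le_rfl (eLpNorm_smul_le_mul_eLpNorm hb.1 ha.1))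
  refine tendsto_integral_of_L1' _ (hint hu₀ hv₀).1 ?_ ?_
  · filter_upwards [hu, hv] with i hi hi'
    exact hint hi hi'
  have h0 : Tendsto (fun i => K *
      (eLpNorm (fun x => u i x - u₀ x) p * eLpNorm (fun x => v i x - v₀ x) q) +
      K * (eLpNorm (fun x => u i x - u₀ x) p * eLpNorm v₀ q) +
      K * (eLpNorm u₀ p * eLpNorm (fun x => v i x - v₀ x) q)) l (𝓝 0) := by
    have hu' := hu₀.2.ne
    have hv' := hv₀.2.ne
    generalize eLpNorm u₀ p = A at hu' ⊢
    generalize eLpNorm v₀ q = B at hv' ⊢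
    have a1 := ENNReal.Tendsto.mul hul (Or.inr zero_ne_top) hvl (Or.inr zero_ne_top)
    have a2 := ENNReal.Tendsto.mul_const (b := B) hul (Or.inr hv')
    have a3 := ENNReal.Tendsto.const_mul (a := A) hvl (Or.inr hu')
    have b1 := ENNReal.Tendsto.const_mul (a := K) a1 (Or.inr hK)
    have b2 := ENNReal.Tendsto.const_mul (a := K) a2 (Or.inr hK)
    have b3 := ENNReal.Tendsto.const_mul (a := K) a3 (Or.inr hK)
    have b4 := (b1.add b2).add b3
    simpa only [mul_zero, zero_mul, add_zero] using b4
  refine tendsto_of_tendsto_of_tendsto_of_le_of_le' tendsto_const_nhds h0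
    (Eventually.of_forall fun _ => zero_le) ?_
  filter_upwards [hu, hv] with i hi hi'
  have du : MemLp (fun x => u i x - u₀ x) p := hi.sub hu₀
  have dv : MemLp (fun x => v i x - v₀ x) q := hi'.sub hv₀
  -- This splitting involves only the differences and the fixed limits, so no uniform bound on `u i`
  -- or `v i` is needed.
  have e : ((fun x => w x * (u i x * v i x)) - fun x => w x * (u₀ x * v₀ x)) =
      ((fun x => w x * ((u i x - u₀ x) * (v i x - v₀ x))) +
        fun x => w x * ((u i x - u₀ x) * v₀ x)) + fun x => w x * (u₀ x * (v i x - v₀ x)) := by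
    funext x
    simp only [Pi.sub_apply, Pi.add_apply]
    ring
  rw [e]
  refine (eLpNorm_add_le ((hint du dv).add (hint du hv₀)).1 (hint hu₀ dv).1 le_rfl).trans
    (add_le_add ((eLpNorm_add_le (hint du dv).1 (hint du hv₀).1 le_rfl).trans
      (add_le_add (hnorm du dv) (hnorm du hv₀))) (hnorm hu₀ dv))

/-- The (unnormalized) Hilbert transform, the limit of the conjugate Poisson integrals. -/
noncomputable def hilbert (f : ℝ → ℝ) (x : ℝ) : ℝ :=
  limUnder (𝓝[>] (0 : ℝ)) fun ε => conjInt ε f x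

theorem tendsto_conjInt_add {f : ℝ → ℝ} (hf : Integrable f) {δ : ℝ} (hδ : 0 < δ) (x : ℝ) :
    Tendsto (fun ε => conjInt (δ + ε) f x) (𝓝[>] 0) (𝓝 (conjInt δ f x)) := by
  have him : ∀ {ε : ℝ}, 0 < ε → conjInt ε f x = (cauchyInt f (x + ε * I)).im := by
    intro ε hε
    rw [cauchyInt_eq hf hε]
    simp
  have hopen : IsOpen {z : ℂ | 0 < z.im} := isOpen_lt continuous_const continuous_im
  have hc : ContinuousAt (cauchyInt f) (x + ((δ + 0 : ℝ) : ℂ) * I) :=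
    ((differentiableOn_cauchyInt hf).differentiableAt
      (hopen.mem_nhds (by simpa using hδ))).continuousAt
  have h1 : Tendsto (fun ε : ℝ => (cauchyInt f (x + ((δ + ε : ℝ) : ℂ) * I)).im) (𝓝 0)
      (𝓝 (cauchyInt f (x + ((δ + 0 : ℝ) : ℂ) * I)).im) := by
    have hg : Continuous fun ε : ℝ => (x : ℂ) + ((δ + ε : ℝ) : ℂ) * I := by fun_prop
    exact continuous_im.continuousAt.tendsto.comp (hc.tendsto.comp (hg.tendsto 0))
  rw [← him (by simpa using hδ), add_zero] at h1
  refine (h1.mono_left nhdsWithin_le_nhds).congr' ?_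
  filter_upwards [self_mem_nhdsWithin] with ε hε
  exact (him (add_pos hδ hε)).symm

/-- Let `h` be the `L^p` limit. Passing to the limit in `P_δ Q_ε f = π Q_(δ+ε) f` gives `P_δ h = π
Q_δ f`, so almost everywhere convergence of `Q_δ f` is that of the Poisson integrals of `h`, and `h`
agrees almost everywhere with the pointwise limit `hilbert f`. -/
theorem exists_hilbert_aux {p : ℝ≥0∞} (hp : 1 < p) (hp' : p ≠ ∞) {f : ℝ → ℝ}
    (hf : Integrable f) (hfp : MemLp f p) : MemLp (hilbert f) p ∧
      Tendsto (fun ε => eLpNorm (fun x => conjInt ε f x - hilbert f x) p) (𝓝[>] 0) (𝓝 0) ∧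
      ∀ᵐ x, Tendsto (fun ε => conjInt ε f x) (𝓝[>] 0) (𝓝 (hilbert f x)) := by
  obtain ⟨h, hh, hlim⟩ := exists_tendsto_eLpNorm_conjInt hp hp' hf hfp
  have hconj : p.HolderConjugate (p.conjExponent) := ENNReal.HolderConjugate.conjExponent hp.le
  have hq : 1 ≤ p.conjExponent := ENNReal.HolderConjugate.one_le p.conjExponent p
  have hP : ∀ δ : ℝ, 0 < δ → ∀ x, poissonInt δ h x = Real.pi * conjInt δ f x := by
    intro δ hδ x
    have h1 := tendsto_integral_mul_mul (l := 𝓝[>] (0 : ℝ)) (p := p) (q := p.conjExponent)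
      (u := fun ε => conjInt ε f) (u₀ := h) (v := fun _ t => δ / ((x - t) ^ 2 + δ ^ 2))
      (v₀ := fun t => δ / ((x - t) ^ 2 + δ ^ 2)) (w := fun _ => 1) (c := 1)
      (by filter_upwards [self_mem_nhdsWithin] with ε hε
          exact memLp_conjInt hε hp hp' hf) hh
      (Eventually.of_forall fun _ => memLp_poissonKernel_sub hδ hq x)
      (memLp_poissonKernel_sub hδ hq x) aestronglyMeasurable_const (by simp) hlim (by simp)
    have h2 : Tendsto (fun ε => Real.pi * conjInt (δ + ε) f x) (𝓝[>] 0)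
        (𝓝 (Real.pi * conjInt δ f x)) := (tendsto_conjInt_add hf hδ x).const_mul _
    have h3 : ∫ t, 1 * (h t * (δ / ((x - t) ^ 2 + δ ^ 2))) = poissonInt δ h x := by
      rw [poissonInt]; congr 1; funext t; ring
    rw [h3] at h1
    refine tendsto_nhds_unique h1 (h2.congr' ?_)
    filter_upwards [self_mem_nhdsWithin] with ε hε
    rw [← poissonInt_conjInt hf hδ hε, poissonInt]
    congr 1; funext t; ring
  have hae : ∀ᵐ x, Tendsto (fun ε => conjInt ε f x) (𝓝[>] 0) (𝓝 (h x)) := by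
    filter_upwards [ae_tendsto_poissonInt hp.le hh] with x hx
    have h1 := hx.const_mul Real.pi⁻¹
    rw [inv_mul_cancel_left₀ Real.pi_ne_zero] at h1
    refine h1.congr' ?_
    filter_upwards [self_mem_nhdsWithin] with ε hε
    rw [hP ε hε, inv_mul_cancel_left₀ Real.pi_ne_zero]
  have heq : hilbert f =ᵐ[volume] h := by
    filter_upwards [hae] with x hx
    exact hx.limUnder_eq
  refine ⟨hh.ae_eq heq.symm, hlim.congr fun ε => eLpNorm_congr_ae ?_, ?_⟩
  · filter_upwards [heq] with x hx
    rw [hx]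
  · filter_upwards [hae, heq] with x hx hx'
    rwa [hx']

theorem memLp_hilbert {p : ℝ≥0∞} (hp : 1 < p) (hp' : p ≠ ∞) {f : ℝ → ℝ}
    (hf : Integrable f) (hfp : MemLp f p) : MemLp (hilbert f) p :=
  (exists_hilbert_aux hp hp' hf hfp).1

theorem tendsto_eLpNorm_conjInt_sub_hilbert {p : ℝ≥0∞} (hp : 1 < p) (hp' : p ≠ ∞) {f : ℝ → ℝ}
    (hf : Integrable f) (hfp : MemLp f p) :
    Tendsto (fun ε => eLpNorm (fun x => conjInt ε f x - hilbert f x) p) (𝓝[>] 0) (𝓝 0) :=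
  (exists_hilbert_aux hp hp' hf hfp).2.1

theorem ae_tendsto_conjInt {p : ℝ≥0∞} (hp : 1 < p) (hp' : p ≠ ∞) {f : ℝ → ℝ}
    (hf : Integrable f) (hfp : MemLp f p) :
    ∀ᵐ x, Tendsto (fun ε => conjInt ε f x) (𝓝[>] 0) (𝓝 (hilbert f x)) :=
  (exists_hilbert_aux hp hp' hf hfp).2.2

/-- The Hilbert transform is antisymmetric. -/
theorem integral_hilbert_mul {p q : ℝ≥0∞} [p.HolderConjugate q] (hp : 1 < p) (hp' : p ≠ ∞)
    (hq : 1 < q) (hq' : q ≠ ∞) {f g : ℝ → ℝ} (hf : Integrable f) (hfp : MemLp f p)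
    (hg : Integrable g) (hgq : MemLp g q) :
    ∫ x, hilbert f x * g x = -∫ x, f x * hilbert g x := by
  have h1 := tendsto_integral_mul_mul (l := 𝓝[>] (0 : ℝ)) (p := p) (q := q)
    (u := fun ε => conjInt ε f) (u₀ := hilbert f) (v := fun _ => g) (v₀ := g) (w := fun _ => 1)
    (c := 1) (by filter_upwards [self_mem_nhdsWithin] with ε hε
                 exact memLp_conjInt hε hp hp' hf) (memLp_hilbert hp hp' hf hfp)
    (Eventually.of_forall fun _ => hgq) hgq aestronglyMeasurable_const (by simp)
    (tendsto_eLpNorm_conjInt_sub_hilbert hp hp' hf hfp) (by simp)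
  have h2 := tendsto_integral_mul_mul (l := 𝓝[>] (0 : ℝ)) (p := p) (q := q)
    (u := fun _ => f) (u₀ := f) (v := fun ε => conjInt ε g) (v₀ := hilbert g) (w := fun _ => 1)
    (c := 1) (Eventually.of_forall fun _ => hfp) hfp
    (by filter_upwards [self_mem_nhdsWithin] with ε hε
        exact memLp_conjInt hε hq hq' hg) (memLp_hilbert hq hq' hg hgq)
    aestronglyMeasurable_const (by simp) (by simp)
    (tendsto_eLpNorm_conjInt_sub_hilbert hq hq' hg hgq)
  simp only [one_mul] at h1 h2
  refine tendsto_nhds_unique h1 (h2.neg.congr' ?_)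
  filter_upwards [self_mem_nhdsWithin] with ε hε
  exact (integral_conjInt_mul hf hg hε).symm

end Hilbert

/-! ### Tricomi's identity. -/

section Tricomi

open Complex ENNReal

/-- The integrand is the trace of a bounded holomorphic function, integrable by Hölder since the two
Cauchy transforms lie in conjugate Lebesgue spaces. -/
theorem integral_kernel_mul_cauchyInt_mul_cauchyInt {p q : ℝ≥0∞} [p.HolderConjugate q]
    (hp : 1 < p) (hp' : p ≠ ∞) (hq : 1 < q) (hq' : q ≠ ∞) {f g : ℝ → ℝ} (hf : Integrable f)
    (hfp : MemLp f p) (hg : Integrable g) (hgq : MemLp g q) {ε δ : ℝ} (hε : 0 < ε) (hδ : 0 < δ)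
    (x : ℝ) :
    Integrable (fun t : ℝ => I / ((t : ℂ) + ε * I - x) *
      (cauchyInt f (t + δ * I) * cauchyInt g (t + δ * I))) ∧
    ∫ t : ℝ, I / ((t : ℂ) + ε * I - x) *
      (cauchyInt f (t + δ * I) * cauchyInt g (t + δ * I)) = 0 := by
  have hne : ∀ z : ℂ, 0 ≤ z.im → z + ε * I - x ≠ 0 := fun z hz =>
    sub_ofReal_ne_zero (by simpa using by linarith) x
  have hb : ∀ z : ℂ, 0 ≤ z.im → ‖I / (z + ε * I - x)‖ ≤ ε⁻¹ := fun z hz =>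
    norm_I_div_sub_le hε (by simpa using hz) x
  have hdf := differentiableOn_cauchyInt_add hf (δ := δ)
  have hdg := differentiableOn_cauchyInt_add hg (δ := δ)
  have hs0 : {z : ℂ | 0 ≤ z.im} ⊆ {z | -δ < z.im} :=
    fun z (hz : 0 ≤ z.im) => (neg_lt_zero.2 hδ).trans_le hz
  have hs1 : {z : ℂ | 0 < z.im} ⊆ {z | 0 ≤ z.im} := fun z (hz : 0 < z.im) => hz.le
  have hi : Integrable fun t : ℝ => I / ((t : ℂ) + ε * I - x) *
      (cauchyInt f (t + δ * I) * cauchyInt g (t + δ * I)) :=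
    ((memLp_cauchyInt hf hp hp' hfp hδ).integrable_mul (memLp_cauchyInt hg hq hq' hgq hδ)).bdd_mul
      (by fun_prop : Measurable fun t : ℝ => I / ((t : ℂ) + ε * I - x)).aestronglyMeasurable
      (Eventually.of_forall fun t => hb t (by simp))
  have hk : DifferentiableOn ℂ (fun z : ℂ => I / (z + ε * I - x)) {z | 0 ≤ z.im} :=
    DifferentiableOn.div (by fun_prop) (by fun_prop) hne
  refine ⟨hi, integral_eq_zero_of_bounded_of_integrable
    (G := fun z => I / (z + ε * I - x) * (cauchyInt f (z + δ * I) * cauchyInt g (z + δ * I)))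
    (M := ε⁻¹ * ((δ⁻¹ * ∫ t, ‖f t‖) * (δ⁻¹ * ∫ t, ‖g t‖)))
    (hk.continuousOn.mul ((hdf.continuousOn.mono hs0).mul (hdg.continuousOn.mono hs0)))
    ((hk.mono hs1).mul ((hdf.mono (hs1.trans hs0)).mul (hdg.mono (hs1.trans hs0)))) ?_ hi⟩
  intro z hz
  have h1 := norm_cauchyInt_le hf hδ (z := z + δ * I) (by simpa using hz)
  have h2 := norm_cauchyInt_le hg hδ (z := z + δ * I) (by simpa using hz)
  have h3 := hb z hz
  rw [norm_mul, norm_mul]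
  gcongr

/-- Real part of the preceding vanishing integral, with each factor split into its Poisson and
conjugate parts. -/
theorem integral_conj_products {p q : ℝ≥0∞} [p.HolderConjugate q]
    (hp : 1 < p) (hp' : p ≠ ∞) (hq : 1 < q) (hq' : q ≠ ∞) {f g : ℝ → ℝ} (hf : Integrable f)
    (hfp : MemLp f p) (hg : Integrable g) (hgq : MemLp g q) {ε δ : ℝ} (hε : 0 < ε) (hδ : 0 < δ)
    (x : ℝ) :
    (∫ t, ε / ((x - t) ^ 2 + ε ^ 2) * (poissonInt δ f t * poissonInt δ g t)) -
      (∫ t, ε / ((x - t) ^ 2 + ε ^ 2) * (conjInt δ f t * conjInt δ g t)) +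
      ((∫ t, (x - t) / ((x - t) ^ 2 + ε ^ 2) * (poissonInt δ f t * conjInt δ g t)) +
      ∫ t, (x - t) / ((x - t) ^ 2 + ε ^ 2) * (conjInt δ f t * poissonInt δ g t)) = 0 := by
  obtain ⟨hi, h0⟩ := integral_kernel_mul_cauchyInt_mul_cauchyInt hp hp' hq hq' hf hfp hg hgq hε hδ x
  have hPf := memLp_poissonInt hδ hp.le hp' hfp
  have hPg := memLp_poissonInt hδ hq.le hq' hgq
  have hQf := memLp_conjInt hδ hp hp' hf
  have hQg := memLp_conjInt hδ hq hq' hg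
  have hk : ∀ {a b : ℝ → ℝ}, MemLp a p → MemLp b q →
      Integrable fun t => ε / ((x - t) ^ 2 + ε ^ 2) * (a t * b t) := fun ha hb =>
    (ha.integrable_mul hb).bdd_mul (c := (1 + ε⁻¹))
      (by fun_prop : Measurable _).aestronglyMeasurable
      (Eventually.of_forall fun t => (abs_poissonKernel_le hε (x - t)).trans
        (mul_le_of_le_one_right (by positivity)
          (inv_le_one_of_one_le₀ (by linarith [abs_nonneg (x - t)]))))
  have hj : ∀ {a b : ℝ → ℝ}, MemLp a p → MemLp b q →
      Integrable fun t => (x - t) / ((x - t) ^ 2 + ε ^ 2) * (a t * b t) := fun ha hb =>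
    (ha.integrable_mul hb).bdd_mul (c := ε⁻¹) (by fun_prop : Measurable _).aestronglyMeasurable
      (Eventually.of_forall fun t => abs_conjKernel_le_inv hε (x - t))
  have h1 := reCLM.integral_comp_comm hi
  rw [h0, map_zero] at h1
  have e1 : Integrable fun t => ε / ((x - t) ^ 2 + ε ^ 2) * (poissonInt δ f t * poissonInt δ g t) -
      ε / ((x - t) ^ 2 + ε ^ 2) * (conjInt δ f t * conjInt δ g t) :=
    (hk hPf hPg).sub (hk hQf hQg)
  have e2 : Integrable fun t =>
      (x - t) / ((x - t) ^ 2 + ε ^ 2) * (poissonInt δ f t * conjInt δ g t) +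
      (x - t) / ((x - t) ^ 2 + ε ^ 2) * (conjInt δ f t * poissonInt δ g t) :=
    (hj hPf hQg).add (hj hQf hPg)
  rw [← integral_sub (hk hPf hPg) (hk hQf hQg), ← integral_add (hj hPf hQg) (hj hQf hPg),
    ← integral_add e1 e2, ← h1]
  refine integral_congr_ae (Eventually.of_forall fun t => ?_)
  simp only
  rw [cauchyInt_eq hf hδ, cauchyInt_eq hg hδ, I_div_sub_eq hε, ← neg_sub x t, neg_sq, neg_div]
  simp [-ofReal_div]
  ring

/-- Tricomi's identity, regularized by the Poisson kernel. -/
theorem poissonInt_tricomi {p q : ℝ≥0∞} [p.HolderConjugate q]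
    (hp : 1 < p) (hp' : p ≠ ∞) (hq : 1 < q) (hq' : q ≠ ∞) {f g : ℝ → ℝ} (hf : Integrable f)
    (hfp : MemLp f p) (hg : Integrable g) (hgq : MemLp g q) {ε : ℝ} (hε : 0 < ε) (x : ℝ) :
    Real.pi * conjInt ε (fun t => f t * hilbert g t + hilbert f t * g t) x =
      poissonInt ε (fun t => hilbert f t * hilbert g t - Real.pi ^ 2 * (f t * g t)) x := by
  have hHf := memLp_hilbert hp hp' hf hfp
  have hHg := memLp_hilbert hq hq' hg hgq
  have hPf : ∀ᶠ δ in 𝓝[>] (0 : ℝ), MemLp (poissonInt δ f) p := by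
    filter_upwards [self_mem_nhdsWithin] with δ hδ using memLp_poissonInt hδ hp.le hp' hfp
  have hPg : ∀ᶠ δ in 𝓝[>] (0 : ℝ), MemLp (poissonInt δ g) q := by
    filter_upwards [self_mem_nhdsWithin] with δ hδ using memLp_poissonInt hδ hq.le hq' hgq
  have hQf : ∀ᶠ δ in 𝓝[>] (0 : ℝ), MemLp (conjInt δ f) p := by
    filter_upwards [self_mem_nhdsWithin] with δ hδ using memLp_conjInt hδ hp hp' hf
  have hQg : ∀ᶠ δ in 𝓝[>] (0 : ℝ), MemLp (conjInt δ g) q := by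
    filter_upwards [self_mem_nhdsWithin] with δ hδ using memLp_conjInt hδ hq hq' hg
  have lPf := tendsto_eLpNorm_poissonInt_sub hp.le hp' hfp
  have lPg := tendsto_eLpNorm_poissonInt_sub hq.le hq' hgq
  have lQf := tendsto_eLpNorm_conjInt_sub_hilbert hp hp' hf hfp
  have lQg := tendsto_eLpNorm_conjInt_sub_hilbert hq hq' hg hgq
  have hpf : MemLp (fun t => Real.pi * f t) p := hfp.const_mul _
  have hpg : MemLp (fun t => Real.pi * g t) q := hgq.const_mul _
  have mk : AEStronglyMeasurable fun t : ℝ => ε / ((x - t) ^ 2 + ε ^ 2) :=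
    (by fun_prop : Measurable _).aestronglyMeasurable
  have mj : AEStronglyMeasurable fun t : ℝ => (x - t) / ((x - t) ^ 2 + ε ^ 2) :=
    (by fun_prop : Measurable _).aestronglyMeasurable
  have bk : ∀ t : ℝ, |ε / ((x - t) ^ 2 + ε ^ 2)| ≤ 1 + ε⁻¹ := fun t =>
    (abs_poissonKernel_le hε (x - t)).trans (mul_le_of_le_one_right (by positivity)
      (inv_le_one_of_one_le₀ (by linarith [abs_nonneg (x - t)])))
  have bj : ∀ t : ℝ, |(x - t) / ((x - t) ^ 2 + ε ^ 2)| ≤ ε⁻¹ := fun t =>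
    abs_conjKernel_le_inv hε (x - t)
  have l1 := tendsto_integral_mul_mul hPf hpf hPg hpg mk bk lPf lPg
  have l2 := tendsto_integral_mul_mul hQf hHf hQg hHg mk bk lQf lQg
  have l3 := tendsto_integral_mul_mul hPf hpf hQg hHg mj bj lPf lQg
  have l4 := tendsto_integral_mul_mul hQf hHf hPg hpg mj bj lQf lPg
  -- Let `δ → 0` in `integral_conj_products`, with `ε` fixed: Poisson integrals tend to `π` times
  -- the function, conjugate ones to the Hilbert transform.
  have hlim := (l1.sub l2).add (l3.add l4)
  have hz : (∫ t, ε / ((x - t) ^ 2 + ε ^ 2) * (Real.pi * f t * (Real.pi * g t))) -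
      (∫ t, ε / ((x - t) ^ 2 + ε ^ 2) * (hilbert f t * hilbert g t)) +
      ((∫ t, (x - t) / ((x - t) ^ 2 + ε ^ 2) * (Real.pi * f t * hilbert g t)) +
      ∫ t, (x - t) / ((x - t) ^ 2 + ε ^ 2) * (hilbert f t * (Real.pi * g t))) = 0 := by
    refine tendsto_nhds_unique hlim (tendsto_const_nhds.congr' ?_)
    filter_upwards [self_mem_nhdsWithin] with δ hδ
    exact (integral_conj_products hp hp' hq hq' hf hfp hg hgq hε hδ x).symm
  have ik : ∀ {a b : ℝ → ℝ}, MemLp a p → MemLp b q →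
      Integrable fun t => ε / ((x - t) ^ 2 + ε ^ 2) * (a t * b t) := fun ha hb =>
    (ha.integrable_mul hb).bdd_mul mk (Eventually.of_forall bk)
  have ij : ∀ {a b : ℝ → ℝ}, MemLp a p → MemLp b q →
      Integrable fun t => (x - t) / ((x - t) ^ 2 + ε ^ 2) * (a t * b t) := fun ha hb =>
    (ha.integrable_mul hb).bdd_mul mj (Eventually.of_forall bj)
  rw [← integral_sub (ik hpf hpg) (ik hHf hHg), ← integral_add (ij hpf hHg) (ij hHf hpg),
    add_comm, add_eq_zero_iff_eq_neg, ← integral_neg] at hz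
  rw [conjInt, ← integral_const_mul, poissonInt]
  refine Eq.trans ?_ (hz.trans ?_)
  · congr 1; funext t; ring
  · congr 1; funext t; ring

/-- Tricomi's identity `H (f Hg + g Hf) = Hf Hg - π² f g` for the unnormalized Hilbert
transform. -/
theorem ae_tendsto_conjInt_tricomi {p q : ℝ≥0∞} [p.HolderConjugate q]
    (hp : 1 < p) (hp' : p ≠ ∞) (hq : 1 < q) (hq' : q ≠ ∞) {f g : ℝ → ℝ} (hf : Integrable f)
    (hfp : MemLp f p) (hg : Integrable g) (hgq : MemLp g q) :
    ∀ᵐ x, Tendsto (fun ε => conjInt ε (fun t => f t * hilbert g t + hilbert f t * g t) x) (𝓝[>] 0)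
      (𝓝 (hilbert f x * hilbert g x - Real.pi ^ 2 * (f x * g x))) := by
  have hHf := memLp_hilbert hp hp' hf hfp
  have hHg := memLp_hilbert hq hq' hg hgq
  have hi : MemLp (fun t => hilbert f t * hilbert g t - Real.pi ^ 2 * (f t * g t)) 1 := by
    rw [memLp_one_iff_integrable]
    exact (hHf.integrable_mul hHg).sub ((hfp.integrable_mul hgq).const_mul _)
  filter_upwards [ae_tendsto_poissonInt le_rfl hi] with x hx
  have h1 := hx.const_mul Real.pi⁻¹
  rw [inv_mul_cancel_left₀ Real.pi_ne_zero] at h1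
  refine h1.congr' ?_
  filter_upwards [self_mem_nhdsWithin] with ε hε
  rw [← poissonInt_tricomi hp hp' hq hq' hf hfp hg hgq hε, inv_mul_cancel_left₀ Real.pi_ne_zero]

end Tricomi

/-! ### The scale of exponents `(n + 1) / (d + 1)`. -/

section Exponents

open ENNReal

theorem MeasureTheory.MemLp.of_exponent_between {α E : Type*} [MeasurableSpace α] {μ : Measure α}
    [NormedAddCommGroup E] {f : α → E} {p s q : ℝ≥0∞} (hp0 : p ≠ 0) (hq' : q ≠ ∞) (hps : p ≤ s)
    (hsq : s ≤ q) (hp : MemLp f p μ) (hq : MemLp f q μ) : MemLp f s μ := by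
  have hs0 : s ≠ 0 := (lt_of_lt_of_le (pos_iff_ne_zero.2 hp0) hps).ne'
  have hs' : s ≠ ∞ := ne_top_of_le_ne_top hq' hsq
  have hq0 : q ≠ 0 := (lt_of_lt_of_le (pos_iff_ne_zero.2 hs0) hsq).ne'
  have hp' : p ≠ ∞ := ne_top_of_le_ne_top hs' hps
  refine ⟨hp.1, ?_⟩
  have h1 := hp.2
  have h2 := hq.2
  rw [eLpNorm_lt_top_iff_lintegral_rpow_enorm_lt_top hp0 hp'] at h1
  rw [eLpNorm_lt_top_iff_lintegral_rpow_enorm_lt_top hq0 hq'] at h2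
  rw [eLpNorm_lt_top_iff_lintegral_rpow_enorm_lt_top hs0 hs']
  have h3 : ∀ a, ‖f a‖ₑ ^ s.toReal ≤ ‖f a‖ₑ ^ p.toReal + ‖f a‖ₑ ^ q.toReal := by
    intro a
    rcases le_total ‖f a‖ₑ 1 with h | h
    · exact (ENNReal.rpow_le_rpow_of_exponent_ge h ((toReal_le_toReal hp' hs').2 hps)).trans
        le_self_add
    · exact (ENNReal.rpow_le_rpow_of_exponent_le h ((toReal_le_toReal hs' hq').2 hsq)).trans
        le_add_self
  refine (lintegral_mono h3).trans_lt ?_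
  rw [lintegral_add_left' (hp.1.enorm.pow_const _)]
  exact ENNReal.add_lt_top.2 ⟨h1, h2⟩

/-- The exponent `(n + 1) / (d + 1)`. -/
noncomputable def weightExp (n d : ℕ) : ℝ≥0∞ := ((n : ℝ≥0∞) + 1) / (d + 1)

theorem weightExp_inv (n d : ℕ) : (weightExp n d)⁻¹ = ((d : ℝ≥0∞) + 1) / (n + 1) := by
  rw [weightExp, ENNReal.inv_div] <;> simp

theorem weightExp_self (n : ℕ) : weightExp n n = 1 := by
  rw [weightExp, ENNReal.div_self] <;> simp

theorem weightExp_ne_top (n d : ℕ) : weightExp n d ≠ ∞ := by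
  simp [weightExp, ENNReal.div_eq_top]

theorem weightExp_anti {n d e : ℕ} (h : d ≤ e) : weightExp n e ≤ weightExp n d := by
  unfold weightExp
  gcongr

theorem weightExp_lt {n d e : ℕ} (h : d < e) : weightExp n e < weightExp n d := by
  rw [← ENNReal.inv_lt_inv, weightExp_inv, weightExp_inv]
  refine ENNReal.div_lt_div_right (by simp) (by simp) ?_
  exact_mod_cast Nat.succ_lt_succ h

theorem one_lt_weightExp {n d : ℕ} (h : d < n) : 1 < weightExp n d :=
  weightExp_self n ▸ weightExp_lt h

theorem one_le_weightExp {n d : ℕ} (h : d ≤ n) : 1 ≤ weightExp n d :=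
  weightExp_self n ▸ weightExp_anti h

/-- The inverse exponents `(d + 1) / (n + 1)` increase by `1 / (n + 1)` per degree: multiplication
by an `L^(n+1)` function costs exactly one degree. -/
theorem holderTriple_weightExp (n d : ℕ) :
    (weightExp n 0).HolderTriple (weightExp n d) (weightExp n (d + 1)) where
  inv_add_inv_eq_inv := by
    rw [weightExp_inv, weightExp_inv, weightExp_inv, ← ENNReal.add_div]
    congr 1
    push_cast
    ring

theorem holderConjugate_weightExp {n : ℕ} (hn : 1 ≤ n) :
    (weightExp n 0).HolderConjugate (weightExp n (n - 1)) := by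
  have h := holderTriple_weightExp n (n - 1)
  rwa [Nat.sub_add_cancel hn, weightExp_self] at h

/-- Membership in `L¹ ∩ L^((n+1)/(d+1))`. -/
def MemWeight (n d : ℕ) (g : ℝ → ℝ) : Prop := MemLp g 1 ∧ MemLp g (weightExp n d)

variable {n d : ℕ} {u g : ℝ → ℝ}

theorem MemWeight.memLp {e : ℕ} (hg : MemWeight n d g) (hde : d ≤ e) (he : e ≤ n) :
    MemLp g (weightExp n e) :=
  hg.1.of_exponent_between one_ne_zero (weightExp_ne_top n d) (one_le_weightExp he)
    (weightExp_anti hde) hg.2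

theorem MemWeight.mono {e : ℕ} (hg : MemWeight n d g) (hde : d ≤ e) (he : e ≤ n) :
    MemWeight n e g :=
  ⟨hg.1, hg.memLp hde he⟩

theorem MemWeight.integrable (hg : MemWeight n d g) : Integrable g :=
  memLp_one_iff_integrable.1 hg.1

theorem MemWeight.add (hu : MemWeight n d u) (hg : MemWeight n d g) :
    MemWeight n d fun t => u t + g t :=
  ⟨hu.1.add hg.1, hu.2.add hg.2⟩

theorem MemWeight.sub (hu : MemWeight n d u) (hg : MemWeight n d g) :
    MemWeight n d fun t => u t - g t :=
  ⟨hu.1.sub hg.1, hu.2.sub hg.2⟩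

theorem MemWeight.const_mul (hg : MemWeight n d g) (c : ℝ) :
    MemWeight n d fun t => c * g t :=
  ⟨hg.1.const_mul c, hg.2.const_mul c⟩

theorem MemWeight.congr (hu : MemWeight n d u) (h : u =ᵐ[volume] g) : MemWeight n d g :=
  ⟨(memLp_congr_ae h).1 hu.1, (memLp_congr_ae h).1 hu.2⟩

/-- Integrability of the product comes from the exponent of degree `n - 1`, conjugate to `n + 1`.
Asking this of `g` instead of `g ∈ L¹` allows `g` to be a Hilbert transform, which need not be
integrable. -/
theorem memWeight_mul (hu : MemLp u (weightExp n 0)) (hg : MemLp g (weightExp n d))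
    (hg' : MemLp g (weightExp n (n - 1))) (hd : d < n) :
    MemWeight n (d + 1) fun t => u t * g t := by
  have h1 := holderTriple_weightExp n d
  have h2 := holderConjugate_weightExp (n := n) (by omega)
  exact ⟨hg'.mul' hu, hg.mul' hu⟩

theorem MemWeight.mul (hu : MemLp u (weightExp n 0)) (hg : MemWeight n d g) (hd : d < n) :
    MemWeight n (d + 1) fun t => u t * g t :=
  memWeight_mul hu hg.2 (hg.memLp (by omega) (by omega)) hd

theorem MemWeight.memLp_hilbert {e : ℕ} (hg : MemWeight n d g) (hde : d ≤ e) (he : e < n) :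
    MemLp (hilbert g) (weightExp n e) :=
  _root_.memLp_hilbert (one_lt_weightExp he) (weightExp_ne_top n e) hg.integrable
    (hg.memLp hde he.le)

theorem MemWeight.mul_hilbert (hu : MemLp u (weightExp n 0)) (hg : MemWeight n d g) (hd : d < n) :
    MemWeight n (d + 1) fun t => u t * hilbert g t :=
  memWeight_mul hu (hg.memLp_hilbert le_rfl hd) (hg.memLp_hilbert (by omega) (by omega)) hd

theorem MemWeight.ae_tendsto_conjInt (hg : MemWeight n d g) (hd : d < n) :
    ∀ᵐ x, Tendsto (fun ε => conjInt ε g x) (𝓝[>] 0) (𝓝 (hilbert g x)) :=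
  _root_.ae_tendsto_conjInt (one_lt_weightExp hd) (weightExp_ne_top n d) hg.integrable hg.2

theorem MemWeight.hilbert_add (hu : MemWeight n d u) (hg : MemWeight n d g) (hd : d < n) :
    ∀ᵐ x, hilbert (fun t => u t + g t) x = hilbert u x + hilbert g x := by
  filter_upwards [hu.ae_tendsto_conjInt hd, hg.ae_tendsto_conjInt hd] with x h1 h2
  refine ((h1.add h2).congr' ?_).limUnder_eq
  filter_upwards [self_mem_nhdsWithin] with ε hε
  rw [conjInt_add hu.integrable hg.integrable hε]

theorem MemWeight.hilbert_sub (hu : MemWeight n d u) (hg : MemWeight n d g) (hd : d < n) :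
    ∀ᵐ x, hilbert (fun t => u t - g t) x = hilbert u x - hilbert g x := by
  filter_upwards [hu.ae_tendsto_conjInt hd, hg.ae_tendsto_conjInt hd] with x h1 h2
  refine ((h1.sub h2).congr' ?_).limUnder_eq
  filter_upwards [self_mem_nhdsWithin] with ε hε
  rw [conjInt_sub hu.integrable hg.integrable hε]

theorem MemWeight.hilbert_const_mul (hg : MemWeight n d g) (hd : d < n) (c : ℝ) :
    ∀ᵐ x, hilbert (fun t => c * g t) x = c * hilbert g x := by
  filter_upwards [hg.ae_tendsto_conjInt hd] with x h1
  refine ((h1.const_mul c).congr fun ε => ?_).limUnder_eq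
  rw [conjInt_const_mul]

theorem hilbert_congr_ae (h : u =ᵐ[volume] g) (x : ℝ) : hilbert u x = hilbert g x := by
  unfold hilbert
  congr 1
  funext ε
  refine integral_congr_ae ?_
  filter_upwards [h] with t ht
  rw [ht]

/-- Tricomi's identity: `H(u Hg + Hu g) = Hu Hg - π² u g`. -/
theorem MemWeight.hilbert_tricomi (hu : MemWeight n 0 u) (hg : MemWeight n d g) (hd : d < n) :
    ∀ᵐ x, hilbert (fun t => u t * hilbert g t + hilbert u t * g t) x =
      hilbert u x * hilbert g x - Real.pi ^ 2 * (u x * g x) := by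
  have h2 := holderConjugate_weightExp (n := n) (by omega)
  have h3 := ae_tendsto_conjInt_tricomi (one_lt_weightExp (by omega)) (weightExp_ne_top n 0)
    (one_lt_weightExp (n := n) (d := n - 1) (by omega)) (weightExp_ne_top n _) hu.integrable hu.2
    hg.integrable (hg.memLp (e := n - 1) (by omega) (by omega))
  filter_upwards [h3] with x hx using hx.limUnder_eq

theorem MemWeight.integral_hilbert_mul (hu : MemWeight n 0 u) (hg : MemWeight n d g) (hd : d < n) :
    ∫ x, hilbert u x * g x = -∫ x, u x * hilbert g x :=
  have := holderConjugate_weightExp (n := n) (by omega)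
  _root_.integral_hilbert_mul (one_lt_weightExp (by omega)) (weightExp_ne_top n 0)
    (one_lt_weightExp (n := n) (d := n - 1) (by omega)) (weightExp_ne_top n _) hu.integrable hu.2
    hg.integrable (hg.memLp (e := n - 1) (by omega) (by omega))

end Exponents

theorem memWeight_of_integrable_pow {n : ℕ} {r : ℝ → ℝ} (hr : ∀ x, 0 ≤ r x) (h1 : Integrable r)
    (h2 : Integrable fun t => r t ^ (n + 1)) : MemWeight n 0 r := by
  refine ⟨memLp_one_iff_integrable.2 h1, ?_⟩
  have e : weightExp n 0 = ((n + 1 : ℕ) : ENNReal) := by simp [weightExp]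
  rw [e, ← integrable_norm_rpow_iff h1.aestronglyMeasurable (by simp) (by simp)]
  refine h2.congr (Eventually.of_forall fun t => ?_)
  simp only [ENNReal.toReal_natCast, Real.rpow_natCast, Real.norm_of_nonneg (hr t)]

/-! ### The transform and the reducer through the Hilbert transform. -/

section Transform

variable {I : Set ℝ} {ρ : ℝ → ℝ} {n d : ℕ} {f g : ℝ → ℝ}

theorem setIntegral_mul_eq_indicator (hI : MeasurableSet I) (k : ℝ → ℝ) :
    ∫ t in I, k t * ρ t = ∫ t, k t * I.indicator ρ t := by
  rw [← integral_indicator hI]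
  refine integral_congr_ae (Eventually.of_forall fun t => ?_)
  simp only [Set.indicator_mul_right]

theorem reducerApprox_eq (hI : MeasurableSet I) (x ε : ℝ) :
    reducerApprox I ρ x ε = 2 * conjInt ε (I.indicator ρ) x := by
  rw [reducerApprox, conjInt, ← setIntegral_mul_eq_indicator hI]
  simp only [div_mul_eq_mul_div]

theorem ae_tendsto_reducerApprox (hI : MeasurableSet I) (hr : MemWeight n 0 (I.indicator ρ))
    (hn : 0 < n) :
    ∀ᵐ x, Tendsto (reducerApprox I ρ x) (𝓝[>] 0) (𝓝 (2 * hilbert (I.indicator ρ) x)) := by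
  filter_upwards [hr.ae_tendsto_conjInt hn] with x hx
  exact (hx.const_mul 2).congr fun ε => (reducerApprox_eq hI x ε).symm

theorem reducer_ae_eq (hI : MeasurableSet I) (hr : MemWeight n 0 (I.indicator ρ)) (hn : 0 < n) :
    (fun x => reducer I ρ x / 2) =ᵐ[volume] hilbert (I.indicator ρ) := by
  filter_upwards [ae_tendsto_reducerApprox hI hr hn] with x hx
  rw [reducer, hx.limUnder_eq]
  ring

/-- Separating `f t` from `f x` is legitimate before the limit, where both integrals converge
absolutely; the sign comes from `t - x` against `x - t`. -/
theorem transformApprox_eq (hI : MeasurableSet I) (hr : Integrable (I.indicator ρ))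
    (hf : Integrable fun t => f t * I.indicator ρ t) {ε : ℝ} (hε : 0 < ε) (x : ℝ) :
    transformApprox I ρ f x ε = f x * conjInt ε (I.indicator ρ) x -
      conjInt ε (fun t => f t * I.indicator ρ t) x := by
  rw [transformApprox, setIntegral_mul_eq_indicator hI, conjInt, conjInt, ← integral_const_mul,
    ← integral_sub ((integrable_conjKernel_mul hr hε x).const_mul _)
      (integrable_conjKernel_mul hf hε x)]
  refine integral_congr_ae (Eventually.of_forall fun t => ?_)
  simp only
  rw [← neg_sub x t, neg_sq]
  ring

theorem ae_tendsto_transformApprox (hI : MeasurableSet I) (hr : MemWeight n 0 (I.indicator ρ))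
    (hf : MemWeight n d fun t => f t * I.indicator ρ t) (hd : d < n) :
    ∀ᵐ x, Tendsto (transformApprox I ρ f x) (𝓝[>] 0)
      (𝓝 (f x * hilbert (I.indicator ρ) x - hilbert (fun t => f t * I.indicator ρ t) x)) := by
  filter_upwards [hr.ae_tendsto_conjInt (by omega), hf.ae_tendsto_conjInt hd] with x h1 h2
  refine ((h1.const_mul (f x)).sub h2).congr' ?_
  filter_upwards [self_mem_nhdsWithin] with ε hε
  exact (transformApprox_eq hI hr.integrable hf.integrable hε x).symm

theorem transform_ae_eq (hI : MeasurableSet I) (hr : MemWeight n 0 (I.indicator ρ))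
    (hf : MemWeight n d fun t => f t * I.indicator ρ t) (hd : d < n) :
    transform I ρ f =ᵐ[volume] fun x =>
      f x * hilbert (I.indicator ρ) x - hilbert (fun t => f t * I.indicator ρ t) x := by
  filter_upwards [ae_tendsto_transformApprox hI hr hf hd] with x hx using hx.limUnder_eq

theorem transformApprox_congr (h : f =ᵐ[volume.restrict I] g) {x : ℝ} (hx : f x = g x) (ε : ℝ) :
    transformApprox I ρ f x ε = transformApprox I ρ g x ε := by
  refine integral_congr_ae ?_
  filter_upwards [h] with t ht
  rw [ht, hx]

/-- The value at `x` depends on `f x` itself, so equality holds only where `f` and `g` agree; this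
suffices for the transform to act on germs. -/
theorem transform_congr (h : f =ᵐ[volume.restrict I] g) :
    transform I ρ f =ᵐ[volume.restrict I] transform I ρ g := by
  filter_upwards [h] with x hx
  rw [transform, transform, funext (transformApprox_congr h hx)]

theorem mul_indicator_congr (hI : MeasurableSet I) (h : f =ᵐ[volume.restrict I] g) :
    (fun t => f t * I.indicator ρ t) =ᵐ[volume] fun t => g t * I.indicator ρ t := by
  filter_upwards [(ae_restrict_iff' hI).1 h] with t ht
  by_cases hx : t ∈ I
  · rw [ht hx]
  · simp [hx]

theorem memWeight_reducer_mul (hI : MeasurableSet I) (hr : MemWeight n 0 (I.indicator ρ))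
    (hf : MemWeight n d fun t => f t * I.indicator ρ t) (hd : d < n) :
    MemWeight n (d + 1) fun t => reducer I ρ t / 2 * f t * I.indicator ρ t := by
  refine (MemWeight.mul (hr.memLp_hilbert le_rfl (by omega)) hf hd).congr ?_
  filter_upwards [reducer_ae_eq hI hr (by omega)] with t ht
  rw [← ht, mul_assoc]

theorem memWeight_sq_mul (hr : MemWeight n 0 (I.indicator ρ))
    (hf : MemWeight n d fun t => f t * I.indicator ρ t) (hd : d + 2 ≤ n) (c : ℝ) :
    MemWeight n (d + 2) fun t => c * ρ t ^ 2 * f t * I.indicator ρ t := by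
  have h1 := (MemWeight.mul hr.2 (MemWeight.mul hr.2 hf (by omega)) (by omega)).const_mul c
  refine h1.congr (Eventually.of_forall fun t => ?_)
  by_cases ht : t ∈ I
  · simp only [Set.indicator_of_mem ht]; ring
  · simp [ht]

theorem memWeight_transform (hI : MeasurableSet I) (hr : MemWeight n 0 (I.indicator ρ))
    (hf : MemWeight n d fun t => f t * I.indicator ρ t) (hd : d < n) :
    MemWeight n (d + 1) fun t => transform I ρ f t * I.indicator ρ t := by
  have h1 := (MemWeight.mul (hr.memLp_hilbert le_rfl (by omega)) hf hd).sub (hf.mul_hilbert hr.2 hd)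
  refine h1.congr ?_
  filter_upwards [transform_ae_eq hI hr hf hd] with t ht
  rw [ht]
  ring

/-- By antisymmetry `-∫ r H(f r) = ∫ (H r) f r`, so the two terms of the transform contribute
equally. -/
theorem integral_transform_mul (hI : MeasurableSet I) (hr : MemWeight n 0 (I.indicator ρ))
    (hf : MemWeight n d fun t => f t * I.indicator ρ t) (hd : d < n) :
    ∫ t in I, transform I ρ f t * ρ t = 2 * ∫ t in I, reducer I ρ t / 2 * f t * ρ t := by
  rw [setIntegral_mul_eq_indicator hI, setIntegral_mul_eq_indicator hI]
  have h1 := (MemWeight.mul (hr.memLp_hilbert le_rfl (by omega)) hf hd).integrable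
  have h2 := (hf.mul_hilbert hr.2 hd).integrable
  have e1 : ∫ t, transform I ρ f t * I.indicator ρ t =
      ∫ t, (hilbert (I.indicator ρ) t * (f t * I.indicator ρ t) -
        I.indicator ρ t * hilbert (fun t => f t * I.indicator ρ t) t) := by
    refine integral_congr_ae ?_
    filter_upwards [transform_ae_eq hI hr hf hd] with t ht
    rw [ht]
    ring
  have e2 : ∫ t, reducer I ρ t / 2 * f t * I.indicator ρ t =
      ∫ t, hilbert (I.indicator ρ) t * (f t * I.indicator ρ t) := by
    refine integral_congr_ae ?_
    filter_upwards [reducer_ae_eq hI hr (by omega)] with t ht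
    rw [← ht, mul_assoc]
  have e3 := hr.integral_hilbert_mul hf hd
  rw [e1, e2, integral_sub h1 h2]
  linarith

theorem transform_add (hI : MeasurableSet I) (hr : MemWeight n 0 (I.indicator ρ))
    (hf : MemWeight n d fun t => f t * I.indicator ρ t)
    (hg : MemWeight n d fun t => g t * I.indicator ρ t) (hd : d < n) :
    transform I ρ (f + g) =ᵐ[volume] transform I ρ f + transform I ρ g := by
  have e : (fun t => (f + g) t * I.indicator ρ t) =
      fun t => f t * I.indicator ρ t + g t * I.indicator ρ t :=
    funext fun t => add_mul _ _ _
  have hfg : MemWeight n d fun t => (f + g) t * I.indicator ρ t := e ▸ hf.add hg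
  filter_upwards [transform_ae_eq hI hr hf hd, transform_ae_eq hI hr hg hd,
    transform_ae_eq hI hr hfg hd, hf.hilbert_add hg hd] with x h1 h2 h3 h4
  rw [h3, e, h4, Pi.add_apply, Pi.add_apply, h1, h2]
  ring

theorem transform_smul (hI : MeasurableSet I) (hr : MemWeight n 0 (I.indicator ρ))
    (hf : MemWeight n d fun t => f t * I.indicator ρ t) (hd : d < n) (c : ℝ) :
    transform I ρ (c • f) =ᵐ[volume] c • transform I ρ f := by
  have e : (fun t => (c • f) t * I.indicator ρ t) = fun t => c * (f t * I.indicator ρ t) :=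
    funext fun t => mul_assoc _ _ _
  have hcf : MemWeight n d fun t => (c • f) t * I.indicator ρ t := e ▸ hf.const_mul c
  filter_upwards [transform_ae_eq hI hr hf hd, transform_ae_eq hI hr hcf hd,
    hf.hilbert_const_mul hd c] with x h1 h2 h3
  rw [h2, e, h3, Pi.smul_apply, Pi.smul_apply, h1, smul_eq_mul, smul_eq_mul]
  ring

/-- With `a` the transform, `b` the multiplication by half the reducer and `c` the multiplication
by `π² ρ²`, Tricomi's identity reads `2 a b = a² + b² + c`. -/
theorem transform_reducer_mul (hI : MeasurableSet I) (hr : MemWeight n 0 (I.indicator ρ))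
    (hf : MemWeight n d fun t => f t * I.indicator ρ t) (hd : d + 2 ≤ n) :
    ∀ᵐ x ∂(volume.restrict I), 2 * transform I ρ (fun t => reducer I ρ t / 2 * f t) x =
      transform I ρ (transform I ρ f) x + reducer I ρ x / 2 * (reducer I ρ x / 2 * f x) +
        Real.pi ^ 2 * ρ x ^ 2 * f x := by
  set r := I.indicator ρ with hrd
  set g : ℝ → ℝ := fun t => f t * r t with hg
  have hb := memWeight_reducer_mul hI hr hf (by omega)
  have ha := memWeight_transform hI hr hf (by omega)
  have hu := MemWeight.mul (hr.memLp_hilbert le_rfl (by omega)) hf (by omega)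
  have hv := hf.mul_hilbert hr.2 (by omega)
  have h1 := reducer_ae_eq hI hr (by omega)
  have h2 := transform_ae_eq hI hr hf (by omega)
  have h3 := transform_ae_eq hI hr hb (by omega)
  have h4 := transform_ae_eq hI hr ha (by omega)
  have e3 : (fun t => reducer I ρ t / 2 * f t * r t) =ᵐ[volume] fun t => hilbert r t * g t := by
    filter_upwards [h1] with t ht
    rw [hg, ← ht, mul_assoc]
  have e4 : (fun t => transform I ρ f t * r t) =ᵐ[volume]
      fun t => hilbert r t * g t - r t * hilbert g t := by
    filter_upwards [h2] with t ht
    rw [ht]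
    simp only [hg]
    ring
  -- Tricomi's identity for `r` and `g = f r`. Additivity of `H` is needed on `r Hg` and `g Hr`,
  -- both of degree `d + 1`, which is why `d + 2 ≤ n`.
  have h5 := hr.hilbert_tricomi hf (by omega)
  have h6 := hv.hilbert_add hu (by omega)
  have h7 := hu.hilbert_sub hv (by omega)
  have hI' := ae_restrict_mem (μ := volume) hI
  filter_upwards [hI', ae_restrict_of_ae h1, ae_restrict_of_ae h2, ae_restrict_of_ae h3,
    ae_restrict_of_ae h4, ae_restrict_of_ae h5, ae_restrict_of_ae h6, ae_restrict_of_ae h7]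
    with x hx k1 k2 k3 k4 k5 k6 k7
  have hrx : r x = ρ x := Set.indicator_of_mem hx ρ
  rw [k3, k4, k2, k1, hilbert_congr_ae e3, hilbert_congr_ae e4, k7]
  rw [k6] at k5
  have hgx : g x = f x * ρ x := by rw [← hrx]
  rw [hrx, hgx] at k5
  linear_combination (-1) * k5

end Transform

/-! ### Passage to linear maps on germs, and the integral formula. -/

section Germ

variable {I : Set ℝ} {ρ : ℝ → ℝ} {n d : ℕ} {f g : ℝ → ℝ}

/-- Germs of functions on `I` up to null sets. -/
abbrev AEGerm (I : Set ℝ) : Type := Germ (ae (volume.restrict I)) ℝ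

/-- The germs of the functions `f` for which `f ρ` belongs to `L¹ ∩ L^((n+1)/(d+1))`. -/
noncomputable def weightSpace (I : Set ℝ) (ρ : ℝ → ℝ) (n d : ℕ) : Submodule ℝ (AEGerm I) where
  carrier := {F | ∃ f : ℝ → ℝ, F = f ∧ MemWeight n d fun t => f t * I.indicator ρ t}
  add_mem' := by
    rintro _ _ ⟨f, rfl, hf⟩ ⟨g, rfl, hg⟩
    refine ⟨f + g, rfl, ?_⟩
    simpa only [Pi.add_apply, add_mul] using hf.add hg
  zero_mem' := ⟨0, rfl, by simp [MemWeight]⟩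
  smul_mem' := by
    rintro c _ ⟨f, rfl, hf⟩
    refine ⟨c • f, rfl, ?_⟩
    simpa only [Pi.smul_apply, smul_eq_mul, mul_assoc] using hf.const_mul c

theorem coe_mem_weightSpace (hI : MeasurableSet I) :
    (f : AEGerm I) ∈ weightSpace I ρ n d ↔ MemWeight n d fun t => f t * I.indicator ρ t := by
  refine ⟨?_, fun h => ⟨f, rfl, h⟩⟩
  rintro ⟨g, hfg, hg⟩
  exact hg.congr (mul_indicator_congr hI (Germ.coe_eq.1 hfg).symm)

/-- Multiplication by a function, as an operator on germs. -/
noncomputable def germMul (I : Set ℝ) (u : ℝ → ℝ) : AEGerm I →ₗ[ℝ] AEGerm I where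
  toFun F := u * F
  map_add' F G := mul_add _ F G
  map_smul' c F := by
    refine Germ.inductionOn F fun f => Germ.coe_eq.2 (Eventually.of_forall fun t => ?_)
    exact mul_left_comm _ _ _

theorem germMul_coe (u : ℝ → ℝ) : germMul I u f = ((fun t => u t * f t : ℝ → ℝ) : AEGerm I) := rfl

theorem germMul_pow_coe (u : ℝ → ℝ) (k : ℕ) :
    (germMul I u ^ k) f = ((fun t => u t ^ k * f t : ℝ → ℝ) : AEGerm I) := by
  induction k with
  | zero => simp
  | succ k ih =>
    rw [pow_succ', Module.End.mul_apply, ih, germMul_coe]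
    refine Germ.coe_eq.2 (Eventually.of_forall fun t => ?_)
    simp only
    ring

/-- The transform is linear only almost everywhere and only on `weightSpace`, whence germs; an
arbitrary linear extension to all germs is harmless, because the filtered relations never look
outside that space. -/
theorem exists_linearMap_transform (hI : MeasurableSet I) (hr : MemWeight n 0 (I.indicator ρ))
    (hd : d < n) :
    ∃ a : AEGerm I →ₗ[ℝ] AEGerm I, ∀ f : ℝ → ℝ, (f : AEGerm I) ∈ weightSpace I ρ n d →
      a f = (transform I ρ f : ℝ → ℝ) := by
  let T : AEGerm I → AEGerm I := fun F => Germ.map' (transform I ρ) (fun _ _ => transform_congr) F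
  let a₀ : weightSpace I ρ n d →ₗ[ℝ] AEGerm I :=
    { toFun := fun F => T F.1
      map_add' := by
        rintro ⟨_, f, rfl, hf⟩ ⟨_, g, rfl, hg⟩
        exact Germ.coe_eq.2 (ae_restrict_of_ae (transform_add hI hr hf hg hd))
      map_smul' := by
        rintro c ⟨_, f, rfl, hf⟩
        exact Germ.coe_eq.2 (ae_restrict_of_ae (transform_smul hI hr hf hd c)) }
  obtain ⟨a, ha⟩ := a₀.exists_extend
  exact ⟨a, fun f hf => LinearMap.congr_fun ha ⟨f, hf⟩⟩

theorem integrableOn_of_memWeight (hI : MeasurableSet I)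
    (hf : MemWeight n d fun t => f t * I.indicator ρ t) :
    IntegrableOn (fun t => f t * ρ t) I := by
  rw [← integrable_indicator_iff hI]
  refine hf.integrable.congr (Eventually.of_forall fun t => ?_)
  simp only [Set.indicator_mul_right]

theorem exists_linearMap_integral (hI : MeasurableSet I) :
    ∃ L : AEGerm I →ₗ[ℝ] ℝ, ∀ f : ℝ → ℝ, (f : AEGerm I) ∈ weightSpace I ρ n d →
      L f = ∫ t in I, f t * ρ t := by
  let S : AEGerm I → ℝ := fun F => Germ.liftOn F (fun f => ∫ t in I, f t * ρ t)
    fun f g hfg => integral_congr_ae (hfg.mul EventuallyEq.rfl)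
  let L₀ : weightSpace I ρ n d →ₗ[ℝ] ℝ :=
    { toFun := fun F => S F.1
      map_add' := by
        rintro ⟨_, f, rfl, hf⟩ ⟨_, g, rfl, hg⟩
        refine Eq.trans ?_ (integral_add (integrableOn_of_memWeight hI hf) (integrableOn_of_memWeight hI hg))
        exact integral_congr_ae (Eventually.of_forall fun t => add_mul _ _ _)
      map_smul' := by
        rintro c ⟨_, f, rfl, hf⟩
        refine Eq.trans ?_ (integral_const_mul c _)
        exact integral_congr_ae (Eventually.of_forall fun t => mul_assoc _ _ _) }
  obtain ⟨L, hL⟩ := L₀.exists_extend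
  exact ⟨L, fun f hf => LinearMap.congr_fun hL ⟨f, hf⟩⟩

theorem memWeight_iterate_transform (hI : MeasurableSet I) (hr : MemWeight n 0 (I.indicator ρ))
    (hf : MemWeight n d fun t => f t * I.indicator ρ t) {j : ℕ} (hd : d + j ≤ n) :
    MemWeight n (d + j) fun t => (transform I ρ)^[j] f t * I.indicator ρ t := by
  induction j with
  | zero => exact hf
  | succ j ih =>
    rw [Function.iterate_succ_apply']
    exact memWeight_transform (d := d + j) hI hr (ih (by omega)) (by omega)

theorem memWeight_pow (hr : MemWeight n 0 (I.indicator ρ)) {k : ℕ} (hk : 2 * k ≤ n) :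
    MemWeight n (2 * k) fun t => ρ t ^ (2 * k) * I.indicator ρ t := by
  induction k with
  | zero => simpa using hr
  | succ k ih =>
    have h := memWeight_sq_mul hr (ih (by omega)) (by omega) 1
    refine h.congr (Eventually.of_forall fun t => ?_)
    simp only
    ring

theorem memWeight_reducer_pow (hI : MeasurableSet I) (hr : MemWeight n 0 (I.indicator ρ))
    {m : ℕ} (hm : m ≤ n) :
    MemWeight n m fun t => (reducer I ρ t / 2) ^ m * I.indicator ρ t := by
  induction m with
  | zero => simpa using hr
  | succ m ih =>
    have h := memWeight_reducer_mul hI hr (ih (by omega)) (by omega)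
    refine h.congr (Eventually.of_forall fun t => ?_)
    simp only
    ring

theorem pow_linearMap_transform {a : AEGerm I →ₗ[ℝ] AEGerm I} (hI : MeasurableSet I)
    (hr : MemWeight n 0 (I.indicator ρ))
    (ha : ∀ f : ℝ → ℝ, (f : AEGerm I) ∈ weightSpace I ρ n (n - 1) →
      a f = (transform I ρ f : ℝ → ℝ))
    (hf : MemWeight n d fun t => f t * I.indicator ρ t) {j : ℕ} (hd : d + j ≤ n) :
    (a ^ j) f = ((transform I ρ)^[j] f : AEGerm I) := by
  induction j with
  | zero => rfl
  | succ j ih =>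
    rw [pow_succ', Module.End.mul_apply, ih (by omega), Function.iterate_succ_apply']
    refine ha _ ((coe_mem_weightSpace hI).2 ?_)
    exact (memWeight_iterate_transform hI hr hf (j := j) (by omega)).mono (by omega) (by omega)

theorem integral_reducer_pow_mul (hI : MeasurableSet I) (hr : MemWeight n 0 (I.indicator ρ))
    (hn : 1 ≤ n) :
    ((n : ℝ) + 1) * ∫ t in I, (reducer I ρ t / 2) ^ n * ρ t =
      ∑ k ∈ Finset.range ((n + 1) / 2 + 1), Real.pi ^ (2 * k) * (uCoeff n k : ℝ) *
        ∫ t in I, (transform I ρ)^[n - 2 * k] (fun s => ρ s ^ (2 * k)) t * ρ t := by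
  -- Degree `n - 1` is the largest space on which the transform is controlled and contains those of
  -- every degree `d < n`; the integral is taken on degree `n`, one step further.
  obtain ⟨a, ha⟩ := exists_linearMap_transform (d := n - 1) hI hr (by omega)
  obtain ⟨L, hL⟩ := exists_linearMap_integral (ρ := ρ) (n := n) (d := n) hI
  have ha' : ∀ {d : ℕ}, d < n → ∀ {f : ℝ → ℝ},
      (MemWeight n d fun t => f t * I.indicator ρ t) → a f = (transform I ρ f : ℝ → ℝ) :=
    fun hd f hf => ha f ((coe_mem_weightSpace hI).2 (hf.mono (by omega) (by omega)))
  have hL' : ∀ {d : ℕ}, d ≤ n → ∀ {f : ℝ → ℝ},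
      (MemWeight n d fun t => f t * I.indicator ρ t) → L f = ∫ t in I, f t * ρ t :=
    fun hd f hf => hL f ((coe_mem_weightSpace hI).2 (hf.mono hd le_rfl))
  have H : FilteredTriple a (germMul I fun t => reducer I ρ t / 2)
      (germMul I fun t => Real.pi ^ 2 * ρ t ^ 2) (weightSpace I ρ n) n :=
    { map_b := by
        rintro d hd _ ⟨f, rfl, hf⟩
        exact ⟨_, germMul_coe _, memWeight_reducer_mul hI hr hf hd⟩
      map_c := by
        rintro d hd _ ⟨f, rfl, hf⟩
        exact ⟨_, germMul_coe _, memWeight_sq_mul hr hf hd _⟩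
      comm := fun F => mul_left_comm _ _ _
      rel := by
        rintro d hd _ ⟨f, rfl, hf⟩
        rw [germMul_coe, germMul_coe, germMul_coe, ha' (by omega) hf,
          ha' (by omega) (memWeight_reducer_mul hI hr hf (by omega)),
          ha' (by omega) (memWeight_transform hI hr hf (by omega))]
        exact Germ.coe_eq.2 (transform_reducer_mul hI hr hf hd) }
  have hLa : ∀ d < n, ∀ F ∈ weightSpace I ρ n d,
      L (a F) = 2 * L (germMul I (fun t => reducer I ρ t / 2) F) := by
    rintro d hd _ ⟨f, rfl, hf⟩
    rw [germMul_coe, ha' hd hf, hL' hd (memWeight_transform hI hr hf hd),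
      hL' hd (memWeight_reducer_mul hI hr hf hd)]
    exact integral_transform_mul hI hr hf hd
  have h1 : MemWeight n 0 fun t => (1 : ℝ → ℝ) t * I.indicator ρ t := by simpa using hr
  have key := H.functional hLa (f := ((1 : ℝ → ℝ) : AEGerm I)) (d := 0) (K := (n + 1) / 2 + 1) n
    ⟨1, rfl, h1⟩ (by omega) (by omega)
  have e1 : L ((germMul I (fun t => reducer I ρ t / 2) ^ n) ((1 : ℝ → ℝ) : AEGerm I)) =
      ∫ t in I, (reducer I ρ t / 2) ^ n * ρ t := by
    rw [germMul_pow_coe]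
    simp only [Pi.one_apply, mul_one]
    exact hL' le_rfl (memWeight_reducer_pow hI hr le_rfl)
  rw [e1] at key
  rw [key]
  refine Finset.sum_congr rfl fun k hk => ?_
  rcases lt_or_ge n (2 * k) with hkn | hkn
  -- This happens only for `n` odd and `2k = n + 1`. The exponent `n - 2 * k` then truncates to `0`,
  -- and the vanishing coefficient makes the term irrelevant.
  · have hk' : k = (n + 1) / 2 := by have := Finset.mem_range.1 hk; omega
    have hu : uCoeff n k = 0 := by
      rw [hk']
      exact uCoeff_top_eq_zero (Nat.not_even_iff_odd.1 fun ⟨m, hm⟩ => by omega)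
    simp [hu]
  · have e2 : (germMul I (fun t => Real.pi ^ 2 * ρ t ^ 2) ^ k) ((1 : ℝ → ℝ) : AEGerm I) =
        Real.pi ^ (2 * k) • ((fun s => ρ s ^ (2 * k) : ℝ → ℝ) : AEGerm I) := by
      rw [germMul_pow_coe]
      refine Germ.coe_eq.2 (Eventually.of_forall fun t => ?_)
      simp [mul_pow, pow_mul]
    have hk2 := memWeight_pow hr hkn
    rw [e2, map_smul, map_smul, pow_linearMap_transform hI hr ha hk2 (by omega),
      hL' (by omega) (memWeight_iterate_transform hI hr hk2 (by omega)), smul_eq_mul]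
    ring

end Germ

theorem mainTheorem11 (I : Set ℝ) (hI : I.OrdConnected) (ρ : ℝ → ℝ)
    (hρ_nonneg : ∀ x ∈ I, 0 ≤ ρ x) (hρ_int : IntegrableOn ρ I) (hρ_one : ∫ t in I, ρ t = 1)
    (hρ_red : IsReducibleDensity I ρ)
    (n : ℕ) (hn : 1 ≤ n) (hρ_pow : IntegrableOn (fun t => ρ t ^ (n + 1)) I) :
    -- the limit that defines the reducer exists
    (∀ᵐ x ∂(volume.restrict I), ∃ l, Tendsto (reducerApprox I ρ x) (𝓝[>] 0) (𝓝 l)) ∧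
    -- the limits that define the iterates of the transform exist
    (∀ k j : ℕ, j + 2 * k < n → ∀ᵐ x ∂(volume.restrict I), ∃ l,
      Tendsto (transformApprox I ρ ((transform I ρ)^[j] fun t => ρ t ^ (2 * k)) x)
        (𝓝[>] 0) (𝓝 l)) ∧
    -- the integrands are integrable
    IntegrableOn (fun t => (reducer I ρ t / 2) ^ n * ρ t) I ∧
    (∀ k : ℕ, 2 * k ≤ n →
      IntegrableOn (fun t => (transform I ρ)^[n - 2 * k] (fun s => ρ s ^ (2 * k)) t * ρ t) I) ∧
    -- for `n` odd the last term, `2 * k = n + 1`, has coefficient zero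
    (Odd n → uCoeff n ((n + 1) / 2) = 0) ∧
    ((n : ℝ) + 1) * ∫ t in I, (reducer I ρ t / 2) ^ n * ρ t =
      ∑ k ∈ Finset.range ((n + 1) / 2 + 1), Real.pi ^ (2 * k) * (uCoeff n k : ℝ) *
        ∫ t in I, (transform I ρ)^[n - 2 * k] (fun s => ρ s ^ (2 * k)) t * ρ t := by
  have hIm : MeasurableSet I := hI.measurableSet
  -- The density extended by zero lies in `L¹ ∩ L^(n+1)`, that is, the constant `1` has degree 0.
  have hr : MemWeight n 0 (I.indicator ρ) := by
    refine memWeight_of_integrable_pow (fun x => Set.indicator_nonneg hρ_nonneg x)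
      ((integrable_indicator_iff hIm).2 hρ_int) ?_
    refine ((integrable_indicator_iff hIm).2 hρ_pow).congr (Eventually.of_forall fun t => ?_)
    by_cases ht : t ∈ I <;> simp [ht]
  refine ⟨?_, ?_, ?_, ?_, uCoeff_top_eq_zero, integral_reducer_pow_mul hIm hr hn⟩
  · filter_upwards [ae_restrict_of_ae (ae_tendsto_reducerApprox hIm hr hn)] with x hx using ⟨_, hx⟩
  · intro k j hjk
    have h := memWeight_iterate_transform hIm hr (memWeight_pow hr (k := k) (by omega))
      (j := j) (by omega)
    filter_upwards [ae_restrict_of_ae (ae_tendsto_transformApprox hIm hr h (by omega))]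
      with x hx using ⟨_, hx⟩
  · exact integrableOn_of_memWeight hIm (memWeight_reducer_pow hIm hr le_rfl)
  · intro k hk
    exact integrableOn_of_memWeight hIm
      (memWeight_iterate_transform hIm hr (memWeight_pow hr hk) (by omega))
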